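/- Let $1\le k\le n$ and let $B_1$ be the open unit ball of $\mathbb R^n$. Let $\mathrm{Sym}_n$ and $\mathrm{Sym}_n^+$ be the sets of symmetric, respectively positive definite symmetric, real $n\times n$ matrices, let $\lambda(M)\in\mathbb R^n$ be the vector of eigenvalues of $M\in\mathrm{Sym}_n$, and for $1\le j\le n$ let $\Gamma_j^+=\{\lambda\in\mathbb R^n:\sigma_1(\lambda)>0,\dots,\sigma_j(\lambda)>0\}$, where $\sigma_i$ is the $i$-th elementary symmetric function. Let $(f,\Gamma)$ be a pair such that $\Gamma\subset\mathbb R^n$ is an open symmetric cone with vertex at the origin, $\Gamma+\Gamma_n^+\subset\Gamma$, $f\in C^1(\Gamma)\cap C^0(\overline\Gamma)$ is homogeneous of degree one, $f>0$ and $\partial f/\partial\lambda_i>0$ in $\Gamma$ for all $i$, and $f=0$ on $\partial\Gamma$. Let $W\in C^2(\overline B_1,\mathrm{Sym}_n^+)$, let $R>0$ be a function on $B_1$, and let $L\in C^2(\overline B_1\times\mathbb R^n,\mathrm{Sym}_n)$ be of the form $L=L_0+L_1+L_2$ with $L_m(x,rp)=r^mL_m(x,p)$ for $m=0,1,2$.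 For a $C^2$ function $\varphi$ put $\Lambda_\varphi(x)=\lambda\bigl(W(x)\,(D^2\varphi(x)+L(x,D\varphi(x)))\,W(x)\bigr)$, and consider the equation $$f(\Lambda_w)=R\,e^{2w},\qquad \Lambda_w\in\Gamma\qquad\text{in }B_1. \tag{1}$$ A function $w\in C(B_1)$ is a viscosity solution of (1) if for every $x_0\in B_1$ and every $\varphi\in C^2$ with $\varphi(x_0)=w(x_0)$: if $\varphi\ge w$ near $x_0$, then $\Lambda_\varphi(x_0)\in\Gamma$ and $f(\Lambda_\varphi(x_0))\ge R(x_0)e^{2\varphi(x_0)}$; and if $\varphi\le w$ near $x_0$, then either $\Lambda_\varphi(x_0)\in\Gamma$ and $f(\Lambda_\varphi(x_0))\le R(x_0)e^{2\varphi(x_0)}$, or $\Lambda_\varphi(x_0)\in\mathbb R^n\setminus\Gamma$. A paraboloid is a polynomial of degree at most $2$. A function $v\in C(B_1)$ is $k$-convex (in the viscosity sense) if $\lambda(D^2\varphi(x_0))\in\Gamma_k^+$ for every $x_0\in B_1$ and every paraboloid $\varphi$ with $\varphi(x_0)=v(x_0)$ and $\varphi\ge v$ near $x_0$. A function $w$ is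 punctually second order differentiable at $x_0$ if $w(x)=P(x)+o(|x-x_0|^2)$ as $x\to x_0$ for some paraboloid $P$. Theorem. Suppose $\Gamma\subset\Gamma_k^+$, and let $w\in C^{0,1}(B_1)$ be a Lipschitz viscosity solution of (1). Assume that either $k>n/2$ and $W(x)$ is the identity matrix for all $x\in B_1$, or $k=n$. Then there is a constant $C\ge 0$, depending only on $n$, $L$ and the Lipschitz constant of $w$, such that $w+C|x|^2$ is $k$-convex on $B_1$; moreover, $w$ is punctually second order differentiable almost everywhere in $B_1$. -/

import Mathlib

open Set Filter Topology MeasureTheory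
open scoped NNReal

noncomputable section

/-- Euclidean space `ℝⁿ`. -/
abbrev Euc (n : ℕ) : Type := EuclideanSpace ℝ (Fin n)

/-- The open unit ball `B₁ ⊂ ℝⁿ`. -/
abbrev unitBall (n : ℕ) : Set (Euc n) := Metric.ball 0 1

/-- The closed unit ball of `ℝⁿ`. -/
abbrev closedUnitBall (n : ℕ) : Set (Euc n) := Metric.closedBall 0 1

/-- The `k`-th elementary symmetric function `σ_k(μ₁, …, μₙ)`. -/
def sigmaFn {n : ℕ} (k : ℕ) (μ : Fin n → ℝ) : ℝ :=
  ∑ s ∈ Finset.powersetCard k Finset.univ, ∏ i ∈ s, μ i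

/-- The positive cone `Γ_k⁺ = {σ₁ > 0, …, σ_k > 0} ⊂ ℝⁿ`. -/
def gammaPlus (n k : ℕ) : Set (Fin n → ℝ) :=
  {μ | ∀ j : ℕ, 1 ≤ j → j ≤ k → 0 < sigmaFn j μ}

/-- The vector of eigenvalues, with multiplicity, of a real symmetric matrix
(the value on a matrix that is not symmetric is irrelevant). -/
def eigenvalueVec {n : ℕ} (A : Matrix (Fin n) (Fin n) ℝ) : Fin n → ℝ :=
  open Classical in if h : A.IsHermitian then h.eigenvalues else 0

/-- The Hessian matrix `D²φ(x)`. -/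
def hessMatrix {n : ℕ} (φ : Euc n → ℝ) (x : Euc n) : Matrix (Fin n) (Fin n) ℝ :=
  Matrix.of fun i j =>
    fderiv ℝ (fderiv ℝ φ) x (EuclideanSpace.single i 1) (EuclideanSpace.single j 1)

/-- The structural conditions on the pair `(f, Γ)`. -/
structure IsAdmissiblePair {n : ℕ} (f : (Fin n → ℝ) → ℝ) (Γ : Set (Fin n → ℝ)) : Prop where
  isOpen : IsOpen Γ
  symmetric : ∀ τ : Equiv.Perm (Fin n), ∀ μ ∈ Γ, (fun i => μ (τ i)) ∈ Γ
  cone : ∀ t : ℝ, 0 < t → ∀ μ ∈ Γ, t • μ ∈ Γ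
  add_mem : ∀ μ ∈ Γ, ∀ ν ∈ gammaPlus n n, μ + ν ∈ Γ
  contDiffOn : ContDiffOn ℝ 1 f Γ
  continuousOn : ContinuousOn f (closure Γ)
  homogeneous : ∀ t : ℝ, 0 < t → ∀ μ ∈ Γ, f (t • μ) = t * f μ
  pos : ∀ μ ∈ Γ, 0 < f μ
  partial_pos : ∀ μ ∈ Γ, ∀ i : Fin n, 0 < fderiv ℝ f μ (Pi.single i 1)
  eq_zero : ∀ μ ∈ frontier Γ, f μ = 0

/-- `L ∈ C²(B̄₁ × ℝⁿ, Sym_n)`, and `L = L₀ + L₁ + L₂` with `L_m(x, rp) = r^m L_m(x, p)`. -/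
structure IsAdmissibleL {n : ℕ} (L : Euc n → Euc n → Matrix (Fin n) (Fin n) ℝ) : Prop where
  contDiffOn : ∀ i j : Fin n,
    ContDiffOn ℝ 2 (fun z : Euc n × Euc n => L z.1 z.2 i j) (closedUnitBall n ×ˢ univ)
  symm : ∀ x ∈ closedUnitBall n, ∀ p : Euc n, (L x p).IsSymm
  structural : ∃ L' : Fin 3 → Euc n → Euc n → Matrix (Fin n) (Fin n) ℝ,
    ∀ x ∈ closedUnitBall n, ∀ p : Euc n,
      L x p = L' 0 x p + L' 1 x p + L' 2 x p ∧
      ∀ (m : Fin 3) (r : ℝ), L' m x (r • p) = r ^ (m : ℕ) • L' m x p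

/-- `W ∈ C²(B̄₁, Sym_n⁺)`. -/
structure IsAdmissibleW {n : ℕ} (W : Euc n → Matrix (Fin n) (Fin n) ℝ) : Prop where
  contDiffOn : ∀ i j : Fin n, ContDiffOn ℝ 2 (fun x => W x i j) (closedUnitBall n)
  posDef : ∀ x ∈ closedUnitBall n, (W x).PosDef

/-- The eigenvalues `λ(W ∘ (D²φ + L(·, Dφ)) ∘ W)(x)`. -/
def operatorEigenvalues {n : ℕ} (L : Euc n → Euc n → Matrix (Fin n) (Fin n) ℝ)
    (W : Euc n → Matrix (Fin n) (Fin n) ℝ) (φ : Euc n → ℝ) (x : Euc n) : Fin n → ℝ :=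
  eigenvalueVec (W x * (hessMatrix φ x + L x (gradient φ x)) * W x)

/-- `φ` touches `w` from above at `x₀`. -/
def TouchesAbove {n : ℕ} (φ w : Euc n → ℝ) (x₀ : Euc n) : Prop :=
  φ x₀ = w x₀ ∧ ∀ᶠ x in 𝓝 x₀, w x ≤ φ x

/-- `φ` touches `w` from below at `x₀`. -/
def TouchesBelow {n : ℕ} (φ w : Euc n → ℝ) (x₀ : Euc n) : Prop :=
  φ x₀ = w x₀ ∧ ∀ᶠ x in 𝓝 x₀, φ x ≤ w x

/-- `w` is a viscosity subsolution on `B₁` of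
`f(λ(W ∘ (D²w + L(x, Dw)) ∘ W)) = R e^{2w}`, `λ(W ∘ (D²w + L(x, Dw)) ∘ W) ∈ Γ`. -/
def IsViscositySubsolution {n : ℕ} (f : (Fin n → ℝ) → ℝ) (Γ : Set (Fin n → ℝ))
    (L : Euc n → Euc n → Matrix (Fin n) (Fin n) ℝ) (W : Euc n → Matrix (Fin n) (Fin n) ℝ)
    (R : Euc n → ℝ) (w : Euc n → ℝ) : Prop :=
  ContinuousOn w (unitBall n) ∧
  ∀ x₀ ∈ unitBall n, ∀ φ : Euc n → ℝ, ContDiffOn ℝ 2 φ (unitBall n) → TouchesAbove φ w x₀ →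
    operatorEigenvalues L W φ x₀ ∈ Γ ∧
    R x₀ * Real.exp (2 * φ x₀) ≤ f (operatorEigenvalues L W φ x₀)

/-- `w` is a viscosity supersolution on `B₁` of the same equation. -/
def IsViscositySupersolution {n : ℕ} (f : (Fin n → ℝ) → ℝ) (Γ : Set (Fin n → ℝ))
    (L : Euc n → Euc n → Matrix (Fin n) (Fin n) ℝ) (W : Euc n → Matrix (Fin n) (Fin n) ℝ)
    (R : Euc n → ℝ) (w : Euc n → ℝ) : Prop :=
  ContinuousOn w (unitBall n) ∧
  ∀ x₀ ∈ unitBall n, ∀ φ : Euc n → ℝ, ContDiffOn ℝ 2 φ (unitBall n) → TouchesBelow φ w x₀ →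
    (operatorEigenvalues L W φ x₀ ∈ Γ ∧
      f (operatorEigenvalues L W φ x₀) ≤ R x₀ * Real.exp (2 * φ x₀)) ∨
    operatorEigenvalues L W φ x₀ ∉ Γ

/-- `w` is a viscosity solution on `B₁`: both a subsolution and a supersolution. -/
def IsViscositySolution {n : ℕ} (f : (Fin n → ℝ) → ℝ) (Γ : Set (Fin n → ℝ))
    (L : Euc n → Euc n → Matrix (Fin n) (Fin n) ℝ) (W : Euc n → Matrix (Fin n) (Fin n) ℝ)
    (R : Euc n → ℝ) (w : Euc n → ℝ) : Prop :=
  IsViscositySubsolution f Γ L W R w ∧ IsViscositySupersolution f Γ L W R w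

/-- A paraboloid: a polynomial function of degree at most two on `ℝⁿ`. -/
def IsParaboloid {n : ℕ} (P : Euc n → ℝ) : Prop :=
  ∃ (c : ℝ) (b : Fin n → ℝ) (A : Matrix (Fin n) (Fin n) ℝ),
    ∀ x : Euc n, P x = c + ∑ i, b i * x i + ∑ i, ∑ j, A i j * x i * x j

/-- `w` is `k`-convex on `B₁` in the viscosity sense. -/
def IsKConvex {n : ℕ} (k : ℕ) (w : Euc n → ℝ) : Prop :=
  ContinuousOn w (unitBall n) ∧
  ∀ x₀ ∈ unitBall n, ∀ φ : Euc n → ℝ, IsParaboloid φ → TouchesAbove φ w x₀ →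
    eigenvalueVec (hessMatrix φ x₀) ∈ gammaPlus n k

/-- `w` is punctually second order differentiable at `x₀`:
`w(x) = P(x) + o(|x - x₀|²)` as `x → x₀` for some paraboloid `P`. -/
def IsPunctuallyTwiceDifferentiableAt {n : ℕ} (w : Euc n → ℝ) (x₀ : Euc n) : Prop :=
  ∃ P : Euc n → ℝ, IsParaboloid P ∧
    Asymptotics.IsLittleO (𝓝 x₀) (fun x => w x - P x) (fun x => ‖x - x₀‖ ^ 2)

end

/-! Convexity. If a paraboloid `φ` touches `w + C|x|²` from above at `x₀`, then `ψ = φ - C|x|²`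
touches `w`. Hence `|Dψ(x₀)|` is at most the Lipschitz constant `K`, and `L(x, p)` is bounded for
`|p| ≤ K`. For large `C` this makes `D²φ > D²ψ + L(x₀, Dψ)` as quadratic forms. If `W = I`, Weyl
monotonicity and `Γ + Γ_n⁺ ⊂ Γ` carry the eigenvalues into `Γ ⊂ Γ_k⁺`. If `k = n`, positive
definiteness is unaffected by the congruence with `W`.

Reduction to a linear cone. On `Γ_k⁺` one has `λ_i + c σ₁ ≥ 0` with `c = (n-k)/(n(k-1))`
(`neg_le_of_mem_gammaPlus`). So `u = w + C|x|²` satisfies `D²u + c tr(D²u) I ≥ 0` in the viscosity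
sense, and `k > n/2` gives `c(n-2) < 1` (`gammaRatio_mul_lt`). Two features of this cone matter: the
trace controls the norm of the Hessian, and small positive powers `|x - y|^α` violate the condition
strictly away from `y`.

Second order differentiability. The sup-convolution `u^ε` is semiconvex, so Alexandrov's theorem
applies to it (`ae_isAlexandrovPoint`), and `D²u^ε` inherits the cone condition
(`traceCone_of_isAlexandrovPoint`). Integrating its Laplacian against a cutoff shows that `ε D²u^ε`
is small outside a set of measure `O(ε)` (`volume_large_trace_le`). There the map from `x` to a
maximiser `y` is injective with Jacobian near one. By the area formula its image, on which `u` is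
touched from above by paraboloids of opening `1/ε`, nearly fills the ball. Letting `ε → 0`, almost
every point lies in such a contact set (`ae_mem_iUnion_upperContactSet`).

On a contact set `u` equals a quadratic minus a convex function, so Alexandrov gives an expansion
along the set at almost every point of it. At a density point, comparison with `|x - y|^α` transfers
the expansion to nearby points off the set (`IsTraceConvexOn.holder_comparison`,
`IsTraceConvexOn.expansion_of_density`). -/

/-! ### Subgradients, the resolvent, and Alexandrov's theorem for convex functions. -/

section Subgradient

open scoped RealInnerProductSpace

/-- `p` is a subgradient of `f` at `x`. -/
def IsSubgradient {E : Type*} [NormedAddCommGroup E] [InnerProductSpace ℝ E]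
    (f : E → ℝ) (x p : E) : Prop :=
  ∀ y, f x + ⟪p, y - x⟫ ≤ f y

variable {E : Type*} [NormedAddCommGroup E] [InnerProductSpace ℝ E] {f : E → ℝ}

theorem IsSubgradient.monotone {x y p q : E} (hp : IsSubgradient f x p)
    (hq : IsSubgradient f y q) : 0 ≤ ⟪p - q, x - y⟫ := by
  have h1 := hp y
  have h2 := hq x
  have h3 : ⟪p, y - x⟫ = - ⟪p, x - y⟫ := by rw [← inner_neg_right, neg_sub]
  rw [inner_sub_left]
  linarith

theorem convexOn_of_subgradient (hf : ∀ x, ∃ p, IsSubgradient f x p) : ConvexOn ℝ univ f := by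
  refine ⟨convex_univ, fun x _ y _ a b ha hb hab => ?_⟩
  obtain ⟨q, hq⟩ := hf (a • x + b • y)
  have h1 := mul_le_mul_of_nonneg_left (hq x) ha
  have h2 := mul_le_mul_of_nonneg_left (hq y) hb
  have h3 : a * ⟪q, x - (a • x + b • y)⟫ + b * ⟪q, y - (a • x + b • y)⟫ = 0 := by
    rw [← real_inner_smul_right, ← real_inner_smul_right, ← inner_add_right]
    have : a • (x - (a • x + b • y)) + b • (y - (a • x + b • y))
        = (a - (a + b) * a) • x + (b - (a + b) * b) • y := by module
    rw [this, hab]; simp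
  have h4 : f (a • x + b • y) = a * f (a • x + b • y) + b * f (a • x + b • y) := by
    rw [← add_mul, hab, one_mul]
  simp only [smul_eq_mul]
  nlinarith

theorem continuous_of_subgradient [FiniteDimensional ℝ E]
    (hf : ∀ x, ∃ p, IsSubgradient f x p) : Continuous f :=
  (convexOn_of_subgradient hf).locallyLipschitz.continuous

/-- A minimiser of `f + ‖· - z‖²/2` exists and inverts `id + ∂f`. -/
theorem exists_resolvent [FiniteDimensional ℝ E] (hf : ∀ x, ∃ p, IsSubgradient f x p) (z : E) :
    ∃ x, IsSubgradient f x (z - x) := by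
  have hcont := continuous_of_subgradient hf
  obtain ⟨p, hp⟩ := hf z
  have hcoer : Tendsto (fun x => f x + ‖x - z‖ ^ 2 / 2) (cocompact E) atTop := by
    have h1 : Tendsto (fun x : E => ‖x - z‖) (cocompact E) atTop := by
      have := tendsto_norm_cocompact_atTop (E := E)
      refine tendsto_atTop_mono (fun x => ?_) (tendsto_atTop_add_const_right _ (-‖z‖) this)
      have := norm_sub_norm_le x z
      linarith
    have h2 : Tendsto (fun t : ℝ => f z + t * (-‖p‖ + t * (1/2))) atTop atTop := by
      apply tendsto_atTop_add_const_left
      apply Tendsto.atTop_mul_atTop₀ tendsto_id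
      apply tendsto_atTop_add_const_left
      exact tendsto_id.atTop_mul_const (by norm_num)
    refine tendsto_atTop_mono (fun x => ?_) (h2.comp h1)
    have h3 := hp x
    have h4 := (abs_le.1 (abs_real_inner_le_norm p (x - z))).1
    simp only [Function.comp]
    nlinarith
  obtain ⟨x, hx⟩ := Continuous.exists_forall_le (by fun_prop) hcoer
  refine ⟨x, fun y => ?_⟩
  -- The minimiser is compared with points of the segment towards `y`. Convexity bounds `f` there
  -- and the square contributes only `O(t²)` beyond its linear part, so dividing by `t` and letting
  -- `t → 0` leaves the subgradient inequality.
  have key : ∀ t : ℝ, 0 < t → t ≤ 1 → f x + ⟪z - x, y - x⟫ - t * (‖y - x‖ ^ 2 / 2) ≤ f y := by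
    intro t ht ht1
    have h1 := hx (x + t • (y - x))
    have h2 := (convexOn_of_subgradient hf).2 (mem_univ x) (mem_univ y)
      (sub_nonneg.2 ht1) ht.le (by ring)
    have h3 : (1 - t) • x + t • y = x + t • (y - x) := by module
    rw [h3] at h2
    have h4 : ‖x + t • (y - x) - z‖ ^ 2
        = ‖x - z‖ ^ 2 - 2 * t * ⟪z - x, y - x⟫ + t ^ 2 * ‖y - x‖ ^ 2 := by
      have : x + t • (y - x) - z = (x - z) + t • (y - x) := by abel
      rw [this, norm_add_sq_real, inner_smul_right, norm_smul, mul_pow, ← neg_sub z x,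
        inner_neg_left, norm_neg]
      simp; ring
    rw [h4] at h1
    simp only [smul_eq_mul] at h2
    have h5 : t * (f x + ⟪z - x, y - x⟫ - t * (‖y - x‖ ^ 2 / 2)) ≤ t * f y := by nlinarith
    exact le_of_mul_le_mul_left h5 ht
  have hlim : Tendsto (fun t : ℝ => f x + ⟪z - x, y - x⟫ - t * (‖y - x‖ ^ 2 / 2)) (𝓝[>] 0)
      (𝓝 (f x + ⟪z - x, y - x⟫ - 0 * (‖y - x‖ ^ 2 / 2))) := by
    apply Tendsto.mono_left _ nhdsWithin_le_nhds
    apply Continuous.tendsto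
    fun_prop
  rw [zero_mul, sub_zero] at hlim
  refine le_of_tendsto hlim ?_
  filter_upwards [Ioc_mem_nhdsGT (zero_lt_one' ℝ)] with t ht using key t ht.1 ht.2

/-- Firm nonexpansiveness of the resolvent of the subdifferential. -/
theorem resolvent_firm {x y z w : E} (hx : IsSubgradient f x (z - x))
    (hy : IsSubgradient f y (w - y)) : ‖x - y‖ ^ 2 ≤ ⟪x - y, z - w⟫ := by
  have h := hx.monotone hy
  have h1 : z - x - (w - y) = (z - w) - (x - y) := by abel
  rw [h1, inner_sub_left, real_inner_self_eq_norm_sq, real_inner_comm] at h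
  linarith

theorem resolvent_lipschitz {J : E → E} (hJ : ∀ z, IsSubgradient f (J z) (z - J z)) :
    LipschitzWith 1 J := by
  refine LipschitzWith.of_dist_le_mul fun z w => ?_
  rw [dist_eq_norm, dist_eq_norm, NNReal.coe_one, one_mul]
  have h1 := resolvent_firm (hJ z) (hJ w)
  have h2 := real_inner_le_norm (J z - J w) (z - w)
  by_contra! h
  nlinarith [norm_nonneg (J z - J w), norm_nonneg (z - w)]

/-- This makes `J` surjective: each `x` is the image of `x + p` for any subgradient `p`. Null sets
of bad parameters `z` therefore become null sets of bad points `x`. -/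
theorem resolvent_eq {J : E → E} (hJ : ∀ z, IsSubgradient f (J z) (z - J z)) {x p : E}
    (hp : IsSubgradient f x p) : J (x + p) = x := by
  have h1 := resolvent_firm (hJ (x + p)) (show IsSubgradient f x (x + p - x) by simpa using hp)
  simp only [sub_self, inner_zero_right] at h1
  have : ‖J (x + p) - x‖ = 0 := by nlinarith [norm_nonneg (J (x + p) - x)]
  exact sub_eq_zero.1 (norm_eq_zero.1 this)

/-- First order expansion of all subgradients near a point where the resolvent has an
invertible derivative. -/
theorem subgradient_expansion_of_resolvent {J : E → E}
    (hJ : ∀ z, IsSubgradient f (J z) (z - J z)) {z : E} (B : E ≃L[ℝ] E)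
    (hB : HasFDerivAt J (B : E →L[ℝ] E) z) {ε : ℝ} (hε : 0 < ε) :
    ∀ᶠ y in 𝓝 (J z), ∀ q, IsSubgradient f y q →
      ‖q - (z - J z) - ((B.symm : E →L[ℝ] E) - 1) (y - J z)‖ ≤ ε * ‖y - J z‖ := by
  obtain ⟨c, hc, hBc⟩ : ∃ c : ℝ, 0 < c ∧ ∀ v, c * ‖v‖ ≤ ‖B v‖ := by
    refine ⟨(‖(B.symm : E →L[ℝ] E)‖ + 1)⁻¹, by positivity, fun v => ?_⟩
    have h1 := (B.symm : E →L[ℝ] E).le_opNorm (B v)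
    simp only [ContinuousLinearEquiv.coe_coe, ContinuousLinearEquiv.symm_apply_apply] at h1
    rw [inv_mul_le_iff₀ (by positivity)]
    nlinarith [norm_nonneg (B v)]
  set N := ‖(B.symm : E →L[ℝ] E)‖ with hN
  have hN0 : 0 ≤ N := norm_nonneg _
  -- The bound `c / 2` keeps `J` expanding at rate at least `c / 2` from `z`; the other bound pays
  -- for the final application of `B⁻¹`, of norm `N`, together with the resulting factor `2 / c`.
  set τ : ℝ := min (c / 2) (ε * c / (2 * (N + 1))) with hτ
  have hτ0 : 0 < τ := by positivity
  have hτ1 : τ ≤ c / 2 := min_le_left _ _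
  have hτ2 : τ * (2 * (N + 1)) ≤ ε * c := by
    rw [← le_div_iff₀ (by positivity)]; exact min_le_right _ _
  have hlin := hB.isLittleO.def hτ0
  obtain ⟨δ', hδ', hball⟩ := Metric.eventually_nhds_iff.1 hlin
  set δ := δ' / 2 with hδdef
  have hδ : 0 < δ := by positivity
  have hexp : ∀ w, ‖w - z‖ ≤ δ → ‖J w - J z - B (w - z)‖ ≤ τ * ‖w - z‖ := fun w hw =>
    hball (by rw [dist_eq_norm]; linarith)
  -- If `w` is far from `z`, then `J w` stays away from `J z`. Along the ray from `z` to `w`, firm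
  -- nonexpansiveness makes the component of `J` in the direction `e` nondecreasing, and at distance
  -- `δ` its increment is already at least `c² δ / 4`.
  have hfar : ∀ w, δ < ‖w - z‖ → c ^ 2 / 4 * δ ≤ ‖J w - J z‖ := by
    intro w hw
    have hw0 : 0 < ‖w - z‖ := hδ.trans hw
    set e : E := ‖w - z‖⁻¹ • (w - z) with he
    have hen : ‖e‖ = 1 := by rw [he, norm_smul, norm_inv, norm_norm, inv_mul_cancel₀ hw0.ne']
    have hwe : w - z = ‖w - z‖ • e := by rw [he, smul_smul, mul_inv_cancel₀ hw0.ne', one_smul]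
    have hzd : z + δ • e - z = δ • e := by abel
    have h1 := hexp (z + δ • e) (by rw [hzd, norm_smul, hen, Real.norm_of_nonneg hδ.le, mul_one])
    rw [hzd, norm_smul, hen, Real.norm_of_nonneg hδ.le, mul_one] at h1
    have h2 := hBc (δ • e)
    rw [norm_smul, hen, Real.norm_of_nonneg hδ.le, mul_one] at h2
    have h3 : c / 2 * δ ≤ ‖J (z + δ • e) - J z‖ := by
      have := norm_sub_norm_le (B (δ • e)) (J (z + δ • e) - J z)
      rw [norm_sub_rev] at h1
      nlinarith
    have h4 := resolvent_firm (hJ (z + δ • e)) (hJ z)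
    rw [hzd, inner_smul_right] at h4
    have h5 : c ^ 2 / 4 * δ ≤ ⟪J (z + δ • e) - J z, e⟫ := by
      have : c ^ 2 / 4 * δ * δ ≤ δ * ⟪J (z + δ • e) - J z, e⟫ := by nlinarith [mul_pos hc hδ]
      nlinarith
    have h6 := resolvent_firm (hJ w) (hJ (z + δ • e))
    have hwz : w - (z + δ • e) = (‖w - z‖ - δ) • e := by
      rw [sub_smul, ← hwe]; abel
    rw [hwz, inner_smul_right] at h6
    have h7 : 0 ≤ ⟪J w - J (z + δ • e), e⟫ := by
      have : 0 ≤ (‖w - z‖ - δ) * ⟪J w - J (z + δ • e), e⟫ := le_trans (by positivity) h6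
      exact nonneg_of_mul_nonneg_right this (by linarith)
    have h8 : ⟪J w - J z, e⟫ = ⟪J w - J (z + δ • e), e⟫ + ⟪J (z + δ • e) - J z, e⟫ := by
      rw [← inner_add_left]; congr 1; abel
    have h9 := real_inner_le_norm (J w - J z) e
    rw [hen, mul_one] at h9
    linarith
  have hnear : ∀ᶠ y in 𝓝 (J z), ‖y - J z‖ < c ^ 2 / 4 * δ := by
    have := Metric.ball_mem_nhds (J z) (show 0 < c ^ 2 / 4 * δ by positivity)
    filter_upwards [this] with y hy
    rwa [mem_ball_iff_norm] at hy
  filter_upwards [hnear] with y hy q hq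
  -- Since `J (y + q) = y`, inverting the linearisation of `J` at `z` determines `q` to first order.
  -- No uniqueness of subgradients near `J z` is needed.
  set w := y + q with hw
  have hJw : J w = y := resolvent_eq hJ hq
  have hwδ : ‖w - z‖ ≤ δ := by
    by_contra! h
    have := hfar w h
    rw [hJw] at this
    linarith
  have h1 := hexp w hwδ
  rw [hJw] at h1
  have h2 : c / 2 * ‖w - z‖ ≤ ‖y - J z‖ := by
    have h3 := hBc (w - z)
    have := norm_sub_norm_le (B (w - z)) (y - J z)
    rw [norm_sub_rev] at h1
    nlinarith [norm_nonneg (w - z)]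
  have h3 : q - (z - J z) - ((B.symm : E →L[ℝ] E) - 1) (y - J z)
      = - (B.symm : E →L[ℝ] E) (y - J z - B (w - z)) := by
    have h4 : (B.symm : E →L[ℝ] E) (B (w - z)) = w - z := B.symm_apply_apply _
    rw [map_sub (B.symm : E →L[ℝ] E) (y - J z), h4]
    simp only [sub_apply, one_apply_eq_self, hw]
    abel
  rw [h3, norm_neg]
  refine ((B.symm : E →L[ℝ] E).le_opNorm _).trans ?_
  rw [← hN]
  have h4 : N * ‖y - J z - B (w - z)‖ ≤ (N + 1) * (τ * ‖w - z‖) := by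
    apply mul_le_mul (by linarith) h1 (norm_nonneg _) (by linarith)
  have h5 : (N + 1) * (τ * ‖w - z‖) * 2 ≤ ε * c * ‖w - z‖ := by
    nlinarith [norm_nonneg (w - z)]
  nlinarith

/-- Cut `[0, 1]` into `N + 1` equal steps: the linear terms add up to `M`, the quadratic ones to `C
/ (N + 1)`. -/
theorem abs_sub_le_of_quadratic_increments {e : ℝ → ℝ} {M C : ℝ}
    (h : ∀ s t, 0 ≤ s → s ≤ t → t ≤ 1 → |e t - e s| ≤ M * (t - s) + C * (t - s) ^ 2) :
    |e 1 - e 0| ≤ M := by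
  have key : ∀ N : ℕ, |e 1 - e 0| ≤ M + C * (1 / ((N : ℝ) + 1)) := by
    intro N
    have hN : (0 : ℝ) < (N : ℝ) + 1 := by positivity
    have h1 := Finset.sum_range_sub (fun i : ℕ => e (i / ((N : ℝ) + 1))) (N + 1)
    simp only [Nat.cast_add, Nat.cast_one, Nat.cast_zero, zero_div, div_self hN.ne'] at h1
    rw [← h1]
    refine (Finset.abs_sum_le_sum_abs _ _).trans ?_
    have h2 : ∀ i ∈ Finset.range (N + 1), |e (((i : ℝ) + 1) / ((N : ℝ) + 1)) - e (i / ((N : ℝ) + 1))|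
        ≤ M * (1 / ((N : ℝ) + 1)) + C * (1 / ((N : ℝ) + 1)) ^ 2 := by
      intro i hi
      have hi' : (i : ℝ) + 1 ≤ (N : ℝ) + 1 := by exact_mod_cast Finset.mem_range.1 hi
      have := h (i / ((N : ℝ) + 1)) (((i : ℝ) + 1) / ((N : ℝ) + 1)) (by positivity)
        (by gcongr; linarith) (by rwa [div_le_one hN])
      rw [← sub_div, add_sub_cancel_left] at this
      exact this
    refine (Finset.sum_le_card_nsmul _ _ _ h2).trans (le_of_eq ?_)
    rw [Finset.card_range, nsmul_eq_mul]
    push_cast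
    field_simp
  have hlim : Tendsto (fun N : ℕ => M + C * (1 / ((N : ℝ) + 1))) atTop (𝓝 (M + C * 0)) :=
    (tendsto_one_div_add_atTop_nhds_zero_nat.const_mul C).const_add M
  rw [mul_zero, add_zero] at hlim
  exact ge_of_tendsto' hlim key

/-- A first order expansion of the subgradients integrates to a second order expansion. -/
theorem second_order_of_subgradient_expansion (hf : ∀ x, ∃ p, IsSubgradient f x p) {x p : E}
    {A : E →L[ℝ] E}
    (h : ∀ ε > 0, ∀ᶠ y in 𝓝 x, ∀ q, IsSubgradient f y q →
      ‖q - p - A (y - x)‖ ≤ ε * ‖y - x‖) :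
    (fun y => f y - f x - ⟪p, y - x⟫ - ⟪A (y - x), y - x⟫ / 2) =o[𝓝 x]
      fun y => ‖y - x‖ ^ 2 := by
  refine Asymptotics.isLittleO_iff.2 fun ε hε => ?_
  obtain ⟨δ, hδ, hball⟩ := Metric.eventually_nhds_iff.1 (h ε hε)
  filter_upwards [Metric.ball_mem_nhds x hδ] with y hy
  choose Q hQ using hf
  set d := y - x with hd
  have hyx : ‖d‖ < δ := by rwa [mem_ball_iff_norm] at hy
  set a := ⟪A d, d⟫ with ha
  set e : ℝ → ℝ := fun t => f (x + t • d) - t * ⟪p, d⟫ - t ^ 2 * a / 2 with he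
  have hq : ∀ t : ℝ, 0 ≤ t → t ≤ 1 →
      |⟪Q (x + t • d), d⟫ - ⟪p, d⟫ - t * a| ≤ ε * ‖d‖ ^ 2 := by
    intro t ht ht1
    have h1 : ‖t • d‖ ≤ ‖d‖ := by
      rw [norm_smul, Real.norm_of_nonneg ht]
      exact mul_le_of_le_one_left (norm_nonneg _) ht1
    have h2 := hball (y := x + t • d) (by rw [dist_eq_norm, add_sub_cancel_left]; linarith)
      _ (hQ _)
    rw [add_sub_cancel_left] at h2
    have h3 : ⟪Q (x + t • d), d⟫ - ⟪p, d⟫ - t * a = ⟪Q (x + t • d) - p - A (t • d), d⟫ := by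
      rw [map_smul, inner_sub_left, inner_sub_left, inner_smul_left]; simp [ha]
    rw [h3]
    refine (abs_real_inner_le_norm _ _).trans ?_
    have : ‖Q (x + t • d) - p - A (t • d)‖ ≤ ε * ‖d‖ := h2.trans (by gcongr)
    nlinarith [norm_nonneg d]
  -- The subgradient inequalities at the two ends of `[s, t]` trap the increment of `f` between two
  -- slopes, both known to first order. This takes the place of integrating a derivative.
  have hmain := abs_sub_le_of_quadratic_increments (e := e) (M := ε * ‖d‖ ^ 2) (C := |a| / 2)
    (by
      intro s t hs hst ht
      have h1 := hQ (x + s • d) (x + t • d)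
      have h2 := hQ (x + t • d) (x + s • d)
      have e1 : x + t • d - (x + s • d) = (t - s) • d := by module
      have e2 : x + s • d - (x + t • d) = (-(t - s)) • d := by module
      rw [e1, inner_smul_right] at h1
      rw [e2, inner_smul_right] at h2
      have h3 := abs_le.1 (hq s hs (hst.trans ht))
      have h4 := abs_le.1 (hq t (hs.trans hst) ht)
      have hts : 0 ≤ t - s := by linarith
      have m1 := mul_le_mul_of_nonneg_left h3.1 hts
      have m2 := mul_le_mul_of_nonneg_left h4.2 hts
      have m3 := mul_le_mul_of_nonneg_left (le_abs_self a) (sq_nonneg (t - s))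
      have m4 := mul_le_mul_of_nonneg_left (neg_abs_le a) (sq_nonneg (t - s))
      simp only [he]
      rw [abs_le]
      constructor <;> nlinarith)
  have e3 : x + d = y := by rw [hd]; abel
  simp only [he, one_smul, zero_smul, e3, add_zero] at hmain
  rw [Real.norm_eq_abs, Real.norm_of_nonneg (by positivity)]
  convert hmain using 2
  simp only [hd]
  ring

/-- Comparing `f (x + t(v + w))` with the supporting plane at `x + tv` gives, at order `t²`, `⟪Av,
w⟫ ≤ ⟪Aw, v⟫ + ⟪Aw, w⟫`. Replacing `w` by `sw` and letting `s → 0` removes the last term, and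
exchanging the vectors gives equality. -/
theorem symm_of_subgradient_expansion (hf : ∀ x, ∃ p, IsSubgradient f x p) {x p : E}
    {A : E →L[ℝ] E}
    (h : ∀ ε > 0, ∀ᶠ y in 𝓝 x, ∀ q, IsSubgradient f y q →
      ‖q - p - A (y - x)‖ ≤ ε * ‖y - x‖) (v w : E) : ⟪A v, w⟫ = ⟪A w, v⟫ := by
  have h2 := second_order_of_subgradient_expansion hf h
  choose Q hQ using hf
  have key : ∀ v w : E, ⟪A v, w⟫ ≤ ⟪A w, v⟫ + ⟪A w, w⟫ := by
    intro v w
    have hbound : ∀ ε > 0, ⟪A v, w⟫ - ⟪A w, v⟫ - ⟪A w, w⟫ ≤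
        ε * (2 * ‖v + w‖ ^ 2 + 2 * ‖v‖ ^ 2 + 2 * ‖v‖ * ‖w‖) := by
      intro ε hε
      have tz : ∀ u : E, Tendsto (fun t : ℝ => x + t • u) (𝓝[>] 0) (𝓝 x) := fun u => by
        have : Continuous fun t : ℝ => x + t • u := by fun_prop
        simpa using (this.tendsto 0).mono_left nhdsWithin_le_nhds
      obtain ⟨t, ⟨⟨⟨h3, h4⟩, h5⟩, ht⟩⟩ := ((((tz (v + w)).eventually (h2.def hε)).and
        ((tz v).eventually (h2.def hε))).and ((tz v).eventually (h ε hε))).and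
        self_mem_nhdsWithin |>.exists
      have ht : 0 < t := ht
      have h5 := h5 _ (hQ _)
      have h6 := hQ (x + t • v) (x + t • (v + w))
      have e1 : x + t • (v + w) - (x + t • v) = t • w := by module
      simp only [add_sub_cancel_left, norm_smul, map_smul, map_add, inner_smul_left,
        inner_smul_right, inner_add_left, inner_add_right, Real.norm_eq_abs, conj_trivial, abs_pow,
        abs_mul, abs_norm, abs_of_pos ht] at h3 h4 h5
      rw [e1, inner_smul_right] at h6
      have h7 := (abs_real_inner_le_norm (Q (x + t • v) - p - t • A v) w)
      rw [inner_sub_left, inner_sub_left, inner_smul_left] at h7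
      simp only [conj_trivial] at h7
      have h8 : ‖Q (x + t • v) - p - t • A v‖ * ‖w‖ ≤ ε * (t * ‖v‖) * ‖w‖ := by gcongr
      have h9 := (abs_le.1 (h7.trans h8)).1
      have h10 := (abs_le.1 h3).2
      have h11 := (abs_le.1 h4).1
      have h9' := mul_le_mul_of_nonneg_left h9 ht.le
      have : t ^ 2 * (⟪A v, w⟫ - ⟪A w, v⟫ - ⟪A w, w⟫) ≤
          t ^ 2 * (ε * (2 * ‖v + w‖ ^ 2 + 2 * ‖v‖ ^ 2 + 2 * ‖v‖ * ‖w‖)) := by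
        nlinarith
      exact le_of_mul_le_mul_left this (by positivity)
    set D := 2 * ‖v + w‖ ^ 2 + 2 * ‖v‖ ^ 2 + 2 * ‖v‖ * ‖w‖ with hD
    have hD0 : 0 ≤ D := by positivity
    by_contra! hcon
    have := hbound ((⟪A v, w⟫ - ⟪A w, v⟫ - ⟪A w, w⟫) / (2 * (D + 1))) (by
      apply div_pos <;> linarith)
    rw [div_mul_eq_mul_div, le_div_iff₀ (by positivity)] at this
    nlinarith
  have key2 : ∀ v w : E, ⟪A v, w⟫ ≤ ⟪A w, v⟫ := by
    intro v w
    by_contra! hcon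
    set d := ⟪A v, w⟫ - ⟪A w, v⟫ with hd
    have hd0 : 0 < d := by simp only [hd]; linarith
    have hs : ∀ s : ℝ, 0 < s → d ≤ s * |⟪A w, w⟫| := by
      intro s hs
      have := key v (s • w)
      simp only [map_smul, inner_smul_left, inner_smul_right, conj_trivial] at this
      have h3 : s * d ≤ s * (s * ⟪A w, w⟫) := by nlinarith
      have h4 := le_of_mul_le_mul_left h3 hs
      nlinarith [le_abs_self ⟪A w, w⟫]
    have := hs (d / (2 * (|⟪A w, w⟫| + 1))) (by positivity)
    rw [div_mul_eq_mul_div, le_div_iff₀ (by positivity)] at this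
    nlinarith [abs_nonneg ⟪A w, w⟫]
  exact le_antisymm (key2 v w) (key2 w v)

/-- Volume and the Hausdorff measure of dimension `finrank` are both Haar measures, hence have the
same null sets, and Lipschitz maps control Hausdorff measure. -/
theorem volume_image_eq_zero_of_lipschitz [FiniteDimensional ℝ E] [MeasurableSpace E]
    [BorelSpace E] {K : ℝ≥0} {g : E → E} (hg : LipschitzWith K g) {s : Set E}
    (hs : volume s = 0) : volume (g '' s) = 0 := by
  have : (Measure.hausdorffMeasure (X := E) (Module.finrank ℝ E : ℝ)).IsAddHaarMeasure :=
    isAddHaarMeasure_hausdorffMeasure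
  have h1 : (volume : Measure E) ≪ Measure.hausdorffMeasure (Module.finrank ℝ E : ℝ) :=
    Measure.absolutelyContinuous_isAddHaarMeasure _ _
  have h2 : (Measure.hausdorffMeasure (X := E) (Module.finrank ℝ E : ℝ)) ≪ (volume : Measure E) :=
    Measure.absolutelyContinuous_isAddHaarMeasure _ _
  apply h1
  have h3 := hg.hausdorffMeasure_image_le (d := Module.finrank ℝ E) (by positivity) s
  rw [h2 hs, mul_zero] at h3
  exact le_antisymm h3 zero_le

/-- `f` has at `x` a second order expansion with gradient `p` and symmetric Hessian `A`, in the
strong sense that all nearby subgradients have the corresponding first order expansion. -/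
structure IsAlexandrovPoint (f : E → ℝ) (x p : E) (A : E →L[ℝ] E) : Prop where
  symm : ∀ v w, ⟪A v, w⟫ = ⟪A w, v⟫
  subgradient : ∀ ε > 0, ∀ᶠ y in 𝓝 x, ∀ q, IsSubgradient f y q →
    ‖q - p - A (y - x)‖ ≤ ε * ‖y - x‖
  expansion : (fun y => f y - f x - ⟪p, y - x⟫ - ⟪A (y - x), y - x⟫ / 2) =o[𝓝 x]
    fun y => ‖y - x‖ ^ 2

/-- **Alexandrov's theorem**. -/
theorem ae_isAlexandrovPoint [FiniteDimensional ℝ E] [MeasurableSpace E] [BorelSpace E]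
    (hf : ∀ x, ∃ p, IsSubgradient f x p) :
    ∀ᵐ x : E, ∃ p A, IsAlexandrovPoint f x p A := by
  choose J hJ using exists_resolvent hf
  have hlip := resolvent_lipschitz hJ
  -- Both exceptional sets have null image: the first by Rademacher's theorem and the Lipschitz
  -- bound, the second by Sard's lemma. Every other `x` comes from a point where `J` has an
  -- invertible derivative.
  set Z₁ : Set E := {z | ¬ DifferentiableAt ℝ J z} with hZ₁
  set Z₂ : Set E := {z | DifferentiableAt ℝ J z ∧ (fderiv ℝ J z).det = 0} with hZ₂
  have h1 : volume (J '' Z₁) = 0 :=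
    volume_image_eq_zero_of_lipschitz hlip (ae_iff.1 (hlip.ae_differentiableAt (μ := volume)))
  have h2 : volume (J '' Z₂) = 0 :=
    addHaar_image_eq_zero_of_det_fderivWithin_eq_zero volume
      (fun x hx => (hx.1.hasFDerivAt).hasFDerivWithinAt) (fun x hx => hx.2)
  have h3 : volume (J '' Z₁ ∪ J '' Z₂) = 0 := measure_union_null h1 h2
  filter_upwards [compl_mem_ae_iff.2 h3] with x hx
  obtain ⟨p₀, hp₀⟩ := hf x
  have hJx := resolvent_eq hJ hp₀
  set z := x + p₀ with hz
  have hzd : DifferentiableAt ℝ J z := by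
    by_contra h
    exact hx (Or.inl ⟨z, h, hJx⟩)
  have hdet : (fderiv ℝ J z).det ≠ 0 := fun h => hx (Or.inr ⟨z, ⟨hzd, h⟩, hJx⟩)
  set B := (fderiv ℝ J z).toContinuousLinearEquivOfDetNeZero hdet with hB
  have hBf : HasFDerivAt J (B : E →L[ℝ] E) z := by
    rw [hB, ContinuousLinearMap.coe_toContinuousLinearEquivOfDetNeZero]
    exact hzd.hasFDerivAt
  have hexp : ∀ ε > 0, ∀ᶠ y in 𝓝 x, ∀ q, IsSubgradient f y q →
      ‖q - (z - x) - ((B.symm : E →L[ℝ] E) - 1) (y - x)‖ ≤ ε * ‖y - x‖ := by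
    intro ε hε
    have := subgradient_expansion_of_resolvent hJ B hBf hε
    rwa [hJx] at this
  exact ⟨z - x, (B.symm : E →L[ℝ] E) - 1, symm_of_subgradient_expansion hf hexp, hexp,
    second_order_of_subgradient_expansion hf hexp⟩

end Subgradient

/-! ### Convex conjugates, sup-convolutions and contact sets. -/

section Conjugate

open scoped RealInnerProductSpace

/-- `y` attains the supremum that defines the convex conjugate of `h` at `x`. -/
def IsConjugatePoint {E : Type*} [NormedAddCommGroup E] [InnerProductSpace ℝ E]
    (h : E → ℝ) (x y : E) : Prop :=
  ∀ y', ⟪x, y'⟫ - h y' ≤ ⟪x, y⟫ - h y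

/-- The convex conjugate. -/
noncomputable def convexConjugate {E : Type*} [NormedAddCommGroup E] [InnerProductSpace ℝ E]
    (h : E → ℝ) (x : E) : ℝ :=
  ⨆ y, (⟪x, y⟫ - h y)

variable {E : Type*} [NormedAddCommGroup E] [InnerProductSpace ℝ E] {h : E → ℝ}

theorem IsConjugatePoint.convexConjugate_eq {x y : E} (hy : IsConjugatePoint h x y) :
    convexConjugate h x = ⟪x, y⟫ - h y :=
  le_antisymm (ciSup_le hy)
    (le_ciSup (f := fun y => ⟪x, y⟫ - h y) ⟨_, by rintro _ ⟨y', rfl⟩; exact hy y'⟩ y)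

theorem le_convexConjugate (hh : ∀ x, ∃ y, IsConjugatePoint h x y) (x y : E) :
    ⟪x, y⟫ - h y ≤ convexConjugate h x := by
  obtain ⟨z, hz⟩ := hh x
  rw [hz.convexConjugate_eq]
  exact hz y

theorem IsConjugatePoint.isSubgradient (hh : ∀ x, ∃ y, IsConjugatePoint h x y) {x y : E}
    (hy : IsConjugatePoint h x y) : IsSubgradient (convexConjugate h) x y := by
  intro x'
  have h1 := le_convexConjugate hh x' y
  rw [hy.convexConjugate_eq, inner_sub_right]
  linarith [real_inner_comm x' y, real_inner_comm x y]

theorem exists_isConjugatePoint [FiniteDimensional ℝ E] (hc : Continuous h) {a b : ℝ}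
    (ha : 0 < a) (hb : ∀ y, a * ‖y‖ ^ 2 - b ≤ h y) (x : E) : ∃ y, IsConjugatePoint h x y := by
  have hcoer : Tendsto (fun y => h y - ⟪x, y⟫) (cocompact E) atTop := by
    have h1 := tendsto_norm_cocompact_atTop (E := E)
    have h2 : Tendsto (fun t : ℝ => -b + t * (-‖x‖ + t * a)) atTop atTop := by
      apply tendsto_atTop_add_const_left
      apply Tendsto.atTop_mul_atTop₀ tendsto_id
      apply tendsto_atTop_add_const_left
      exact tendsto_id.atTop_mul_const ha
    refine tendsto_atTop_mono (fun y => ?_) (h2.comp h1)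
    have h3 := hb y
    have h4 := real_inner_le_norm x y
    simp only [Function.comp]
    nlinarith
  obtain ⟨y, hy⟩ := Continuous.exists_forall_le (by fun_prop) hcoer
  exact ⟨y, fun y' => by linarith [hy y']⟩

/-- The potential whose conjugate encodes the sup-convolution of `u` with parameter `ε`. -/
noncomputable def supConvPotential {E : Type*} [NormedAddCommGroup E]
    (u : E → ℝ) (ε : ℝ) (y : E) : ℝ :=
  ‖y‖ ^ 2 / 2 - ε * u y

/-- The set of points where `u` is touched from above by a paraboloid of opening `1 / ε`. -/
def upperContactSet {E : Type*} [NormedAddCommGroup E] [InnerProductSpace ℝ E]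
    (u : E → ℝ) (ε : ℝ) : Set E :=
  {y | convexConjugate (convexConjugate (supConvPotential u ε)) y = supConvPotential u ε y}

variable {u : E → ℝ} {K : ℝ≥0} {ε : ℝ}

omit [InnerProductSpace ℝ E] in
theorem continuous_supConvPotential (hu : LipschitzWith K u) : Continuous (supConvPotential u ε) := by
  have := hu.continuous
  unfold supConvPotential
  fun_prop

omit [InnerProductSpace ℝ E] in
theorem le_supConvPotential (hu : LipschitzWith K u) (hε : 0 ≤ ε) (y : E) :
    1 / 4 * ‖y‖ ^ 2 - (ε * |u 0| + ε ^ 2 * K ^ 2) ≤ supConvPotential u ε y := by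
  have h1 := hu.dist_le_mul y 0
  rw [Real.dist_eq, dist_zero_right] at h1
  have h2 := (abs_le.1 h1).2
  have h3 := le_abs_self (u 0)
  have h4 : ε * u y ≤ ε * (|u 0| + K * ‖y‖) := by gcongr; linarith
  unfold supConvPotential
  -- Young's inequality absorbs `ε K ‖y‖` into half of `‖y‖² / 2`, whence the coefficient `1 / 4`.
  nlinarith [sq_nonneg (‖y‖ / 2 - ε * K)]

theorem exists_isConjugatePoint_supConvPotential [FiniteDimensional ℝ E]
    (hu : LipschitzWith K u) (hε : 0 ≤ ε) (x : E) :
    ∃ y, IsConjugatePoint (supConvPotential u ε) x y :=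
  exists_isConjugatePoint (continuous_supConvPotential hu) (by norm_num)
    (le_supConvPotential hu hε) x

theorem le_convexConjugate_supConvPotential [FiniteDimensional ℝ E]
    (hu : LipschitzWith K u) (hε : 0 ≤ ε) (x : E) :
    1 / 4 * ‖x‖ ^ 2 - (ε * |u 0| + ε ^ 2 * K ^ 2) ≤ convexConjugate (supConvPotential u ε) x := by
  have h0 := le_convexConjugate (exists_isConjugatePoint_supConvPotential hu hε) x x
  have h1 := hu.dist_le_mul x 0
  rw [Real.dist_eq, dist_zero_right] at h1
  have h2 := (abs_le.1 h1).1
  have h3 := neg_abs_le (u 0)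
  have h4 : ε * (-|u 0| - K * ‖x‖) ≤ ε * u x := by gcongr; linarith
  rw [real_inner_self_eq_norm_sq] at h0
  unfold supConvPotential at h0 ⊢
  nlinarith [sq_nonneg (‖x‖ / 2 - ε * K)]

theorem exists_subgradient_convexConjugate_supConvPotential [FiniteDimensional ℝ E]
    (hu : LipschitzWith K u) (hε : 0 ≤ ε) (x : E) :
    ∃ p, IsSubgradient (convexConjugate (supConvPotential u ε)) x p :=
  (exists_isConjugatePoint_supConvPotential hu hε x).imp
    fun _ hy => hy.isSubgradient (exists_isConjugatePoint_supConvPotential hu hε)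

theorem exists_isConjugatePoint_biconjugate [FiniteDimensional ℝ E]
    (hu : LipschitzWith K u) (hε : 0 ≤ ε) (x : E) :
    ∃ y, IsConjugatePoint (convexConjugate (supConvPotential u ε)) x y :=
  exists_isConjugatePoint (continuous_of_subgradient
    (exists_subgradient_convexConjugate_supConvPotential hu hε)) (by norm_num)
    (le_convexConjugate_supConvPotential hu hε) x

theorem exists_subgradient_biconjugate [FiniteDimensional ℝ E]
    (hu : LipschitzWith K u) (hε : 0 ≤ ε) (x : E) :
    ∃ p, IsSubgradient (convexConjugate (convexConjugate (supConvPotential u ε))) x p :=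
  (exists_isConjugatePoint_biconjugate hu hε x).imp
    fun _ hy => hy.isSubgradient (exists_isConjugatePoint_biconjugate hu hε)

theorem isClosed_upperContactSet [FiniteDimensional ℝ E] (hu : LipschitzWith K u) (hε : 0 ≤ ε) :
    IsClosed (upperContactSet u ε) :=
  isClosed_eq (continuous_of_subgradient (exists_subgradient_biconjugate hu hε))
    (continuous_supConvPotential hu)

/-- The affine function of slope `x` that supports the potential at `y` lies below the biconjugate,
which must therefore reach the potential at `y`. -/
theorem IsConjugatePoint.mem_upperContactSet [FiniteDimensional ℝ E] (hu : LipschitzWith K u)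
    (hε : 0 ≤ ε) {x y : E} (hy : IsConjugatePoint (supConvPotential u ε) x y) :
    y ∈ upperContactSet u ε := by
  have hex := exists_isConjugatePoint_supConvPotential hu hε
  refine le_antisymm (ciSup_le fun x' => ?_) ?_
  · have := le_convexConjugate hex x' y
    rw [real_inner_comm]
    linarith
  · have := le_convexConjugate (exists_isConjugatePoint_biconjugate hu hε) y x
    rw [hy.convexConjugate_eq, real_inner_comm] at this
    linarith

/-- Testing maximality against the competitor `x` itself gives `‖x - y‖² / 2 ≤ ε K ‖x - y‖`. -/
theorem IsConjugatePoint.norm_sub_le (hu : LipschitzWith K u) (hε : 0 ≤ ε) {x y : E}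
    (hy : IsConjugatePoint (supConvPotential u ε) x y) : ‖x - y‖ ≤ 2 * K * ε := by
  have h1 := hy x
  have h2 := hu.dist_le_mul y x
  rw [Real.dist_eq, dist_eq_norm, norm_sub_rev] at h2
  have h3 := mul_le_mul_of_nonneg_left (abs_le.1 h2).2 hε
  have h4 := norm_sub_sq_real x y
  rw [real_inner_self_eq_norm_sq] at h1
  unfold supConvPotential at h1
  by_contra! h
  have h5 : 0 ≤ 2 * K * ε := by positivity
  have h6 : ‖x - y‖ * (2 * K * ε) < ‖x - y‖ * ‖x - y‖ :=
    mul_lt_mul_of_pos_left h (h5.trans_lt h)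
  nlinarith

/-- At almost every point of the contact set, `u` has a second order expansion along it. -/
theorem ae_expansion_upperContactSet [FiniteDimensional ℝ E] [MeasurableSpace E] [BorelSpace E]
    (hu : LipschitzWith K u) (hε : 0 < ε) :
    ∀ᵐ y : E, y ∈ upperContactSet u ε → ∃ (p : E) (A : E →L[ℝ] E),
      (fun z => u z - u y - ⟪p, z - y⟫ - ⟪A (z - y), z - y⟫ / 2) =o[𝓝[upperContactSet u ε] y]
        fun z => ‖z - y‖ ^ 2 := by
  filter_upwards [ae_isAlexandrovPoint (exists_subgradient_biconjugate hu hε.le)] with y hy hyH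
  obtain ⟨p, A, hA⟩ := hy
  -- On the contact set `u` is `ε⁻¹` times `‖·‖² / 2` minus the biconjugate; these are the
  -- corresponding first and second order terms.
  refine ⟨ε⁻¹ • (y - p), ε⁻¹ • (1 - A), ?_⟩
  have h1 := (hA.expansion.mono (nhdsWithin_le_nhds (s := upperContactSet u ε))).const_mul_left
    (-ε⁻¹)
  refine h1.congr' ?_ EventuallyEq.rfl
  filter_upwards [self_mem_nhdsWithin] with z hz
  have hz : convexConjugate (convexConjugate (supConvPotential u ε)) z = supConvPotential u ε z :=
    hz
  have hyH : convexConjugate (convexConjugate (supConvPotential u ε)) y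
    = supConvPotential u ε y := hyH
  have hzy : ‖z‖ ^ 2 = ‖y‖ ^ 2 + 2 * ⟪y, z - y⟫ + ‖z - y‖ ^ 2 := by
    rw [← norm_add_sq_real, add_sub_cancel]
  rw [hz, hyH]
  have h2 : ⟪(1 - A) (z - y), z - y⟫ = ‖z - y‖ ^ 2 - ⟪A (z - y), z - y⟫ := by
    rw [sub_apply, one_apply_eq_self, inner_sub_left, real_inner_self_eq_norm_sq]
  simp only [supConvPotential, hzy, smul_apply, inner_smul_left, conj_trivial, h2,
    inner_sub_left y p]
  field_simp
  ring

end Conjugate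

/-! ### The trace cone and its transfer to the sup-convolution. -/

section TraceCone

open scoped RealInnerProductSpace

/-- The trace of a continuous linear endomorphism. -/
noncomputable def opTrace {E : Type*} [NormedAddCommGroup E] [InnerProductSpace ℝ E]
    (A : E →L[ℝ] E) : ℝ :=
  LinearMap.trace ℝ E A

/-- `u` satisfies `D²u + c tr(D²u) I ≥ 0` on `s`, tested with paraboloids touching `u` from
above. -/
def IsTraceConvexOn {E : Type*} [NormedAddCommGroup E] [InnerProductSpace ℝ E]
    (c : ℝ) (u : E → ℝ) (s : Set E) : Prop :=
  ∀ x₀ ∈ s, ∀ (p : E) (A : E →L[ℝ] E),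
    (∀ᶠ x in 𝓝 x₀, u x ≤ u x₀ + ⟪p, x - x₀⟫ + ⟪A (x - x₀), x - x₀⟫ / 2) →
    ∀ ξ, 0 ≤ ⟪A ξ, ξ⟫ + c * opTrace A * ‖ξ‖ ^ 2

variable {E : Type*} [NormedAddCommGroup E] [InnerProductSpace ℝ E]

theorem opTrace_eq_sum {ι : Type*} [Fintype ι] (b : OrthonormalBasis ι ℝ E) (A : E →L[ℝ] E) :
    opTrace A = ∑ i, ⟪A (b i), b i⟫ := by
  rw [opTrace, LinearMap.trace_eq_sum_inner _ b]
  exact Finset.sum_congr rfl fun i _ => real_inner_comm _ _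

theorem opTrace_add (A B : E →L[ℝ] E) : opTrace (A + B) = opTrace A + opTrace B := by
  simp [opTrace]

theorem opTrace_sub (A B : E →L[ℝ] E) : opTrace (A - B) = opTrace A - opTrace B := by
  simp [opTrace]

theorem opTrace_smul (t : ℝ) (A : E →L[ℝ] E) : opTrace (t • A) = t * opTrace A := by
  simp [opTrace]

theorem opTrace_one [FiniteDimensional ℝ E] :
    opTrace (1 : E →L[ℝ] E) = Module.finrank ℝ E := by
  rw [opTrace, ContinuousLinearMap.toLinearMap_one, LinearMap.trace_one]

theorem inner_sq_le_of_nonneg {A : E →L[ℝ] E} (hs : ∀ v w, ⟪A v, w⟫ = ⟪A w, v⟫)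
    (hp : ∀ v, 0 ≤ ⟪A v, v⟫) (v w : E) : ⟪A v, w⟫ ^ 2 ≤ ⟪A v, v⟫ * ⟪A w, w⟫ := by
  have h : ∀ t : ℝ, 0 ≤ ⟪A w, w⟫ * (t * t) + (2 * ⟪A v, w⟫) * t + ⟪A v, v⟫ := by
    intro t
    have h1 := hp (v + t • w)
    simp only [map_add, map_smul, inner_add_left, inner_add_right, inner_smul_left,
      inner_smul_right, conj_trivial] at h1
    rw [hs w v] at h1
    linarith
  have := discrim_le_zero h
  rw [discrim] at this
  nlinarith

/-- Cauchy–Schwarz for the form of `A`, summed over an orthonormal basis, gives `‖A v‖² ≤ ⟪A v, v⟫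
tr A`. -/
theorem norm_le_opTrace_of_nonneg [FiniteDimensional ℝ E] {A : E →L[ℝ] E}
    (hs : ∀ v w, ⟪A v, w⟫ = ⟪A w, v⟫) (hp : ∀ v, 0 ≤ ⟪A v, v⟫) : ‖A‖ ≤ opTrace A := by
  set b := stdOrthonormalBasis ℝ E
  have ht := opTrace_eq_sum b A
  have ht0 : 0 ≤ opTrace A := by rw [ht]; exact Finset.sum_nonneg fun i _ => hp _
  refine A.opNorm_le_bound ht0 fun v => ?_
  have h1 : ‖A v‖ ^ 2 ≤ ⟪A v, v⟫ * opTrace A := by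
    rw [← b.sum_sq_norm_inner_right (A v), ht, Finset.mul_sum]
    refine Finset.sum_le_sum fun i _ => ?_
    rw [Real.norm_eq_abs, sq_abs, real_inner_comm]
    exact inner_sq_le_of_nonneg hs hp _ _
  have h2 := real_inner_le_norm (A v) v
  by_contra! h
  have h3 : 0 ≤ opTrace A * ‖v‖ := by positivity
  have h4 : ‖A v‖ * (opTrace A * ‖v‖) < ‖A v‖ * ‖A v‖ :=
    mul_lt_mul_of_pos_left h (h3.trans_lt h)
  nlinarith

/-- The operator `A + c tr(A) I` is nonnegative, so its trace, a positive multiple of `tr A`, bounds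
its norm; subtracting the scalar part costs `c tr A`. -/
theorem norm_le_of_traceCone [FiniteDimensional ℝ E] {c : ℝ} (hc : 0 ≤ c) {A : E →L[ℝ] E}
    (hs : ∀ v w, ⟪A v, w⟫ = ⟪A w, v⟫) (hp : ∀ ξ, 0 ≤ ⟪A ξ, ξ⟫ + c * opTrace A * ‖ξ‖ ^ 2) :
    0 ≤ opTrace A ∧ ‖A‖ ≤ (1 + c * Module.finrank ℝ E + c) * opTrace A := by
  set B := A + (c * opTrace A) • (1 : E →L[ℝ] E) with hB
  have hBi : ∀ v w, ⟪B v, w⟫ = ⟪A v, w⟫ + c * opTrace A * ⟪v, w⟫ := by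
    intro v w
    simp [hB, inner_add_left, inner_smul_left]
  have hBt : opTrace B = (1 + c * Module.finrank ℝ E) * opTrace A := by
    rw [hB, opTrace_add, opTrace_smul, opTrace_one]; ring
  have h1 := norm_le_opTrace_of_nonneg (A := B)
    (fun v w => by rw [hBi, hBi, hs, real_inner_comm v w])
    (fun v => by rw [hBi, real_inner_self_eq_norm_sq]; exact hp v)
  have h0 : 0 ≤ opTrace A := by
    have h2 : 0 ≤ (1 + c * Module.finrank ℝ E) * opTrace A := by
      rw [← hBt]; exact (norm_nonneg _).trans h1
    exact nonneg_of_mul_nonneg_right h2 (by positivity)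
  refine ⟨h0, ?_⟩
  have h3 : A = B - (c * opTrace A) • (1 : E →L[ℝ] E) := by rw [hB, add_sub_cancel_right]
  have h4 : ‖(c * opTrace A) • (1 : E →L[ℝ] E)‖ ≤ c * opTrace A := by
    rw [norm_smul, Real.norm_of_nonneg (by positivity)]
    exact mul_le_of_le_one_right (by positivity) ContinuousLinearMap.norm_id_le
  calc ‖A‖ = ‖B - (c * opTrace A) • (1 : E →L[ℝ] E)‖ := by rw [← h3]
    _ ≤ ‖B‖ + ‖(c * opTrace A) • (1 : E →L[ℝ] E)‖ := norm_sub_le _ _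
    _ ≤ _ := by rw [hBt] at h1; linarith

theorem IsAlexandrovPoint.eq_gradient {f : E → ℝ} {x p q : E} {A : E →L[ℝ] E}
    (h : IsAlexandrovPoint f x p A) (hq : IsSubgradient f x q) : q = p := by
  have := (h.subgradient 1 one_pos).self_of_nhds q hq
  simp only [sub_self, map_zero, sub_zero, norm_zero, mul_zero] at this
  exact sub_eq_zero.1 (norm_eq_zero.1 (le_antisymm this (norm_nonneg _)))

/-- The expansion constrains all nearby subgradients, so any selection is differentiable here. This
supplies the Jacobian for the area formula. -/
theorem IsAlexandrovPoint.hasFDerivAt {f : E → ℝ} {x p : E} {A : E →L[ℝ] E}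
    (h : IsAlexandrovPoint f x p A) {T : E → E} (hT : ∀ x, IsSubgradient f x (T x)) :
    HasFDerivAt T A x := by
  rw [hasFDerivAt_iff_isLittleO, Asymptotics.isLittleO_iff]
  intro ε hε
  filter_upwards [h.subgradient ε hε] with y hy
  rw [h.eq_gradient (hT x)]
  exact hy _ (hT y)

/-- The Hessian of the sup-convolution inherits the trace cone condition. -/
theorem traceCone_of_isAlexandrovPoint [FiniteDimensional ℝ E] {u : E → ℝ} {K : ℝ≥0} {ε c : ℝ}
    {s : Set E} (hu : LipschitzWith K u) (hε : 0 < ε) (hc : 0 ≤ c) (htc : IsTraceConvexOn c u s)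
    {x y p : E} {A : E →L[ℝ] E} (hy : IsConjugatePoint (supConvPotential u ε) x y) (hys : y ∈ s)
    (hA : IsAlexandrovPoint (convexConjugate (supConvPotential u ε)) x p A) :
    Module.finrank ℝ E ≤ opTrace A ∧
      ‖A - 1‖ ≤ (1 + c * Module.finrank ℝ E + c) * (opTrace A - Module.finrank ℝ E) := by
  have hex := exists_isConjugatePoint_supConvPotential hu hε.le
  obtain rfl := hA.eq_gradient (hy.isSubgradient hex)
  -- Moving `x` and `y` by the same `d` leaves `‖x - y‖` unchanged, so a paraboloid above the
  -- sup-convolution at `x` translates to one above `u` at `y`. The extra `δ` absorbs the little-o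
  -- error and is then sent to zero.
  have key : ∀ δ : ℝ, 0 < δ → ∀ ξ, 0 ≤ ⟪(A - 1 + δ • (1 : E →L[ℝ] E)) ξ, ξ⟫
      + c * opTrace (A - 1 + δ • (1 : E →L[ℝ] E)) * ‖ξ‖ ^ 2 := by
    intro δ hδ ξ
    have h1 : Tendsto (fun y' => x + (y' - y)) (𝓝 y) (𝓝 x) := by
      have : Continuous fun y' => x + (y' - y) := by fun_prop
      simpa using this.tendsto y
    have h2 := h1.eventually (hA.expansion.def (half_pos hδ))
    have h3 := htc y hys (ε⁻¹ • (y - x)) (ε⁻¹ • (A - 1 + δ • (1 : E →L[ℝ] E))) (by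
      filter_upwards [h2] with y' hy'
      rw [add_sub_cancel_left, Real.norm_eq_abs, Real.norm_of_nonneg (by positivity)] at hy'
      have h4 := (abs_le.1 hy').2
      have h5 := le_convexConjugate hex (x + (y' - y)) y'
      rw [hy.convexConjugate_eq] at h4
      set d := y' - y with hd
      have hy'd : y' = y + d := by rw [hd]; abel
      have hin : ⟪(A - 1 + δ • (1 : E →L[ℝ] E)) d, d⟫ = ⟪A d, d⟫ - ‖d‖ ^ 2 + δ * ‖d‖ ^ 2 := by
        simp [inner_add_left, inner_sub_left, inner_smul_left]
      have hsq : ‖y'‖ ^ 2 = ‖y‖ ^ 2 + 2 * ⟪y, d⟫ + ‖d‖ ^ 2 := by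
        rw [hy'd, norm_add_sq_real]
      have hpr : ⟪x + d, y'⟫ = ⟪x, y⟫ + ⟪x, d⟫ + ⟪y, d⟫ + ‖d‖ ^ 2 := by
        rw [hy'd, inner_add_left, inner_add_right, inner_add_right, real_inner_self_eq_norm_sq,
          real_inner_comm y d]
        ring
      rw [smul_apply, inner_smul_left, inner_smul_left, hin, inner_sub_left]
      simp only [supConvPotential, hsq, hpr, conj_trivial] at h4 h5 ⊢
      have h6 : ε * u y' ≤ ε * (u y + ε⁻¹ * (⟪y, d⟫ - ⟪x, d⟫)
          + ε⁻¹ * (⟪A d, d⟫ - ‖d‖ ^ 2 + δ * ‖d‖ ^ 2) / 2) := by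
        have : ε * (u y + ε⁻¹ * (⟪y, d⟫ - ⟪x, d⟫)
          + ε⁻¹ * (⟪A d, d⟫ - ‖d‖ ^ 2 + δ * ‖d‖ ^ 2) / 2) = ε * u y + (⟪y, d⟫ - ⟪x, d⟫)
          + (⟪A d, d⟫ - ‖d‖ ^ 2 + δ * ‖d‖ ^ 2) / 2 := by field_simp
        rw [this]
        linarith
      exact le_of_mul_le_mul_left h6 hε) ξ
    rw [opTrace_smul, smul_apply, inner_smul_left, conj_trivial] at h3
    have h4 : ε⁻¹ * ⟪(A - 1 + δ • (1 : E →L[ℝ] E)) ξ, ξ⟫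
      + c * (ε⁻¹ * opTrace (A - 1 + δ • (1 : E →L[ℝ] E))) * ‖ξ‖ ^ 2
      = ε⁻¹ * (⟪(A - 1 + δ • (1 : E →L[ℝ] E)) ξ, ξ⟫
      + c * opTrace (A - 1 + δ • (1 : E →L[ℝ] E)) * ‖ξ‖ ^ 2) := by ring
    rw [h4] at h3
    exact nonneg_of_mul_nonneg_right h3 (by positivity)
  have h0 : ∀ ξ, 0 ≤ ⟪(A - 1) ξ, ξ⟫ + c * opTrace (A - 1) * ‖ξ‖ ^ 2 := by
    intro ξ
    have hlim : Tendsto (fun δ : ℝ => ⟪(A - 1 + δ • (1 : E →L[ℝ] E)) ξ, ξ⟫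
      + c * opTrace (A - 1 + δ • (1 : E →L[ℝ] E)) * ‖ξ‖ ^ 2) (𝓝[>] 0)
      (𝓝 (⟪(A - 1) ξ, ξ⟫ + c * opTrace (A - 1) * ‖ξ‖ ^ 2)) := by
      have : Continuous (fun δ : ℝ => ⟪(A - 1 + δ • (1 : E →L[ℝ] E)) ξ, ξ⟫
        + c * opTrace (A - 1 + δ • (1 : E →L[ℝ] E)) * ‖ξ‖ ^ 2) := by
        simp only [opTrace_add, opTrace_smul, add_apply, smul_apply]
        fun_prop
      simpa using (this.tendsto 0).mono_left nhdsWithin_le_nhds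
    refine ge_of_tendsto hlim ?_
    filter_upwards [self_mem_nhdsWithin] with δ hδ using key δ hδ ξ
  have := norm_le_of_traceCone hc (A := A - 1) (fun v w => by
    simp only [sub_apply, one_apply_eq_self, inner_sub_left]
    rw [hA.symm, real_inner_comm v w]) h0
  rw [opTrace_sub, opTrace_one] at this
  exact ⟨by linarith [this.1], this.2⟩

end TraceCone

/-! ### Discrete Laplacians and a weak-type bound on the trace of the Hessian. -/

section SecondDifference

open scoped RealInnerProductSpace

/-- The discrete Laplacian with step `t`. -/
noncomputable def discreteLaplacian {E : Type*} [NormedAddCommGroup E] [InnerProductSpace ℝ E]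
    [FiniteDimensional ℝ E] (f : E → ℝ) (t : ℝ) (x : E) : ℝ :=
  ∑ i, (f (x + t • stdOrthonormalBasis ℝ E i) + f (x - t • stdOrthonormalBasis ℝ E i)
    - 2 * f x) / t ^ 2

variable {E : Type*} [NormedAddCommGroup E] [InnerProductSpace ℝ E] [FiniteDimensional ℝ E]

theorem continuous_discreteLaplacian {f : E → ℝ} (hf : Continuous f) (t : ℝ) :
    Continuous (discreteLaplacian f t) := by
  unfold discreteLaplacian
  fun_prop

theorem discreteLaplacian_nonneg {f : E → ℝ} (hf : ∀ x, ∃ p, IsSubgradient f x p) (t : ℝ)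
    (x : E) : 0 ≤ discreteLaplacian f t x := by
  refine Finset.sum_nonneg fun i _ => div_nonneg ?_ (sq_nonneg t)
  obtain ⟨p, hp⟩ := hf x
  have h1 := hp (x + t • stdOrthonormalBasis ℝ E i)
  have h2 := hp (x - t • stdOrthonormalBasis ℝ E i)
  rw [add_sub_cancel_left] at h1
  rw [sub_sub_cancel_left, inner_neg_right] at h2
  linarith

theorem IsAlexandrovPoint.tendsto_discreteLaplacian {f : E → ℝ} {x p : E} {A : E →L[ℝ] E}
    (h : IsAlexandrovPoint f x p A) :
    Tendsto (fun t => discreteLaplacian f t x) (𝓝[>] 0) (𝓝 (opTrace A)) := by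
  rw [opTrace_eq_sum (stdOrthonormalBasis ℝ E)]
  refine tendsto_finsetSum _ fun i _ => ?_
  set b := stdOrthonormalBasis ℝ E i with hb
  have hbn : ‖b‖ = 1 := (stdOrthonormalBasis ℝ E).norm_eq_one i
  rw [Metric.tendsto_nhds]
  intro ε hε
  have hT : ∀ v : E, Tendsto (fun t : ℝ => x + t • v) (𝓝[>] 0) (𝓝 x) := fun v => by
    have : Continuous fun t : ℝ => x + t • v := by fun_prop
    simpa using (this.tendsto 0).mono_left nhdsWithin_le_nhds
  have hε3 : 0 < ε / 3 := by positivity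
  filter_upwards [(hT b).eventually (h.expansion.def hε3),
    (hT (-b)).eventually (h.expansion.def hε3), self_mem_nhdsWithin] with t h1 h2 ht
  have ht : 0 < t := ht
  simp only [add_sub_cancel_left, map_smul, map_neg, inner_smul_left, inner_smul_right, inner_neg_left,
    inner_neg_right, norm_smul, norm_neg, hbn, Real.norm_eq_abs, abs_of_pos ht, conj_trivial,
    abs_pow, mul_one, smul_neg, mul_neg, neg_neg] at h1 h2
  rw [Real.dist_eq]
  have h3 : (f (x + t • b) + f (x - t • b) - 2 * f x) / t ^ 2 - ⟪A b, b⟫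
      = ((f (x + t • b) - f x - t * ⟪p, b⟫ - t * (t * ⟪A b, b⟫) / 2) +
        (f (x + -(t • b)) - f x - -(t * ⟪p, b⟫) - t * (t * ⟪A b, b⟫) / 2)) / t ^ 2 := by
    rw [← sub_eq_add_neg]
    field_simp
    ring
  rw [h3, abs_div, abs_of_pos (pow_pos ht 2), div_lt_iff₀ (by positivity)]
  refine (abs_add_le _ _).trans_lt ?_
  have : 0 < ε * t ^ 2 := by positivity
  nlinarith

variable [MeasurableSpace E] [BorelSpace E]

/-- Summation by parts moves one difference onto the cutoff, which is 1-Lipschitz. The other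
difference costs `L ‖w‖`, so no second derivative of `v` enters. -/
theorem integral_cutoff_secondDifference_le {v : E → ℝ} {L : ℝ≥0} (hv : LipschitzWith L v)
    (ρ : ℝ) {w : E} (hw : ‖w‖ ≤ 1) :
    ∫ x, max 0 (ρ - ‖x‖) * (v (x + w) + v (x - w) - 2 * v x) ≤
      L * ‖w‖ ^ 2 * volume.real (Metric.closedBall (0 : E) (ρ + 1)) := by
  set φ : E → ℝ := fun x => max 0 (ρ - ‖x‖) with hφ
  have hφc : Continuous φ := by fun_prop
  have hφ0 : ∀ x, ρ ≤ ‖x‖ → φ x = 0 := fun x hx => max_eq_left (by linarith)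
  have hφs : HasCompactSupport φ := HasCompactSupport.intro (isCompact_closedBall (0 : E) ρ)
    fun x hx => hφ0 x (by simp only [mem_closedBall_zero_iff, not_le] at hx; exact hx.le)
  have hvc := hv.continuous
  have i1 : Integrable fun x => φ x * (v (x + w) - v x) :=
    Continuous.integrable_of_hasCompactSupport (by fun_prop) hφs.mul_right
  have i2 : Integrable fun x => φ x * (v x - v (x - w)) :=
    Continuous.integrable_of_hasCompactSupport (by fun_prop) hφs.mul_right
  have i3 : Integrable fun x => φ (x + w) * (v (x + w) - v x) := by
    have := i2.comp_add_right w
    simpa using this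
  have e1 : ∫ x, φ x * (v (x + w) + v (x - w) - 2 * v x)
      = ∫ x, (φ x - φ (x + w)) * (v (x + w) - v x) := by
    calc ∫ x, φ x * (v (x + w) + v (x - w) - 2 * v x)
        = ∫ x, (φ x * (v (x + w) - v x) - φ x * (v x - v (x - w))) := by
          congr 1; ext x; ring
      _ = (∫ x, φ x * (v (x + w) - v x)) - ∫ x, φ x * (v x - v (x - w)) := integral_sub i1 i2
      _ = (∫ x, φ x * (v (x + w) - v x)) - ∫ x, φ (x + w) * (v (x + w) - v x) := by
          congr 1
          rw [← integral_add_right_eq_self (fun x => φ x * (v x - v (x - w))) w]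
          simp
      _ = _ := by
          rw [← integral_sub i1 i3]
          congr 1; ext x; ring
  rw [e1]
  have e2 : ∫ x in Metric.closedBall (0 : E) (ρ + 1), (φ x - φ (x + w)) * (v (x + w) - v x)
      = ∫ x, (φ x - φ (x + w)) * (v (x + w) - v x) := by
    apply setIntegral_eq_integral_of_forall_compl_eq_zero
    intro x hx
    simp only [mem_closedBall_zero_iff, not_le] at hx
    have h1 : ρ ≤ ‖x + w‖ := by
      have := norm_sub_le (x + w) w
      rw [add_sub_cancel_right] at this
      linarith
    rw [hφ0 x (by linarith), hφ0 _ h1, sub_self, zero_mul]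
  rw [← e2]
  refine (le_abs_self _).trans ?_
  rw [← Real.norm_eq_abs]
  refine norm_setIntegral_le_of_norm_le_const measure_closedBall_lt_top fun x _ => ?_
  have h1 := hv.dist_le_mul (x + w) x
  rw [Real.dist_eq, dist_eq_norm, add_sub_cancel_left] at h1
  have h2 : |φ x - φ (x + w)| ≤ ‖w‖ := by
    have h3 := norm_add_le x w
    have h4 := norm_sub_le (x + w) w
    rw [add_sub_cancel_right] at h4
    simp only [hφ]
    have h5 := abs_max_sub_max_le_abs (ρ - ‖x‖) (ρ - ‖x + w‖) 0
    rw [max_comm _ 0, max_comm _ 0] at h5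
    refine h5.trans (abs_le.2 ⟨by linarith, by linarith⟩)
  rw [norm_mul, Real.norm_eq_abs, Real.norm_eq_abs]
  calc |φ x - φ (x + w)| * |v (x + w) - v x| ≤ ‖w‖ * (L * ‖w‖) := by gcongr
    _ = L * ‖w‖ ^ 2 := by ring

/-- By the parallelogram law `‖x‖² / 2` contributes exactly the dimension; the Lipschitz remainder
is handled one direction at a time. -/
theorem integral_cutoff_discreteLaplacian_le {ψ : E → ℝ} {L : ℝ≥0}
    (hv : LipschitzWith L fun x => ψ x - ‖x‖ ^ 2 / 2) (ρ : ℝ) {t : ℝ} (ht : 0 < t) (ht1 : t ≤ 1) :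
    ∫ x, max 0 (ρ - ‖x‖) * discreteLaplacian ψ t x ≤
      Module.finrank ℝ E * (∫ x : E, max 0 (ρ - ‖x‖)) +
      Module.finrank ℝ E * (L * volume.real (Metric.closedBall (0 : E) (ρ + 1))) := by
  set φ : E → ℝ := fun x => max 0 (ρ - ‖x‖) with hφ
  have hφc : Continuous φ := by fun_prop
  have hφs : HasCompactSupport φ := HasCompactSupport.intro (isCompact_closedBall (0 : E) ρ)
    fun x hx => by
      simp only [mem_closedBall_zero_iff, not_le] at hx
      exact max_eq_left (by linarith)
  set v : E → ℝ := fun x => ψ x - ‖x‖ ^ 2 / 2 with hvdef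
  have hvc : Continuous v := hv.continuous
  set b := stdOrthonormalBasis ℝ E with hb
  have hbn : ∀ i, ‖t • b i‖ = t := fun i => by
    rw [norm_smul, b.norm_eq_one, mul_one, Real.norm_of_nonneg ht.le]
  have e1 : ∀ x, φ x * discreteLaplacian ψ t x = Module.finrank ℝ E * φ x +
      ∑ i, (t ^ 2)⁻¹ * (φ x * (v (x + t • b i) + v (x - t • b i) - 2 * v x)) := by
    intro x
    have h1 : ∀ i, (ψ (x + t • b i) + ψ (x - t • b i) - 2 * ψ x) / t ^ 2
        = 1 + (t ^ 2)⁻¹ * (v (x + t • b i) + v (x - t • b i) - 2 * v x) := by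
      intro i
      have h2 := parallelogram_law_with_norm ℝ x (t • b i)
      rw [hbn] at h2
      simp only [hvdef]
      field_simp
      nlinarith
    simp only [discreteLaplacian, ← hb, h1, Finset.sum_add_distrib, mul_add, Finset.mul_sum]
    simp only [Finset.sum_const, Finset.card_univ, Fintype.card_fin, nsmul_eq_mul]
    congr 1
    · ring
    · exact Finset.sum_congr rfl fun i _ => by ring
  have i0 : Integrable φ := hφc.integrable_of_hasCompactSupport hφs
  have i1 : ∀ i, Integrable fun x =>
      (t ^ 2)⁻¹ * (φ x * (v (x + t • b i) + v (x - t • b i) - 2 * v x)) := fun i =>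
    (Continuous.integrable_of_hasCompactSupport (by fun_prop) hφs.mul_right).const_mul _
  change ∫ x, φ x * discreteLaplacian ψ t x ≤ Module.finrank ℝ E * (∫ x : E, φ x) + _
  simp_rw [e1]
  rw [integral_add (i0.const_mul _) (integrable_finsetSum _ fun i _ => i1 i),
    integral_const_mul, integral_finsetSum _ fun i _ => i1 i]
  gcongr
  refine (Finset.sum_le_card_nsmul _ _ (L * volume.real (Metric.closedBall (0 : E) (ρ + 1)))
    fun i _ => ?_).trans (le_of_eq (by simp))
  rw [integral_const_mul, inv_mul_le_iff₀ (by positivity)]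
  have := integral_cutoff_secondDifference_le hv ρ (w := t • b i) (by rw [hbn]; exact ht1)
  rw [hbn] at this
  refine this.trans (le_of_eq (by ring))

open scoped ENNReal in
/-- Weak-type bound for the Hessian of a convex function that is a Lipschitz perturbation of
`‖x‖² / 2`. -/
theorem volume_large_trace_le {ψ : E → ℝ} {L : ℝ≥0} (hψ : ∀ x, ∃ p, IsSubgradient ψ x p)
    (hv : LipschitzWith L fun x => ψ x - ‖x‖ ^ 2 / 2) {r ρ δ : ℝ} (hr : r < ρ) (hδ : 0 < δ)
    (htr : ∀ x ∈ Metric.ball (0 : E) ρ, ∀ p A, IsAlexandrovPoint ψ x p A →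
      Module.finrank ℝ E ≤ opTrace A) :
    volume {x ∈ Metric.ball (0 : E) r | ∃ p A, IsAlexandrovPoint ψ x p A ∧
        Module.finrank ℝ E + δ ≤ opTrace A} ≤
      ENNReal.ofReal (Module.finrank ℝ E * (L * volume.real (Metric.closedBall (0 : E) (ρ + 1)))
        / (δ * (ρ - r))) := by
  set n : ℝ := (Module.finrank ℝ E : ℝ) with hn
  have hn0 : 0 ≤ n := by positivity
  set M : ℝ := n * (L * volume.real (Metric.closedBall (0 : E) (ρ + 1))) with hM
  have hM0 : 0 ≤ M := by positivity
  set φ : E → ℝ := fun x => max 0 (ρ - ‖x‖) with hφ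
  have hφc : Continuous φ := by fun_prop
  have hφ0 : ∀ x, 0 ≤ φ x := fun x => le_max_left _ _
  have hφs : HasCompactSupport φ := HasCompactSupport.intro (isCompact_closedBall (0 : E) ρ)
    fun x hx => by
      simp only [mem_closedBall_zero_iff, not_le] at hx
      exact max_eq_left (by linarith)
  have hφi : Integrable φ := hφc.integrable_of_hasCompactSupport hφs
  have hψc := continuous_of_subgradient hψ
  set t : ℕ → ℝ := fun j => 1 / ((j : ℝ) + 1) with ht
  have ht0 : ∀ j, 0 < t j := fun j => by positivity
  have ht1 : ∀ j, t j ≤ 1 := fun j => by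
    simp only [ht]
    rw [div_le_one (by positivity)]
    linarith [(Nat.cast_nonneg j : (0 : ℝ) ≤ j)]
  have htl : Tendsto t atTop (𝓝[>] 0) :=
    tendsto_nhdsWithin_iff.2 ⟨tendsto_one_div_add_atTop_nhds_zero_nat, Eventually.of_forall ht0⟩
  set D : ℕ → E → ℝ≥0∞ := fun j x => ENNReal.ofReal (φ x * discreteLaplacian ψ (t j) x) with hD
  have hDm : ∀ j, Measurable (D j) := fun j =>
    ENNReal.measurable_ofReal.comp
      (hφc.mul (continuous_discreteLaplacian hψc (t j))).measurable
  have hDi : ∀ j, ∫⁻ x, D j x ≤ ENNReal.ofReal (n * ∫ x, φ x) + ENNReal.ofReal M := by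
    intro j
    have hc := hφc.mul (continuous_discreteLaplacian hψc (t j))
    have h1 : Integrable fun x => φ x * discreteLaplacian ψ (t j) x :=
      hc.integrable_of_hasCompactSupport hφs.mul_right
    rw [← ofReal_integral_eq_lintegral_ofReal h1 (Eventually.of_forall fun x =>
      mul_nonneg (hφ0 x) (discreteLaplacian_nonneg hψ _ _)),
      ← ENNReal.ofReal_add (mul_nonneg hn0 (integral_nonneg hφ0)) hM0]
    exact ENNReal.ofReal_le_ofReal (integral_cutoff_discreteLaplacian_le hv ρ (ht0 j) (ht1 j))
  have hfatou : ∫⁻ x, liminf (fun j => D j x) atTop ≤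
      ENNReal.ofReal (n * ∫ x, φ x) + ENNReal.ofReal M := by
    refine (lintegral_liminf_le hDm).trans ?_
    refine liminf_le_of_frequently_le' (Frequently.of_forall fun j => hDi j)
  have hlim : ∀ x p A, IsAlexandrovPoint ψ x p A →
      liminf (fun j => D j x) atTop = ENNReal.ofReal (φ x * opTrace A) := by
    intro x p A hA
    apply Tendsto.liminf_eq
    exact ENNReal.tendsto_ofReal ((hA.tendsto_discreteLaplacian.comp htl).const_mul _)
  -- A measurable set that contains the points of large trace, whose own measurability is not
  -- evident.
  set S : Set E := {x | ENNReal.ofReal (n * φ x + δ * (ρ - r)) ≤ liminf (fun j => D j x) atTop}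
    with hS
  have hSm : MeasurableSet S := by
    apply measurableSet_le
    · exact ENNReal.measurable_ofReal.comp (by fun_prop)
    · exact Measurable.liminf hDm
  have hsub : {x ∈ Metric.ball (0 : E) r | ∃ p A, IsAlexandrovPoint ψ x p A ∧
      n + δ ≤ opTrace A} ⊆ S := by
    rintro x ⟨hx, p, A, hA, htA⟩
    rw [mem_ball_zero_iff] at hx
    simp only [hS, mem_ofPred_eq]
    rw [hlim x p A hA]
    apply ENNReal.ofReal_le_ofReal
    have h1 : ρ - r ≤ φ x := le_trans (by linarith) (le_max_right _ _)
    nlinarith [hφ0 x]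
  -- The liminf is at least `n φ` almost everywhere, with excess `δ (ρ - r)` on `S`. Cancelling the
  -- finite `n ∫ φ` from Fatou's bound leaves `δ (ρ - r) |S| ≤ M`.
  have hptw : ∀ᵐ x : E, ENNReal.ofReal (n * φ x)
      + S.indicator (fun _ => ENNReal.ofReal (δ * (ρ - r))) x ≤
      liminf (fun j => D j x) atTop := by
    filter_upwards [ae_isAlexandrovPoint hψ] with x hx
    obtain ⟨p, A, hA⟩ := hx
    by_cases hxS : x ∈ S
    · rw [indicator_of_mem hxS, ← ENNReal.ofReal_add (mul_nonneg hn0 (hφ0 x))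
        (mul_nonneg hδ.le (by linarith))]
      exact hxS
    · rw [indicator_of_notMem hxS, add_zero, hlim x p A hA]
      apply ENNReal.ofReal_le_ofReal
      by_cases hxρ : x ∈ Metric.ball (0 : E) ρ
      · have := htr x hxρ p A hA
        nlinarith [hφ0 x]
      · rw [mem_ball_zero_iff, not_lt] at hxρ
        have : φ x = 0 := max_eq_left (by linarith)
        rw [this]; simp
  have hint := (lintegral_mono_ae hptw).trans hfatou
  rw [lintegral_add_right _ (measurable_const.indicator hSm), lintegral_indicator_const hSm,
    ← ofReal_integral_eq_lintegral_ofReal (hφi.const_mul n) (Eventually.of_forall fun x =>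
      mul_nonneg hn0 (hφ0 x)), integral_const_mul] at hint
  have hfin := (ENNReal.add_le_add_iff_left ENNReal.ofReal_ne_top).1 hint
  have hpos : 0 < δ * (ρ - r) := mul_pos hδ (by linarith)
  refine (measure_mono hsub).trans ?_
  rw [ENNReal.ofReal_div_of_pos hpos, ENNReal.le_div_iff_mul_le
    (Or.inl (by simpa using hpos)) (Or.inl ENNReal.ofReal_ne_top), mul_comm]
  exact hfin

end SecondDifference

/-! ### The contact sets exhaust the ball. -/

section ContactMeasure

open scoped RealInnerProductSpace

variable {E : Type*} [NormedAddCommGroup E] [InnerProductSpace ℝ E]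

/-- If `T x = T x'`, monotonicity at both ends forces `⟪T (x + te) - T x, e⟫ = 0` along the segment.
Then `⟪DT(x) e, e⟫ = 0`, which is impossible when `DT(x)` is within `θ < 1` of the identity. -/
theorem injOn_of_monotone_of_fderiv {T : E → E} (hT : ∀ x y, 0 ≤ ⟪T x - T y, x - y⟫) {s : Set E}
    {θ : ℝ} (hθ : θ < 1) (hs : ∀ x ∈ s, DifferentiableAt ℝ T x ∧ ‖fderiv ℝ T x - 1‖ ≤ θ) :
    InjOn T s := by
  intro x hx x' _ hTx
  by_contra hne
  obtain ⟨hd, hn⟩ := hs x hx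
  set e := x' - x with he
  have he0 : 0 < ‖e‖ := norm_pos_iff.2 (sub_ne_zero.2 (Ne.symm hne))
  set ε := (1 - θ) / 2 with hε
  have hε0 : 0 < ε := by simp only [hε]; linarith
  have h1 : Tendsto (fun t : ℝ => x + t • e) (𝓝[>] 0) (𝓝 x) := by
    have : Continuous fun t : ℝ => x + t • e := by fun_prop
    simpa using (this.tendsto 0).mono_left nhdsWithin_le_nhds
  obtain ⟨t, h2, ht⟩ := ((h1.eventually (hd.hasFDerivAt.isLittleO.def hε0)).and
    (Ioo_mem_nhdsGT (zero_lt_one' ℝ))).exists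
  have m1 := hT (x + t • e) x
  have m2 := hT x' (x + t • e)
  have e1 : x' - (x + t • e) = (1 - t) • e := by rw [he]; module
  rw [add_sub_cancel_left, inner_smul_right] at m1
  rw [e1, inner_smul_right, ← hTx] at m2
  have m3 := nonneg_of_mul_nonneg_right m1 ht.1
  have m4 := nonneg_of_mul_nonneg_right m2 (sub_pos.2 ht.2)
  have m5 : ⟪T (x + t • e) - T x, e⟫ = 0 := by
    rw [← neg_sub, inner_neg_left] at m4
    linarith
  rw [add_sub_cancel_left, norm_smul, Real.norm_of_nonneg ht.1.le] at h2
  have h3 := (abs_real_inner_le_norm (T (x + t • e) - T x - fderiv ℝ T x (t • e)) e).trans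
    (mul_le_mul_of_nonneg_right h2 (norm_nonneg e))
  rw [inner_sub_left, m5, map_smul, inner_smul_left, conj_trivial, zero_sub, abs_neg, abs_mul,
    abs_of_pos ht.1] at h3
  have h4 : t * |⟪fderiv ℝ T x e, e⟫| ≤ t * (ε * ‖e‖ * ‖e‖) := by linarith
  have h5 := le_of_mul_le_mul_left h4 ht.1
  have h6 : ⟪(fderiv ℝ T x - 1) e, e⟫ = ⟪fderiv ℝ T x e, e⟫ - ‖e‖ ^ 2 := by
    rw [sub_apply, inner_sub_left, one_apply_eq_self, real_inner_self_eq_norm_sq]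
  have h7 : |⟪(fderiv ℝ T x - 1) e, e⟫| ≤ θ * ‖e‖ * ‖e‖ :=
    (abs_real_inner_le_norm _ _).trans (mul_le_mul_of_nonneg_right
      (ContinuousLinearMap.le_of_opNorm_le _ hn e) (norm_nonneg e))
  have h8 := (abs_le.1 h7).1
  have h9 := (abs_le.1 h5).2
  have : 0 < ‖e‖ ^ 2 := by positivity
  nlinarith

variable [FiniteDimensional ℝ E] {u : E → ℝ} {K : ℝ≥0} {ε c : ℝ}

/-- The function is `ε` times the sup-convolution. Moving the maximiser along with `x` keeps the
penalty `‖x - y‖²` fixed, so only the variation of `u` is felt. -/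
theorem lipschitzWith_supConvolution (hu : LipschitzWith K u) (hε : 0 ≤ ε) :
    LipschitzWith (⟨ε, hε⟩ * K) fun x => convexConjugate (supConvPotential u ε) x - ‖x‖ ^ 2 / 2 := by
  have hex := exists_isConjugatePoint_supConvPotential hu hε
  refine LipschitzWith.of_le_add_mul _ fun x x' => ?_
  obtain ⟨y, hy⟩ := hex x
  have h1 := le_convexConjugate hex x' (y + (x' - x))
  rw [hy.convexConjugate_eq]
  have h2 := hu.dist_le_mul (y + (x' - x)) y
  rw [Real.dist_eq, dist_eq_norm, add_sub_cancel_left, norm_sub_rev] at h2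
  have h3 := mul_le_mul_of_nonneg_left (abs_le.1 h2).1 hε
  have h4 : ‖x' - (y + (x' - x))‖ = ‖x - y‖ := by congr 1; abel
  have h5 := norm_sub_sq_real x' (y + (x' - x))
  have h6 := norm_sub_sq_real x y
  rw [h4] at h5
  simp only [supConvPotential] at h1 ⊢
  rw [dist_eq_norm]
  change _ ≤ _ + ε * K * ‖x - x'‖
  nlinarith

variable [MeasurableSpace E] [BorelSpace E]

-- Where the trace exceeds the dimension by less than `δ`, the maximiser map `T` has derivative
-- close to the identity. There it is injective with Jacobian at least `1 - η`, and its image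
-- consists of contact points; the remaining `x` fall under the weak-type bound.
open scoped ENNReal in
theorem volume_ball_le_volume_upperContactSet (hu : LipschitzWith K u) (hε : 0 < ε) (hc : 0 ≤ c)
    (htc : IsTraceConvexOn c u (Metric.ball 0 1)) {r ρ δ η : ℝ} (hr : r < ρ)
    (hρ : ρ + 2 * K * ε ≤ 1) (hδ : 0 < δ)
    (hδ1 : (1 + c * Module.finrank ℝ E + c) * δ < 1) (hη : 0 ≤ η)
    (hdet : ∀ B : E →L[ℝ] E, ‖B - 1‖ ≤ (1 + c * Module.finrank ℝ E + c) * δ → 1 - η ≤ |B.det|) :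
    ENNReal.ofReal (1 - η) * volume (Metric.ball (0 : E) r) ≤
      volume (upperContactSet u ε ∩ Metric.ball 0 1) +
      ENNReal.ofReal (Module.finrank ℝ E *
        (ε * K * volume.real (Metric.closedBall (0 : E) (ρ + 1))) / (δ * (ρ - r))) := by
  set C := 1 + c * Module.finrank ℝ E + c with hC
  set ψ := convexConjugate (supConvPotential u ε) with hψ
  have hex := exists_isConjugatePoint_supConvPotential hu hε.le
  choose T hT using id hex
  have hTs : ∀ x, IsSubgradient ψ x (T x) := fun x => (hT x).isSubgradient hex
  have hTb : ∀ x ∈ Metric.ball (0 : E) ρ, T x ∈ Metric.ball (0 : E) 1 := by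
    intro x hx
    rw [mem_ball_zero_iff] at hx ⊢
    have h1 := (hT x).norm_sub_le hu hε.le
    have h2 := norm_sub_norm_le (T x) x
    rw [norm_sub_rev] at h2
    linarith
  set s : Set E := Metric.ball 0 r ∩
    ({x | DifferentiableAt ℝ T x} ∩ {x | ‖fderiv ℝ T x - 1‖ ≤ C * δ}) with hs
  have hsm : MeasurableSet s := by
    refine measurableSet_ball.inter ((measurableSet_of_differentiableAt ℝ T).inter ?_)
    exact measurableSet_le ((measurable_fderiv ℝ T).sub_const 1).norm measurable_const
  have hinj : InjOn T s := injOn_of_monotone_of_fderiv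
    (fun x y => (hTs x).monotone (hTs y)) hδ1 fun x hx => hx.2
  have himg : T '' s ⊆ upperContactSet u ε ∩ Metric.ball 0 1 := by
    rintro _ ⟨x, hx, rfl⟩
    exact ⟨(hT x).mem_upperContactSet hu hε.le, hTb x (Metric.ball_subset_ball hr.le hx.1)⟩
  have harea := lintegral_abs_det_fderiv_eq_addHaar_image volume hsm
    (fun x hx => (hx.2.1.hasFDerivAt).hasFDerivWithinAt) hinj
  have h1 : ENNReal.ofReal (1 - η) * volume s ≤ volume (upperContactSet u ε ∩ Metric.ball 0 1) := by
    refine le_trans ?_ (measure_mono himg)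
    rw [← harea, ← setLIntegral_const]
    exact setLIntegral_mono' hsm fun x hx => ENNReal.ofReal_le_ofReal (hdet _ hx.2.2)
  set bad := {x ∈ Metric.ball (0 : E) r | ∃ p A, IsAlexandrovPoint ψ x p A ∧
        Module.finrank ℝ E + δ ≤ opTrace A} with hbad
  have h2 : volume bad ≤ _ := volume_large_trace_le (fun x => ⟨_, hTs x⟩)
    (lipschitzWith_supConvolution hu hε.le) hr hδ
    (fun x hx p A hA => (traceCone_of_isAlexandrovPoint hu hε hc htc (hT x) (hTb x hx) hA).1)
  have h3 : volume (Metric.ball (0 : E) r) ≤ volume s + volume bad := by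
    refine le_trans (measure_mono_ae ?_) (measure_union_le s bad)
    filter_upwards [ae_isAlexandrovPoint (f := ψ) fun x => ⟨_, hTs x⟩] with x hx hxr
    obtain ⟨p, A, hA⟩ := hx
    by_cases hAt : Module.finrank ℝ E + δ ≤ opTrace A
    · exact Or.inr ⟨hxr, p, A, hA, hAt⟩
    · left
      have hd := hA.hasFDerivAt hTs
      refine ⟨hxr, hd.differentiableAt, ?_⟩
      have h4 := (traceCone_of_isAlexandrovPoint hu hε hc htc (hT x)
        (hTb x (Metric.ball_subset_ball hr.le hxr)) hA).2
      change ‖fderiv ℝ T x - 1‖ ≤ C * δ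
      rw [hd.fderiv]
      refine h4.trans ?_
      rw [not_le] at hAt
      have : 0 ≤ C := by positivity
      exact mul_le_mul_of_nonneg_left (by linarith) this
  calc ENNReal.ofReal (1 - η) * volume (Metric.ball (0 : E) r)
      ≤ ENNReal.ofReal (1 - η) * (volume s + volume bad) := by gcongr
    _ = ENNReal.ofReal (1 - η) * volume s + ENNReal.ofReal (1 - η) * volume bad := mul_add _ _ _
    _ ≤ _ := by
      refine add_le_add h1 ((mul_le_of_le_one_left zero_le ?_).trans h2)
      exact ENNReal.ofReal_le_one.2 (by linarith)

open scoped ENNReal in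
/-- Almost every point is touched from above by a paraboloid. -/
theorem ae_mem_iUnion_upperContactSet (hu : LipschitzWith K u) (hc : 0 ≤ c)
    (htc : IsTraceConvexOn c u (Metric.ball 0 1)) :
    ∀ᵐ x : E, x ∈ Metric.ball (0 : E) 1 →
      x ∈ ⋃ j : ℕ, upperContactSet u (1 / ((j : ℝ) + 1)) := by
  set H : Set E := ⋃ j : ℕ, upperContactSet u (1 / ((j : ℝ) + 1)) with hH
  have hHm : MeasurableSet H := MeasurableSet.iUnion fun j =>
    (isClosed_upperContactSet hu (by positivity)).measurableSet
  set C := 1 + c * Module.finrank ℝ E + c with hC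
  have hC0 : 0 < C := by positivity
  have key : ∀ η : ℝ, 0 < η → η < 1 → ENNReal.ofReal (1 - η) *
      (ENNReal.ofReal ((1 - η) ^ Module.finrank ℝ E) * volume (Metric.ball (0 : E) 1)) ≤
        volume (H ∩ Metric.ball 0 1) := by
    intro η hη hη1
    have hcont : Continuous fun B : E →L[ℝ] E => |B.det| :=
      (ContinuousLinearMap.continuous_det).abs
    have h1 : ∀ᶠ B : E →L[ℝ] E in 𝓝 1, 1 - η < |B.det| := by
      apply hcont.continuousAt.eventually
      apply lt_mem_nhds
      have : (1 : E →L[ℝ] E).det = 1 := LinearMap.det_id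
      simp only [this, abs_one]; linarith
    obtain ⟨δ₀, hδ₀, hball⟩ := Metric.eventually_nhds_iff.1 h1
    -- This depends on `η` but not on `ε`, so the exceptional measure, of order `ε / δ`, vanishes as
    -- `ε → 0`.
    set δ := min (δ₀ / 2) (1 / 2) / C with hδdef
    have hδ : 0 < δ := by positivity
    have hCδ : C * δ = min (δ₀ / 2) (1 / 2) := by rw [hδdef, mul_div_cancel₀ _ hC0.ne']
    have hδ1 : C * δ < 1 := by rw [hCδ]; exact (min_le_right _ _).trans_lt (by norm_num)
    have hdet : ∀ B : E →L[ℝ] E, ‖B - 1‖ ≤ C * δ → 1 - η ≤ |B.det| := by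
      intro B hB
      refine (hball ?_).le
      rw [dist_eq_norm]
      refine hB.trans_lt ?_
      rw [hCδ]
      exact (min_le_left _ _).trans_lt (by linarith)
    set ρ := 1 - η / 2 with hρ
    set M := Module.finrank ℝ E *
        (K * volume.real (Metric.closedBall (0 : E) (ρ + 1))) / (δ * (ρ - (1 - η))) with hM
    have hlim : Tendsto (fun j : ℕ => volume (H ∩ Metric.ball (0 : E) 1) +
        ENNReal.ofReal (1 / ((j : ℝ) + 1) * M)) atTop
        (𝓝 (volume (H ∩ Metric.ball (0 : E) 1) + ENNReal.ofReal (0 * M))) :=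
      tendsto_const_nhds.add (ENNReal.tendsto_ofReal
        (tendsto_one_div_add_atTop_nhds_zero_nat.mul_const M))
    rw [zero_mul, ENNReal.ofReal_zero, add_zero] at hlim
    refine ge_of_tendsto hlim ?_
    have hsmall : ∀ᶠ j : ℕ in atTop, 2 * K * (1 / ((j : ℝ) + 1)) < η / 2 := by
      have := (tendsto_one_div_add_atTop_nhds_zero_nat (𝕜 := ℝ)).const_mul (2 * (K : ℝ))
      rw [mul_zero] at this
      exact this.eventually (gt_mem_nhds (by linarith))
    filter_upwards [hsmall] with j hj
    have h2 := volume_ball_le_volume_upperContactSet hu (ε := 1 / ((j : ℝ) + 1)) (by positivity) hc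
      htc (r := 1 - η) (ρ := ρ) (δ := δ) (η := η) (by linarith) (by linarith) hδ hδ1 hη.le hdet
    rw [Measure.addHaar_ball_of_pos volume (0 : E) (by linarith)] at h2
    refine h2.trans (add_le_add (measure_mono (inter_subset_inter_left _
      (subset_iUnion (fun j : ℕ => upperContactSet u (1 / ((j : ℝ) + 1))) j))) (le_of_eq ?_))
    congr 1
    rw [hM]; ring
  have hge : volume (Metric.ball (0 : E) 1) ≤ volume (H ∩ Metric.ball 0 1) := by
    have hlim : Tendsto (fun η : ℝ => ENNReal.ofReal (1 - η) *
      (ENNReal.ofReal ((1 - η) ^ Module.finrank ℝ E) * volume (Metric.ball (0 : E) 1))) (𝓝[>] 0)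
      (𝓝 (ENNReal.ofReal (1 - 0) *
      (ENNReal.ofReal ((1 - 0) ^ Module.finrank ℝ E) * volume (Metric.ball (0 : E) 1)))) := by
      apply Tendsto.mono_left _ nhdsWithin_le_nhds
      apply ENNReal.Tendsto.mul
      · exact ENNReal.tendsto_ofReal (Continuous.tendsto (by fun_prop) 0)
      · simp
      · apply ENNReal.Tendsto.mul_const
        · exact ENNReal.tendsto_ofReal (Continuous.tendsto
            (f := fun η : ℝ => (1 - η) ^ Module.finrank ℝ E) (by fun_prop) 0)
        · simp
      · simp
    simp only [sub_zero, one_pow, ENNReal.ofReal_one, one_mul] at hlim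
    refine le_of_tendsto hlim ?_
    filter_upwards [Ioo_mem_nhdsGT (zero_lt_one' ℝ)] with η hη using key η hη.1 hη.2
  have := ae_eq_of_subset_of_measure_ge (inter_subset_right (s := H)) hge
    (hHm.inter measurableSet_ball).nullMeasurableSet measure_ball_lt_top.ne
  filter_upwards [this.mem_iff] with x hx hxb
  exact (hx.2 hxb).1

end ContactMeasure

/-! ### Comparison with powers of the distance. -/

section HolderComparison

open scoped RealInnerProductSpace

/-- The difference of the two sides vanishes to first order at `0` and has second derivative `2ε >
0` there. -/
theorem one_add_rpow_le_quadratic (β : ℝ) {ε : ℝ} (hε : 0 < ε) :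
    ∀ᶠ τ in 𝓝 (0 : ℝ), (1 + τ) ^ β ≤ 1 + β * τ + β * (β - 1) / 2 * τ ^ 2 + ε * τ ^ 2 := by
  set f : ℝ → ℝ := fun τ => 1 + β * τ + β * (β - 1) / 2 * τ ^ 2 + ε * τ ^ 2 - (1 + τ) ^ β with hf
  have hpos : ∀ᶠ τ in 𝓝 (0 : ℝ), 0 < 1 + τ :=
    (show Continuous fun τ : ℝ => 1 + τ by fun_prop).tendsto 0 |>.eventually
      (lt_mem_nhds (by norm_num))
  have hpow : ∀ (γ τ : ℝ), 0 < 1 + τ →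
      HasDerivAt (fun τ => (1 + τ) ^ γ) (γ * (1 + τ) ^ (γ - 1)) τ := by
    intro γ τ hτ
    have := ((hasDerivAt_id τ).const_add 1).rpow_const (p := γ) (Or.inl hτ.ne')
    simpa using this
  set f' : ℝ → ℝ := fun τ => β + (β * (β - 1) + 2 * ε) * τ - β * (1 + τ) ^ (β - 1) with hf'
  have h1 : ∀ᶠ τ in 𝓝 (0 : ℝ), HasDerivAt f (f' τ) τ := by
    filter_upwards [hpos] with τ hτ
    have h2 := (((((hasDerivAt_id τ).const_mul β).const_add 1).add
      (((hasDerivAt_id τ).pow 2).const_mul (β * (β - 1) / 2))).add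
      (((hasDerivAt_id τ).pow 2).const_mul ε)).sub (hpow β τ hτ)
    refine h2.congr_deriv ?_
    simp [hf']
    ring
  have h2 : HasDerivAt f' (2 * ε) 0 := by
    have h3 := (((hasDerivAt_id (0 : ℝ)).const_mul (β * (β - 1) + 2 * ε)).const_add β).sub
      ((hpow (β - 1) 0 (by norm_num)).const_mul β)
    refine h3.congr_deriv ?_
    simp
  have h3 : deriv f =ᶠ[𝓝 0] f' := h1.mono fun τ h => h.deriv
  have h4 : IsLocalMin f 0 := by
    apply isLocalMin_of_deriv_deriv_pos
    · rw [h3.deriv_eq, h2.deriv]; positivity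
    · rw [h3.eq_of_nhds]; simp [hf']
    · exact h1.self_of_nhds.continuousAt
  have h0 : f 0 = 0 := by simp [hf]
  filter_upwards [h4] with τ hτ
  rw [h0] at hτ
  simp only [hf] at hτ
  linarith

variable {E : Type*} [NormedAddCommGroup E] [InnerProductSpace ℝ E]

/-- Second order upper bound for a power of the norm. -/
theorem norm_rpow_le_paraboloid {α δ : ℝ} (hα : 0 < α) (hα1 : α < 1) (hδ : 0 < δ) {d₀ : E}
    (hd₀ : d₀ ≠ 0) :
    ∀ᶠ d in 𝓝 (0 : E), ‖d₀ + d‖ ^ α ≤ ‖d₀‖ ^ α + α * ‖d₀‖ ^ (α - 2) * ⟪d₀, d⟫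
      + (α * ‖d₀‖ ^ (α - 2) * ((α - 2) / ‖d₀‖ ^ 2 * ⟪d₀, d⟫ ^ 2 + ‖d‖ ^ 2) + δ * ‖d‖ ^ 2) / 2 := by
  set r := ‖d₀‖ with hr
  have hr0 : 0 < r := norm_pos_iff.2 hd₀
  set β := α / 2 with hβ
  have hra : 0 < r ^ α := Real.rpow_pos_of_pos hr0 α
  -- With `‖d₀ + d‖² = r² (1 + τ)` the power is `r^α (1 + τ)^(α/2)`. As `(τ r²)² ≤ 9 r² ‖d‖²`, this
  -- `ε` costs `δ ‖d‖² / 4`; the cubic remainder takes another `δ ‖d‖² / 4`.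
  set ε := δ * r ^ 2 / (36 * r ^ α) with hε
  have hε0 : 0 < ε := by positivity
  set τ : E → ℝ := fun d => (2 * ⟪d₀, d⟫ + ‖d‖ ^ 2) / r ^ 2 with hτ
  have hτc : Tendsto τ (𝓝 0) (𝓝 0) := by
    have : Continuous τ := by fun_prop
    simpa [hτ] using this.tendsto 0
  have hsmall : ∀ᶠ d in 𝓝 (0 : E), ‖d‖ < min r (δ * r ^ 3 / (4 * r ^ α)) := by
    have : Continuous fun d : E => ‖d‖ := continuous_norm
    exact (this.tendsto 0).eventually (gt_mem_nhds (by rw [norm_zero]; positivity))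
  filter_upwards [hτc.eventually (one_add_rpow_le_quadratic β hε0), hsmall] with d h1 h2
  set a := ⟪d₀, d⟫ with ha
  have ha1 : |a| ≤ r * ‖d‖ := abs_real_inner_le_norm _ _
  have hd1 : ‖d‖ ≤ r := (h2.trans_le (min_le_left _ _)).le
  have hd2 : ‖d‖ * (4 * r ^ α) ≤ δ * r ^ 3 := by
    rw [← le_div_iff₀ (by positivity)]; exact (h2.trans_le (min_le_right _ _)).le
  have e1 : ‖d₀ + d‖ ^ α = r ^ α * (1 + τ d) ^ β := by
    have h3 : 1 + τ d = (‖d₀ + d‖ / r) ^ 2 := by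
      rw [div_pow, norm_add_sq_real, ← hr]
      simp only [hτ]
      field_simp
      ring
    rw [h3, ← Real.rpow_natCast, ← Real.rpow_mul (by positivity), Nat.cast_ofNat,
      show 2 * β = α by rw [hβ]; ring, Real.div_rpow (norm_nonneg _) hr0.le,
      mul_div_cancel₀ _ hra.ne']
  have e2 : r ^ (α - 2) = r ^ α / r ^ 2 := by
    rw [Real.rpow_sub hr0, Real.rpow_ofNat]
  rw [e1, e2]
  have h3 := mul_le_mul_of_nonneg_left h1 hra.le
  refine h3.trans ?_
  have hτr : τ d * r ^ 2 = 2 * a + ‖d‖ ^ 2 := by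
    simp only [hτ, ha]; field_simp
  have hdn := norm_nonneg d
  -- bounds for `τ²`
  have t1 : (τ d * r ^ 2) ^ 2 ≤ 9 * r ^ 2 * ‖d‖ ^ 2 := by
    rw [hτr]
    have h4 : |2 * a + ‖d‖ ^ 2| ≤ 3 * r * ‖d‖ := by
      have := abs_le.1 ha1
      exact abs_le.2 ⟨by nlinarith, by nlinarith⟩
    have := sq_le_sq' (abs_le.1 h4).1 (abs_le.1 h4).2
    linarith
  have t2 : 4 * a ^ 2 - 4 * r * ‖d‖ ^ 3 ≤ (τ d * r ^ 2) ^ 2 := by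
    rw [hτr]
    have := (abs_le.1 ha1).1
    have h5 : -(r * ‖d‖) * ‖d‖ ^ 2 ≤ a * ‖d‖ ^ 2 := by gcongr
    nlinarith [sq_nonneg (‖d‖ ^ 2)]
  have hβ0 : 0 ≤ β * (1 - β) := by
    apply mul_nonneg <;> simp only [hβ] <;> linarith
  have hβ1 : β * (1 - β) ≤ 1 / 4 := by nlinarith [sq_nonneg (β - 1 / 2)]
  have b1 : r ^ α * ε * τ d ^ 2 ≤ δ / 4 * ‖d‖ ^ 2 := by
    have e3 : r ^ α * ε * τ d ^ 2 = δ / (36 * r ^ 2) * (τ d * r ^ 2) ^ 2 := by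
      rw [hε]; field_simp
    rw [e3]
    calc δ / (36 * r ^ 2) * (τ d * r ^ 2) ^ 2 ≤ δ / (36 * r ^ 2) * (9 * r ^ 2 * ‖d‖ ^ 2) := by
          gcongr
      _ = _ := by field_simp; ring
  have b2 : r ^ α * (β * (1 - β) / 2) * (4 * a ^ 2 - 4 * r * ‖d‖ ^ 3) / r ^ 4
      ≤ r ^ α * (β * (1 - β) / 2) * τ d ^ 2 := by
    rw [div_le_iff₀ (by positivity)]
    have e4 : r ^ α * (β * (1 - β) / 2) * τ d ^ 2 * r ^ 4
      = r ^ α * (β * (1 - β) / 2) * (τ d * r ^ 2) ^ 2 := by ring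
    rw [e4]
    gcongr
  have b3 : r ^ α * (β * (1 - β) / 2) * (4 * r * ‖d‖ ^ 3) / r ^ 4 ≤ δ / 4 * ‖d‖ ^ 2 := by
    rw [div_le_iff₀ (by positivity)]
    have h6 : r ^ α * (β * (1 - β) / 2) * (4 * r * ‖d‖ ^ 3) ≤
        r ^ α * ((1 / 4) / 2) * (4 * r * ‖d‖ ^ 3) := by gcongr
    have h7 : ‖d‖ * (4 * r ^ α) * (r * ‖d‖ ^ 2) ≤ δ * r ^ 3 * (r * ‖d‖ ^ 2) := by gcongr
    nlinarith [mul_nonneg (mul_nonneg hδ.le (pow_nonneg hr0.le 4)) (sq_nonneg ‖d‖)]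
  have e5 : r ^ α * (1 + β * τ d + β * (β - 1) / 2 * τ d ^ 2 + ε * τ d ^ 2)
      = r ^ α + r ^ α * β * (τ d * r ^ 2) / r ^ 2 - r ^ α * (β * (1 - β) / 2) * τ d ^ 2
        + r ^ α * ε * τ d ^ 2 := by
    field_simp; ring
  rw [e5, hτr]
  have e6 : r ^ α * (β * (1 - β) / 2) * (4 * a ^ 2 - 4 * r * ‖d‖ ^ 3) / r ^ 4
    = - (α * (r ^ α / r ^ 2) * ((α - 2) / r ^ 2 * a ^ 2) / 2)
      - r ^ α * (β * (1 - β) / 2) * (4 * r * ‖d‖ ^ 3) / r ^ 4 := by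
    rw [hβ]; field_simp; ring
  have e7 : r ^ α * β * (2 * a + ‖d‖ ^ 2) / r ^ 2
    = α * (r ^ α / r ^ 2) * a + α * (r ^ α / r ^ 2) * ‖d‖ ^ 2 / 2 := by
    rw [hβ]; field_simp
  rw [e7]
  rw [e6] at b2
  linarith

variable [FiniteDimensional ℝ E]

theorem opTrace_rankOne (d : E) :
    opTrace ((innerSL ℝ d).smulRight d) = ‖d‖ ^ 2 := by
  rw [opTrace_eq_sum (stdOrthonormalBasis ℝ E),
    ← (stdOrthonormalBasis ℝ E).sum_sq_norm_inner_right d]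
  refine Finset.sum_congr rfl fun i _ => ?_
  simp only [ContinuousLinearMap.smulRight_apply, innerSL_apply_apply, inner_smul_left,
    conj_trivial, Real.norm_eq_abs, sq_abs]
  rw [real_inner_comm, sq]

/-- The Hölder exponent attached to the cone `A + c tr(A) I ≥ 0` in dimension `n`. -/
noncomputable def coneExponent (c : ℝ) (n : ℕ) : ℝ := (1 - c * (n - 2)) / (2 * (1 + c))

theorem coneExponent_pos {c : ℝ} {n : ℕ} (hc : 0 ≤ c) (hcn : c * (n - 2) < 1) :
    0 < coneExponent c n := by
  unfold coneExponent
  apply div_pos <;> linarith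

theorem coneExponent_lt_one {c : ℝ} {n : ℕ} (hc : 0 ≤ c) : coneExponent c n < 1 := by
  unfold coneExponent
  rw [div_lt_one (by linarith)]
  have : 0 ≤ c * n := by positivity
  linarith

/-- Comparison with the power `‖x - y‖ ^ α`. -/
theorem IsTraceConvexOn.holder_comparison {u : E → ℝ} {c : ℝ} {s : Set E} (hc : 0 ≤ c)
    (hcn : c * (Module.finrank ℝ E - 2) < 1) (htc : IsTraceConvexOn c u s) (hu : Continuous u)
    {y p : E} {ρ m : ℝ} (hρ : 0 < ρ) (hs : Metric.closedBall y ρ ⊆ s)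
    (hm : ∀ x ∈ Metric.closedBall y ρ, u x - ⟪p, x⟫ ≤ m) {x : E}
    (hx : x ∈ Metric.closedBall y ρ) :
    u x - ⟪p, x⟫ ≤ u y - ⟪p, y⟫ +
      (‖x - y‖ / ρ) ^ coneExponent c (Module.finrank ℝ E) * (m - (u y - ⟪p, y⟫)) := by
  set n := Module.finrank ℝ E with hn
  set α := coneExponent c n with hα
  have hα0 : 0 < α := coneExponent_pos hc hcn
  have hα1 : α < 1 := coneExponent_lt_one hc
  -- Up to the factor `α r^(α-2)`, the Hessian of `‖·‖^α` is `α - 1` radially and `1` tangentially,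
  -- so the cone form in the radial direction is `α (1 + c) - (1 - c (n - 2))`. The exponent is half
  -- the value where this vanishes.
  have hαeq : α * (1 + c) = (1 - c * (n - 2)) / 2 := by
    rw [hα, coneExponent]; field_simp
  set v : E → ℝ := fun x => u x - ⟪p, x⟫ with hv
  have hvc : Continuous v := by fun_prop
  have hmy : v y ≤ m := hm y (Metric.mem_closedBall_self hρ.le)
  have hρα : 0 < ρ ^ α := Real.rpow_pos_of_pos hρ α
  -- The surplus `e` makes the barrier strictly larger on the sphere of radius `ρ`, so a positive
  -- maximum is attained in the interior, away from the singularity at `y`.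
  have key : ∀ e > 0, v x ≤ v y + ((m - v y) / ρ ^ α + e) * ‖x - y‖ ^ α := by
    intro e he
    set S := (m - v y) / ρ ^ α + e with hS
    have hS0 : 0 < S := add_pos_of_nonneg_of_pos (div_nonneg (by linarith) hρα.le) he
    set F : E → ℝ := fun x => v x - v y - S * ‖x - y‖ ^ α with hF
    have hFc : Continuous F := by
      have : Continuous fun x : E => ‖x - y‖ ^ α :=
        (continuous_norm.comp (continuous_sub_right y)).rpow_const fun _ => Or.inr hα0.le
      fun_prop
    obtain ⟨x₁, hx₁, hmax⟩ := (isCompact_closedBall y ρ).exists_isMaxOn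
      ⟨y, Metric.mem_closedBall_self hρ.le⟩ hFc.continuousOn
    suffices hle : F x₁ ≤ 0 by
      have := (hmax hx).trans hle
      simp only [hF] at this
      linarith
    by_contra! hpos
    have hFy : F y = 0 := by simp [hF, Real.zero_rpow hα0.ne']
    have hne : x₁ ≠ y := fun h => by rw [h, hFy] at hpos; exact lt_irrefl _ hpos
    have hlt : ‖x₁ - y‖ < ρ := by
      rw [mem_closedBall_iff_norm] at hx₁
      refine lt_of_le_of_ne hx₁ fun h => ?_
      have h1 := hm x₁ (by rw [mem_closedBall_iff_norm]; exact hx₁)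
      have h2 : F x₁ = v x₁ - m - e * ρ ^ α := by
        simp only [hF, h, hS]
        field_simp
        ring
      have : 0 < e * ρ ^ α := by positivity
      linarith
    set d₀ := x₁ - y with hd₀
    have hd₀0 : d₀ ≠ 0 := sub_ne_zero.2 hne
    set r := ‖d₀‖ with hr
    have hr0 : 0 < r := norm_pos_iff.2 hd₀0
    set k := α * r ^ (α - 2) with hk
    have hk0 : 0 < k := mul_pos hα0 (Real.rpow_pos_of_pos hr0 _)
    set κ := (1 - c * (n - 2)) / 2 with hκ
    have hκ0 : 0 < κ := by simp only [hκ]; linarith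
    -- Adding `δ I` raises the cone form by `δ (1 + c n)` per unit length squared; this choice uses
    -- half of the radial deficit `k κ`.
    set δ := k * κ / (2 * (1 + c * n)) with hδ
    have hδ0 : 0 < δ := by positivity
    have hδeq : δ * (1 + c * n) = k * κ / 2 := by rw [hδ]; field_simp
    set R : E →L[ℝ] E := (innerSL ℝ d₀).smulRight d₀ with hR
    set A : E →L[ℝ] E := S • (k • (((α - 2) / r ^ 2) • R + 1) + δ • 1) with hA
    have hRin : ∀ w, ⟪R w, w⟫ = ⟪d₀, w⟫ ^ 2 := fun w => by
      simp [hR, inner_smul_left, sq]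
    have hAin : ∀ w, ⟪A w, w⟫ = S * (k * ((α - 2) / r ^ 2 * ⟪d₀, w⟫ ^ 2 + ‖w‖ ^ 2)
        + δ * ‖w‖ ^ 2) := fun w => by
      rw [← hRin]
      simp [hA, inner_smul_left, inner_add_left]
      ring
    have hAtr : opTrace A = S * (k * ((α - 2) + n) + δ * n) := by
      rw [hA, opTrace_smul, opTrace_add, opTrace_smul, opTrace_smul, opTrace_add, opTrace_smul,
        hR, opTrace_rankOne, opTrace_one, ← hr, ← hn]
      field_simp
    have htouch : ∀ᶠ x in 𝓝 x₁, u x ≤ u x₁ + ⟪p + (S * k) • d₀, x - x₁⟫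
        + ⟪A (x - x₁), x - x₁⟫ / 2 := by
      have h1 : Tendsto (fun x => x - x₁) (𝓝 x₁) (𝓝 0) := by
        have : Continuous fun x => x - x₁ := by fun_prop
        simpa using this.tendsto x₁
      have h2 : ∀ᶠ x in 𝓝 x₁, x ∈ Metric.closedBall y ρ :=
        Filter.mem_of_superset (Metric.isOpen_ball.mem_nhds (mem_ball_iff_norm.2 hlt))
          Metric.ball_subset_closedBall
      filter_upwards [h1.eventually (norm_rpow_le_paraboloid hα0 hα1 hδ0 hd₀0), h2] with x h3 h4
      have h5 : F x ≤ F x₁ := hmax h4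
      have h6 : d₀ + (x - x₁) = x - y := by rw [hd₀]; abel
      rw [h6, ← hr, ← hk] at h3
      have h7 := mul_le_mul_of_nonneg_left h3 hS0.le
      rw [hAin, inner_add_left, inner_smul_left, conj_trivial, inner_sub_right p]
      simp only [hF, hv, ← hd₀, ← hr] at h5
      linarith
    have h8 := htc x₁ (hs hx₁) _ _ htouch d₀
    rw [hAin, hAtr, real_inner_self_eq_norm_sq, ← hr] at h8
    have h9 : S * (k * ((α - 2) / r ^ 2 * (r ^ 2) ^ 2 + r ^ 2) + δ * r ^ 2)
        + c * (S * (k * ((α - 2) + n) + δ * n)) * r ^ 2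
        = S * r ^ 2 * (k * (α * (1 + c) - (1 - c * (n - 2))) + δ * (1 + c * n)) := by
      field_simp
      ring
    rw [h9, hαeq, hδeq] at h8
    have h10 : k * (κ - (1 - c * (n - 2))) + k * κ / 2 = - (k * κ / 2) := by
      rw [hκ]; ring
    rw [h10] at h8
    have : 0 < S * r ^ 2 * (k * κ / 2) := by positivity
    linarith
  have hlim : Tendsto (fun e : ℝ => v y + ((m - v y) / ρ ^ α + e) * ‖x - y‖ ^ α) (𝓝[>] 0)
      (𝓝 (v y + ((m - v y) / ρ ^ α + 0) * ‖x - y‖ ^ α)) := by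
    apply Tendsto.mono_left _ nhdsWithin_le_nhds
    exact Continuous.tendsto (by fun_prop) 0
  have hfin := ge_of_tendsto hlim (by
    filter_upwards [self_mem_nhdsWithin] with e he using key e he)
  refine hfin.trans (le_of_eq ?_)
  rw [Real.div_rpow (norm_nonneg _) hρ.le]
  simp only [hv]
  ring

end HolderComparison

/-! ### From an expansion along a set of density one to a full expansion. -/

section Upgrade

open scoped RealInnerProductSpace

variable {E : Type*} [NormedAddCommGroup E] [InnerProductSpace ℝ E] [FiniteDimensional ℝ E]

open scoped ENNReal in
/-- Near a density point of `H`, every point of the ball of radius `r` is within `η r` of `H`. -/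
theorem exists_mem_near_of_density [MeasurableSpace E] [BorelSpace E] {H : Set E} {x₀ : E}
    (hd : Tendsto (fun r => volume (H ∩ Metric.closedBall x₀ r) / volume (Metric.closedBall x₀ r))
      (𝓝[>] 0) (𝓝 1)) {η : ℝ} (hη : 0 < η) (hη1 : η ≤ 1) :
    ∃ r₀ > 0, ∀ r, 0 < r → r ≤ r₀ → ∀ x ∈ Metric.closedBall x₀ r, ∃ z ∈ H, ‖x - z‖ ≤ η * r := by
  set n := Module.finrank ℝ E with hn
  have hq : 0 < (η / 2) ^ n := by positivity
  have h1 : ∀ᶠ r in 𝓝[>] (0 : ℝ), ENNReal.ofReal (1 - (η / 2) ^ n) <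
      volume (H ∩ Metric.closedBall x₀ r) / volume (Metric.closedBall x₀ r) := by
    apply hd.eventually (lt_mem_nhds _)
    rw [ENNReal.ofReal_lt_one]; linarith
  obtain ⟨R, hR, hball⟩ := mem_nhdsGT_iff_exists_Ioc_subset.1 h1
  have hR : 0 < R := hR
  refine ⟨R / 2, by positivity, fun r hr hrR x hx => ?_⟩
  -- Otherwise a ball of radius `η r` inside the ball of radius `2r` misses `H`, which removes the
  -- fraction `(η / 2) ^ n` of its volume.
  by_contra! hcon
  have h2 := hball (show 2 * r ∈ Ioc 0 R from ⟨by positivity, by linarith⟩)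
  simp only [mem_ofPred_eq] at h2
  set V := volume (Metric.closedBall (0 : E) 1) with hV
  have hV0 : V ≠ 0 := (Metric.measure_closedBall_pos volume _ one_pos).ne'
  have hVt : V ≠ ∞ := measure_closedBall_lt_top.ne
  have hvol : ∀ (y : E) (t : ℝ), 0 ≤ t →
      volume (Metric.closedBall y t) = ENNReal.ofReal (t ^ n) * V := fun y t ht => by
    rw [Measure.addHaar_closedBall' volume y ht]
  have hdisj : Disjoint (H ∩ Metric.closedBall x₀ (2 * r)) (Metric.closedBall x (η * r)) := by
    rw [Set.disjoint_left]
    intro z hz hzx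
    have := hcon z hz.1
    rw [mem_closedBall_iff_norm, norm_sub_rev] at hzx
    linarith
  have hsub : (H ∩ Metric.closedBall x₀ (2 * r)) ∪ Metric.closedBall x (η * r) ⊆
      Metric.closedBall x₀ (2 * r) := by
    refine union_subset inter_subset_right ?_
    apply Metric.closedBall_subset_closedBall'
    rw [mem_closedBall_iff_norm, ← dist_eq_norm] at hx
    nlinarith
  have h3 := measure_mono (μ := volume) hsub
  rw [measure_union hdisj measurableSet_closedBall, hvol _ _ (by positivity),
    hvol _ _ (by positivity)] at h3
  have hpos : 0 < (2 * r) ^ n := by positivity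
  rw [hvol _ _ (by positivity), ENNReal.lt_div_iff_mul_lt
    (Or.inl (mul_ne_zero (by simpa using hpos) hV0))
    (Or.inl (ENNReal.mul_ne_top ENNReal.ofReal_ne_top hVt))] at h2
  have h4 : (2 * r) ^ n = (1 - (η / 2) ^ n) * (2 * r) ^ n + (η * r) ^ n := by
    have : (η * r) ^ n = (η / 2) ^ n * (2 * r) ^ n := by rw [← mul_pow]; congr 1; ring
    rw [this]; ring
  have hle1 : 0 ≤ 1 - (η / 2) ^ n := by
    have : (η / 2) ^ n ≤ 1 := pow_le_one₀ (by positivity) (by linarith)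
    linarith
  have h5 : ENNReal.ofReal ((2 * r) ^ n) * V =
      ENNReal.ofReal (1 - (η / 2) ^ n) * (ENNReal.ofReal ((2 * r) ^ n) * V)
        + ENNReal.ofReal ((η * r) ^ n) * V := by
    conv_lhs => rw [h4, ENNReal.ofReal_add (by positivity) (by positivity),
      ENNReal.ofReal_mul hle1, add_mul, mul_assoc]
  have h6 : ENNReal.ofReal ((η * r) ^ n) * V ≠ ∞ := ENNReal.mul_ne_top ENNReal.ofReal_ne_top hVt
  have h7 := (ENNReal.add_lt_add_iff_right h6).2 h2
  rw [← h5] at h7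
  exact absurd h3 (not_le.2 h7)

omit [InnerProductSpace ℝ E] [FiniteDimensional ℝ E] in
/-- A bound at a definite scale that improves under dilation is a quadratic bound. -/
theorem quadratic_bound_of_iteration {v : E → ℝ} {x₀ : E} {r₀ B C₀ : ℝ} (hr₀ : 0 < r₀)
    (hB : 0 ≤ B) (hC₀ : 0 ≤ C₀) (hv : ∀ x, v x ≤ B * ‖x - x₀‖)
    (hit : ∀ r, 0 < r → r ≤ r₀ → ∀ M, 0 ≤ M → (∀ x ∈ Metric.closedBall x₀ (4 * r), v x ≤ M) →
      ∀ x ∈ Metric.closedBall x₀ r, v x ≤ C₀ * r ^ 2 + M / 32) :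
    ∃ C, 0 ≤ C ∧ ∀ r, 0 < r → r ≤ r₀ → ∀ x ∈ Metric.closedBall x₀ r, v x ≤ C * r ^ 2 := by
  -- The first entry covers radii at least `r₀ / 4`. The second closes the induction: the bound `16
  -- C r²` at scale `4r` is divided by `32`, leaving `C r² / 2` for the `C₀` term.
  set C := max (4 * B / r₀) (2 * C₀) with hC
  have hC1 : 4 * B / r₀ ≤ C := le_max_left _ _
  have hC2 : 2 * C₀ ≤ C := le_max_right _ _
  have hC0 : 0 ≤ C := le_trans (by positivity) hC2
  have hbase : ∀ r, 0 < r → r₀ ≤ 4 * r → ∀ x ∈ Metric.closedBall x₀ r, v x ≤ C * r ^ 2 := by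
    intro r hr hr4 x hx
    rw [mem_closedBall_iff_norm] at hx
    rw [div_le_iff₀ hr₀] at hC1
    have h1 : B * ‖x - x₀‖ ≤ B * r := by gcongr
    have h2 : C * r₀ * r ≤ C * (4 * r) * r := by gcongr
    nlinarith [hv x]
  have hind : ∀ j : ℕ, ∀ r, 0 < r → r ≤ r₀ → r₀ ≤ 4 ^ j * (4 * r) →
      ∀ x ∈ Metric.closedBall x₀ r, v x ≤ C * r ^ 2 := by
    intro j
    induction j with
    | zero => intro r hr _ h4; exact hbase r hr (by simpa using h4)
    | succ j ih =>
      intro r hr hr1 h4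
      by_cases h : r₀ ≤ 4 * r
      · exact hbase r hr h
      · intro x hx
        have h5 := hit r hr hr1 (C * (4 * r) ^ 2) (by positivity)
          (ih (4 * r) (by positivity) (by linarith) (by rw [pow_succ] at h4; linarith)) x hx
        nlinarith [mul_nonneg (sub_nonneg.2 hC2) (sq_nonneg r)]
  refine ⟨C, hC0, fun r hr hr1 => ?_⟩
  obtain ⟨j, hj⟩ := pow_unbounded_of_one_lt (r₀ / (4 * r)) (by norm_num : (1 : ℝ) < 4)
  refine hind j r hr hr1 ?_
  rw [div_lt_iff₀ (by positivity)] at hj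
  exact hj.le

omit [FiniteDimensional ℝ E] in
theorem abs_quadratic_sub_le (A : E →L[ℝ] E) (d e : E) :
    |⟪A d, d⟫ - ⟪A e, e⟫| ≤ ‖A‖ * (‖d‖ + ‖e‖) * ‖d - e‖ := by
  have h1 : ⟪A d, d⟫ - ⟪A e, e⟫ = ⟪A d, d - e⟫ + ⟪A (d - e), e⟫ := by
    rw [map_sub, inner_sub_right, inner_sub_left]; ring
  rw [h1]
  refine (abs_add_le _ _).trans ?_
  have h2 := (abs_real_inner_le_norm (A d) (d - e)).trans
    (mul_le_mul_of_nonneg_right (A.le_opNorm d) (norm_nonneg _))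
  have h3 := (abs_real_inner_le_norm (A (d - e)) e).trans
    (mul_le_mul_of_nonneg_right (A.le_opNorm _) (norm_nonneg _))
  linarith

/-- A second order expansion along a set of density one extends to a full neighbourhood. -/
theorem IsTraceConvexOn.expansion_of_density [MeasurableSpace E] [BorelSpace E] {u : E → ℝ}
    {K : ℝ≥0} {c : ℝ} {s : Set E} (hc : 0 ≤ c) (hcn : c * (Module.finrank ℝ E - 2) < 1)
    (htc : IsTraceConvexOn c u s) (hu : LipschitzWith K u) {H : Set E} {x₀ p : E} {A : E →L[ℝ] E}
    (hs : s ∈ 𝓝 x₀)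
    (hd : Tendsto (fun r => volume (H ∩ Metric.closedBall x₀ r) / volume (Metric.closedBall x₀ r))
      (𝓝[>] 0) (𝓝 1))
    (hexp : (fun z => u z - u x₀ - ⟪p, z - x₀⟫ - ⟪A (z - x₀), z - x₀⟫ / 2) =o[𝓝[H] x₀]
        fun z => ‖z - x₀‖ ^ 2) :
    (fun z => u z - u x₀ - ⟪p, z - x₀⟫ - ⟪A (z - x₀), z - x₀⟫ / 2) =o[𝓝 x₀]
        fun z => ‖z - x₀‖ ^ 2 := by
  set α := coneExponent c (Module.finrank ℝ E) with hα
  have hα0 : 0 < α := coneExponent_pos hc hcn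
  set v : E → ℝ := fun z => u z - u x₀ - ⟪p, z - x₀⟫ with hv
  set Q : E → ℝ := fun z => ⟪A (z - x₀), z - x₀⟫ / 2 with hQ
  set a := ‖A‖ with ha
  have ha0 : 0 ≤ a := norm_nonneg _
  have hQabs : ∀ z, |Q z| ≤ a * ‖z - x₀‖ ^ 2 := by
    intro z
    have h1 := (abs_real_inner_le_norm (A (z - x₀)) (z - x₀)).trans
      (mul_le_mul_of_nonneg_right (A.le_opNorm _) (norm_nonneg _))
    simp only [hQ]
    rw [abs_div, abs_two]
    have : 0 ≤ ‖A‖ * ‖z - x₀‖ * ‖z - x₀‖ := by positivity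
    rw [← ha] at *
    nlinarith
  have hQsub : ∀ z x, |Q z - Q x| ≤ a * (‖z - x₀‖ + ‖x - x₀‖) * ‖x - z‖ := by
    intro z x
    have h1 := abs_quadratic_sub_le A (z - x₀) (x - x₀)
    rw [sub_sub_sub_cancel_right, norm_sub_rev z x] at h1
    simp only [hQ]
    rw [← sub_div, abs_div, abs_two]
    refine le_trans ?_ h1
    have := abs_nonneg (⟪A (z - x₀), z - x₀⟫ - ⟪A (x - x₀), x - x₀⟫)
    linarith
  -- comparison for `v`
  obtain ⟨ρ₀, hρ₀, hball⟩ := Metric.nhds_basis_closedBall.mem_iff.1 hs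
  have hcomp : ∀ (y : E) (r θ M : ℝ), 0 < r → 4 * r ≤ ρ₀ → y ∈ Metric.closedBall x₀ (2 * r) →
      (∀ x ∈ Metric.closedBall x₀ (4 * r), v x ≤ M) →
      ∀ (η : ℝ) (x : E), 0 ≤ η → η ≤ 1 → ‖x - y‖ ≤ η * r → (η / 2) ^ α ≤ θ →
        v x ≤ v y + θ * (M - v y) := by
    intro y r θ M hr hr4 hy hM η x hη hη1 hxy hθ
    have hsub : Metric.closedBall y (2 * r) ⊆ Metric.closedBall x₀ (4 * r) := by
      apply Metric.closedBall_subset_closedBall'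
      rw [mem_closedBall_iff_norm, ← dist_eq_norm] at hy
      linarith
    have hyM : v y ≤ M := hM y (hsub (Metric.mem_closedBall_self (by positivity)))
    have h1 := htc.holder_comparison hc hcn hu.continuous (y := y) (p := p) (ρ := 2 * r)
      (m := M + u x₀ - ⟪p, x₀⟫) (by positivity)
      (hsub.trans ((Metric.closedBall_subset_closedBall hr4).trans hball))
      (fun x' hx' => by
        have := hM x' (hsub hx')
        simp only [hv, inner_sub_right] at this
        linarith)
      (x := x) (by rw [mem_closedBall_iff_norm]; nlinarith)
    rw [← hα] at h1
    have h2 : (‖x - y‖ / (2 * r)) ^ α ≤ θ := by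
      refine le_trans (Real.rpow_le_rpow (by positivity) ?_ hα0.le) hθ
      rw [div_le_div_iff₀ (by positivity) (by positivity)]
      nlinarith
    have h3 := mul_le_mul_of_nonneg_right h2 (sub_nonneg.2 hyM)
    simp only [hv, inner_sub_right] at h3 ⊢
    have h4 : M + u x₀ - ⟪p, x₀⟫ - (u y - ⟪p, y⟫) = M - (u y - u x₀ - (⟪p, y⟫ - ⟪p, x₀⟫)) := by
      ring
    rw [h4] at h1
    linarith
  have hηex : ∀ θ : ℝ, 0 < θ → ∃ η, 0 < η ∧ η ≤ 1 ∧ η ≤ θ ∧ (η / 2) ^ α ≤ θ := by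
    intro θ hθ
    have h1 : Tendsto (fun η : ℝ => (η / 2) ^ α) (𝓝[>] 0) (𝓝 0) := by
      have : Continuous fun η : ℝ => (η / 2) ^ α :=
        (continuous_id.div_const 2).rpow_const fun _ => Or.inr hα0.le
      simpa [Real.zero_rpow hα0.ne'] using (this.tendsto 0).mono_left nhdsWithin_le_nhds
    obtain ⟨η, h2, h3⟩ := ((h1.eventually (gt_mem_nhds hθ)).and
      (Ioo_mem_nhdsGT (lt_min hθ one_pos))).exists
    exact ⟨η, h3.1, (h3.2.trans_le (min_le_right _ _)).le, (h3.2.trans_le (min_le_left _ _)).le,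
      h2.le⟩
  have hexp' : ∀ κ > 0, ∃ R > 0, ∀ z ∈ H, ‖z - x₀‖ ≤ R → |v z - Q z| ≤ κ * ‖z - x₀‖ ^ 2 := by
    intro κ hκ
    have h1 := hexp.def hκ
    obtain ⟨R, hR, h2⟩ := Metric.mem_nhdsWithin_iff.1 h1
    refine ⟨R / 2, by positivity, fun z hz hzR => ?_⟩
    have h3 := h2 ⟨mem_ball_iff_norm.2 (by linarith), hz⟩
    simp only [mem_ofPred_eq, Real.norm_eq_abs, abs_pow, abs_norm] at h3
    exact h3
  -- near points of `H`
  have hnear : ∀ η κ : ℝ, 0 < η → η ≤ 1 → 0 < κ → ∃ r₀ > 0, ∀ r, 0 < r → r ≤ r₀ →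
      ∀ x ∈ Metric.closedBall x₀ r, ∃ z ∈ Metric.closedBall x₀ (2 * r),
        ‖x - z‖ ≤ η * r ∧ |v z - Q z| ≤ κ * r ^ 2 := by
    intro η κ hη hη1 hκ
    obtain ⟨r₁, hr₁, h1⟩ := exists_mem_near_of_density hd hη hη1
    obtain ⟨R, hR, h2⟩ := hexp' (κ / 4) (by positivity)
    refine ⟨min r₁ (R / 2), by positivity, fun r hr hrr x hx => ?_⟩
    obtain ⟨z, hz, hxz⟩ := h1 r hr (hrr.trans (min_le_left _ _)) x hx
    have hrR : r ≤ R / 2 := hrr.trans (min_le_right _ _)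
    rw [mem_closedBall_iff_norm] at hx
    have hz2 : ‖z - x₀‖ ≤ 2 * r := by
      have := norm_sub_le (x - x₀) (x - z)
      rw [sub_sub_sub_cancel_left] at this
      nlinarith
    refine ⟨z, by rwa [mem_closedBall_iff_norm], hxz, (h2 z hz (by linarith)).trans ?_⟩
    have : ‖z - x₀‖ ^ 2 ≤ (2 * r) ^ 2 := by gcongr
    nlinarith
  have hC₀ : ∀ (r κ : ℝ), 0 < r → κ ≤ 1 → ∀ z ∈ Metric.closedBall x₀ (2 * r),
      |v z - Q z| ≤ κ * r ^ 2 → |v z| ≤ (4 * a + 1) * r ^ 2 := by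
    intro r κ hr hκ z hz hzQ
    rw [mem_closedBall_iff_norm] at hz
    have h1 := hQabs z
    have h2 : a * ‖z - x₀‖ ^ 2 ≤ a * (2 * r) ^ 2 := by gcongr
    have h3 := abs_add_le (v z - Q z) (Q z)
    rw [sub_add_cancel] at h3
    nlinarith [sq_nonneg r]
  -- quadratic upper bound
  have hupper : ∃ C r₀ : ℝ, 0 ≤ C ∧ 0 < r₀ ∧ ∀ r, 0 < r → r ≤ r₀ →
      ∀ x ∈ Metric.closedBall x₀ r, v x ≤ C * r ^ 2 := by
    obtain ⟨η, hη, hη1, -, hηθ⟩ := hηex (1 / 32) (by norm_num)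
    obtain ⟨r₁, hr₁, h1⟩ := hnear η 1 hη hη1 one_pos
    set r₀ := min r₁ (ρ₀ / 4) with hr₀
    have hr₀0 : 0 < r₀ := by positivity
    obtain ⟨C, hC, h2⟩ := quadratic_bound_of_iteration (v := v) (x₀ := x₀) (r₀ := r₀)
      (B := K + ‖p‖) (C₀ := 2 * (4 * a + 1)) hr₀0 (by positivity) (by positivity)
      (fun x => by
        have h3 := hu.dist_le_mul x x₀
        rw [Real.dist_eq, dist_eq_norm] at h3
        have h4 := (abs_le.1 (abs_real_inner_le_norm p (x - x₀))).1
        have h5 := (abs_le.1 h3).2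
        simp only [hv]
        linarith)
      (fun r hr hrr M hM hMb x hx => by
        obtain ⟨z, hz, hxz, hzQ⟩ := h1 r hr (hrr.trans (min_le_left _ _)) x hx
        have h3 := hcomp z r (1 / 32) M hr (by linarith [hrr.trans (min_le_right _ _)]) hz hMb η x
          hη.le hη1 hxz hηθ
        have h4 := abs_le.1 (hC₀ r 1 hr le_rfl z hz hzQ)
        have : 0 ≤ (4 * a + 1) * r ^ 2 := by positivity
        linarith)
    exact ⟨C, r₀, hC, hr₀0, h2⟩
  obtain ⟨C, r₂, hC, hr₂, hup⟩ := hupper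
  rw [Asymptotics.isLittleO_iff]
  intro ε hε
  set C₀ := 4 * a + 1 with hC₀def
  have hC₀0 : 0 < C₀ := by positivity
  -- `D` collects the coefficients of `θ r²` in the upper and lower estimates for `v x - v z` and in
  -- the change of `Q`; the other half of `ε` pays for the expansion at `z`.
  set D := 48 * C + 4 * C₀ + 3 * a + 1 with hD
  have hD0 : 0 < D := by positivity
  obtain ⟨η, hη, hη1, hηε, hηθ⟩ := hηex (min (ε / (2 * D)) (1 / 2)) (by positivity)
  set θ := min (ε / (2 * D)) (1 / 2) with hθ
  have hθ0 : 0 < θ := by positivity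
  have hθ1 : θ ≤ 1 / 2 := min_le_right _ _
  have hθD : θ * D ≤ ε / 2 := by
    have : θ ≤ ε / (2 * D) := min_le_left _ _
    rw [le_div_iff₀ (by positivity)] at this
    linarith
  obtain ⟨r₁, hr₁, h1⟩ := hnear η (min (ε / 2) 1) hη hη1 (by positivity)
  have hmem : Metric.ball x₀ (min (min r₁ (ρ₀ / 4)) (r₂ / 4)) ∈ 𝓝 x₀ :=
    Metric.ball_mem_nhds _ (by positivity)
  filter_upwards [hmem] with x hx
  rw [Real.norm_eq_abs, Real.norm_of_nonneg (by positivity)]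
  change |v x - Q x| ≤ ε * ‖x - x₀‖ ^ 2
  by_cases hxx : x = x₀
  · subst hxx; simp [hv, hQ]
  set r := ‖x - x₀‖ with hr
  have hr0 : 0 < r := norm_pos_iff.2 (sub_ne_zero.2 hxx)
  rw [mem_ball_iff_norm, ← hr] at hx
  have hrr1 : r ≤ r₁ := (hx.trans_le ((min_le_left _ _).trans (min_le_left _ _))).le
  have hrr2 : r ≤ ρ₀ / 4 := (hx.trans_le ((min_le_left _ _).trans (min_le_right _ _))).le
  have hrr3 : r ≤ r₂ / 4 := (hx.trans_le (min_le_right _ _)).le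
  have hxr : x ∈ Metric.closedBall x₀ r := by rw [mem_closedBall_iff_norm]
  obtain ⟨z, hz, hxz, hzQ⟩ := h1 r hr0 hrr1 x hxr
  have hM := hup (4 * r) (by positivity) (by linarith)
  have hz0 := abs_le.1 (hC₀ r _ hr0 (min_le_right _ _) z hz hzQ)
  have hzQ' := abs_le.1 (hzQ.trans (mul_le_mul_of_nonneg_right (min_le_left _ _) (sq_nonneg r)))
  have hxM := hup r hr0 (by linarith) x hxr
  have c1 := hcomp z r θ _ hr0 (by linarith) hz hM η x hη.le hη1 hxz hηθ
  -- The comparison is one-sided, but exchanging the roles of `x` and `z` turns it into a lower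
  -- bound for `v x`.
  have c2 := hcomp x r θ _ hr0 (by linarith)
    (Metric.closedBall_subset_closedBall (by linarith) hxr) hM η z hη.le hη1
    (by rwa [norm_sub_rev]) hηθ
  have hzn : ‖z - x₀‖ ≤ 2 * r := by rwa [mem_closedBall_iff_norm] at hz
  have hQd : |Q z - Q x| ≤ 3 * a * θ * r ^ 2 := by
    refine (hQsub z x).trans ?_
    have h5 : a * (‖z - x₀‖ + ‖x - x₀‖) ≤ a * (3 * r) := by
      apply mul_le_mul_of_nonneg_left _ ha0
      rw [← hr]; linarith
    have h6 : ‖x - z‖ ≤ θ * r := hxz.trans (mul_le_mul_of_nonneg_right hηε hr0.le)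
    calc a * (‖z - x₀‖ + ‖x - x₀‖) * ‖x - z‖ ≤ a * (3 * r) * (θ * r) := by gcongr
      _ = _ := by ring
  have hQd' := abs_le.1 hQd
  have hr2 : 0 < r ^ 2 := by positivity
  have hθDr : θ * D * r ^ 2 ≤ ε / 2 * r ^ 2 := by gcongr
  have hDexp : θ * D * r ^ 2 = 48 * (θ * (C * r ^ 2)) + 4 * (θ * (C₀ * r ^ 2))
    + 3 * a * θ * r ^ 2 + θ * r ^ 2 := by rw [hD]; ring
  have p1 : 0 ≤ θ * (C * r ^ 2) := by positivity
  have p2 : 0 ≤ θ * (C₀ * r ^ 2) := by positivity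
  have p3 : 0 ≤ θ * r ^ 2 := by positivity
  have p4 : 0 ≤ C * r ^ 2 := by positivity
  have p5 : 0 ≤ C₀ * r ^ 2 := by positivity
  have hM16 : C * (4 * r) ^ 2 = 16 * (C * r ^ 2) := by ring
  rw [hM16] at c1 c2
  have up : v x - v z ≤ 16 * (θ * (C * r ^ 2)) + θ * (C₀ * r ^ 2) := by
    have := mul_le_mul_of_nonneg_left hz0.1 hθ0.le
    linarith
  -- A crude lower bound for `v x`: as `θ ≤ 1 / 2`, the term `θ v x` on the right of `c2` can be
  -- absorbed. It is then fed back to gain a factor `θ`.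
  have low0 : -(2 * (C₀ * r ^ 2) + 16 * (C * r ^ 2)) ≤ v x := by
    by_contra! hcon
    have h8 : θ * (16 * (C * r ^ 2) - v x) ≤ 1 / 2 * (16 * (C * r ^ 2) - v x) := by
      apply mul_le_mul_of_nonneg_right hθ1
      linarith
    linarith
  have low : v z - v x ≤ 32 * (θ * (C * r ^ 2)) + 2 * (θ * (C₀ * r ^ 2)) := by
    have := mul_le_mul_of_nonneg_left low0 hθ0.le
    linarith
  rw [abs_le]
  constructor <;> linarith

end Upgrade

/-! ### Alexandrov's theorem for the trace cone. -/

section AlmostEverywhere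

open scoped RealInnerProductSpace

variable {E : Type*} [NormedAddCommGroup E] [InnerProductSpace ℝ E] [FiniteDimensional ℝ E]
  [MeasurableSpace E] [BorelSpace E]

/-- An Alexandrov type theorem for Lipschitz functions with `D²u + c tr(D²u) I ≥ 0`. -/
theorem IsTraceConvexOn.ae_expansion {u : E → ℝ} {K : ℝ≥0} {c : ℝ} (hc : 0 ≤ c)
    (hcn : c * (Module.finrank ℝ E - 2) < 1) (htc : IsTraceConvexOn c u (Metric.ball 0 1))
    (hu : LipschitzWith K u) :
    ∀ᵐ x : E, x ∈ Metric.ball (0 : E) 1 → ∃ (p : E) (A : E →L[ℝ] E),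
      (fun z => u z - u x - ⟪p, z - x⟫ - ⟪A (z - x), z - x⟫ / 2) =o[𝓝 x]
        fun z => ‖z - x‖ ^ 2 := by
  have h1 : ∀ᵐ x : E, ∀ j : ℕ, x ∈ upperContactSet u (1 / ((j : ℝ) + 1)) →
      ∃ (p : E) (A : E →L[ℝ] E),
      (fun z => u z - u x - ⟪p, z - x⟫ - ⟪A (z - x), z - x⟫ / 2)
        =o[𝓝[upperContactSet u (1 / ((j : ℝ) + 1))] x] fun z => ‖z - x‖ ^ 2 :=
    ae_all_iff.2 fun j => ae_expansion_upperContactSet hu (by positivity)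
  have h2 : ∀ᵐ x : E, ∀ j : ℕ, x ∈ upperContactSet u (1 / ((j : ℝ) + 1)) →
      Tendsto (fun r => volume (upperContactSet u (1 / ((j : ℝ) + 1)) ∩ Metric.closedBall x r) /
        volume (Metric.closedBall x r)) (𝓝[>] 0) (𝓝 1) :=
    ae_all_iff.2 fun j => (ae_restrict_iff' (isClosed_upperContactSet hu
      (by positivity)).measurableSet).1 (Besicovitch.ae_tendsto_measure_inter_div volume _)
  filter_upwards [h1, h2, ae_mem_iUnion_upperContactSet hu hc htc] with x h1 h2 h3 hx
  obtain ⟨j, hj⟩ := mem_iUnion.1 (h3 hx)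
  obtain ⟨p, A, hA⟩ := h1 j hj
  exact ⟨p, A, htc.expansion_of_density hc hcn hu (Metric.isOpen_ball.mem_nhds hx) (h2 j hj) hA⟩

end AlmostEverywhere

/-! ### Real-rooted polynomials and the eigenvalue bound on `Γ_k⁺`. -/

section RealRooted

open Polynomial

/-- By Rolle, counted with multiplicity, at most one root is lost. -/
theorem splits_derivative_of_splits {p : ℝ[X]} (hp : p.Splits) : p.derivative.Splits := by
  rw [splits_iff_card_roots] at hp ⊢
  have h1 := card_roots_le_derivative p
  have h2 := p.derivative.card_roots'
  have h3 := natDegree_derivative_le p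
  by_cases h0 : p.natDegree = 0
  · omega
  · omega

theorem eval_pos_of_splits {p : ℝ[X]} (hp : p.Splits) (hlc : 0 < p.leadingCoeff) {t : ℝ}
    (ht : ∀ r ∈ p.roots, r < t) : 0 < p.eval t := by
  rw [hp.eval_eq_prod_roots]
  refine mul_pos hlc (Multiset.prod_pos fun x hx => ?_)
  obtain ⟨r, hr, rfl⟩ := Multiset.mem_map.1 hx
  exact sub_pos.2 (ht r hr)

/-- A lower bound for a sum of reciprocals. -/
theorem sum_inv_ge (s : Multiset ℝ) {ρ : ℝ} (hs : ∀ r ∈ s, r < ρ) (l : ℝ) :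
    2 * l * Multiset.card s - l ^ 2 * (Multiset.card s * ρ - s.sum) ≤
      (s.map fun r => 1 / (ρ - r)).sum := by
  induction s using Multiset.induction_on with
  | empty => simp
  | cons a s ih =>
    have h1 := ih fun r hr => hs r (Multiset.mem_cons_of_mem hr)
    have ha : 0 < ρ - a := sub_pos.2 (hs a (Multiset.mem_cons_self a s))
    -- The tangent line of `s ↦ 1 / s` at `s = 1 / l`.
    have h2 : 2 * l - l ^ 2 * (ρ - a) ≤ 1 / (ρ - a) := by
      rw [le_div_iff₀ ha]
      nlinarith [sq_nonneg (1 - l * (ρ - a))]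
    simp only [Multiset.map_cons, Multiset.sum_cons, Multiset.card_cons, Nat.cast_add,
      Nat.cast_one]
    linarith

/-- Comparison between the largest root of a real-rooted polynomial and the largest root of its
derivative; `-a` is the mean of the roots. -/
theorem root_le_of_derivative_pos {p : ℝ[X]} (hp : p.Splits) (hlc : 0 < p.leadingCoeff) {m : ℕ}
    (hm : p.natDegree = m) (hm3 : 3 ≤ m) {a ρ : ℝ} (ha : p.roots.sum = - (m * a))
    (hρ : ∀ t, ρ < t → 0 < p.derivative.eval t) {R : ℝ} (hR : R ∈ p.roots) :
    (R + a) * (m - 2) ≤ (ρ + a) * (m - 1) := by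
  have hm3' : (3 : ℝ) ≤ m := by exact_mod_cast hm3
  have hcard : Multiset.card p.roots = m := by rw [← hm]; exact (splits_iff_card_roots.1 hp)
  obtain ⟨M, hM, hmax⟩ : ∃ M ∈ p.roots, ∀ r ∈ p.roots, r ≤ M := by
    have hne : p.roots.toFinset.Nonempty := ⟨R, Multiset.mem_toFinset.2 hR⟩
    obtain ⟨M, hM, hmax⟩ := p.roots.toFinset.exists_max_image id hne
    exact ⟨M, Multiset.mem_toFinset.1 hM, fun r hr => hmax r (Multiset.mem_toFinset.2 hr)⟩
  suffices h : (M + a) * (m - 2) ≤ (ρ + a) * (m - 1) by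
    have := hmax R hR
    nlinarith
  have hmean : 0 ≤ M + a := by
    have h1 : p.roots.sum ≤ Multiset.card p.roots • M := Multiset.sum_le_card_nsmul _ _ hmax
    rw [ha, hcard, nsmul_eq_mul] at h1
    have : 0 ≤ (m : ℝ) * (M + a) := by linarith
    exact nonneg_of_mul_nonneg_right this (by linarith)
  by_cases hMρ : M ≤ ρ
  · nlinarith
  rw [not_le] at hMρ
  have hp0 : p ≠ 0 := fun h => by simp [h] at hlc
  have hmono : StrictMonoOn (fun t => p.eval t) (Ici ρ) := by
    apply strictMonoOn_of_deriv_pos (convex_Ici ρ) p.continuous.continuousOn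
    intro t ht
    rw [interior_Ici] at ht
    rw [Polynomial.deriv]
    exact hρ t ht
  have hMroot : p.eval M = 0 := (mem_roots hp0).1 hM
  have hρneg : p.eval ρ < 0 := by
    rw [← hMroot]
    exact hmono self_mem_Ici hMρ.le hMρ
  have hρder : 0 ≤ p.derivative.eval ρ := by
    have : Tendsto (fun t => p.derivative.eval t) (𝓝[>] ρ) (𝓝 (p.derivative.eval ρ)) :=
      (p.derivative.continuous.tendsto ρ).mono_left nhdsWithin_le_nhds
    refine ge_of_tendsto this ?_
    filter_upwards [self_mem_nhdsWithin] with t ht using (hρ t ht).le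
  obtain ⟨s, hs⟩ := Multiset.exists_cons_of_mem hM
  -- Since `p` is strictly increasing on `[ρ, ∞)`, `M` is its only root there; a repeated `M` would
  -- make the derivative vanish beyond `ρ`.
  have hslt : ∀ r ∈ s, r < ρ := by
    intro r hr
    by_contra! hge
    have hrp : r ∈ p.roots := by rw [hs]; exact Multiset.mem_cons_of_mem hr
    have hreq : r = M := by
      apply hmono.injOn hge hMρ.le
      simp only [hMroot]
      exact (mem_roots hp0).1 hrp
    subst hreq
    have hcount : 1 < p.rootMultiplicity r := by
      classical
      rw [← count_roots, hs, Multiset.count_cons_self]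
      have := Multiset.one_le_count_iff_mem.2 hr
      omega
    have := (one_lt_rootMultiplicity_iff_isRoot hp0).1 hcount
    have h2 := hρ r hMρ
    rw [IsRoot.def.1 this.2] at h2
    exact lt_irrefl _ h2
  have hlog := hp.eval_derivative_div_eval_of_ne_zero hρneg.ne
  have hle : p.derivative.eval ρ / p.eval ρ ≤ 0 := div_nonpos_of_nonneg_of_nonpos hρder hρneg.le
  rw [hlog, hs, Multiset.map_cons, Multiset.sum_cons] at hle
  have hscard : (Multiset.card s : ℝ) = m - 1 := by
    rw [hs, Multiset.card_cons] at hcard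
    rw [← hcard]; push_cast; ring
  have hssum : s.sum = -(m * a) - M := by
    rw [hs, Multiset.sum_cons] at ha; linarith
  have hD : 0 < M - ρ := sub_pos.2 hMρ
  -- From `p ρ < 0 ≤ p' ρ` the reciprocals over the other roots sum to at most `1 / (M - ρ)`. This
  -- `l` is the value of each term when they are equal and attain that bound; it yields `(m - 1)² (M
  -- - ρ) ≤ ∑ (ρ - r)`.
  have h1 := sum_inv_ge s hslt (1 / ((m - 1) * (M - ρ)))
  rw [hscard, hssum] at h1
  have hm1 : (0 : ℝ) < m - 1 := by linarith
  have h2 : 1 / (ρ - M) = - (1 / (M - ρ)) := by rw [← neg_sub M ρ, one_div_neg_eq_neg_one_div]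
  rw [h2] at hle
  have h3 : 2 * (1 / ((m - 1) * (M - ρ))) * (m - 1)
      - (1 / ((m - 1) * (M - ρ))) ^ 2 * ((m - 1) * ρ - (-(m * a) - M)) ≤ 1 / (M - ρ) := by
    linarith
  have h4 : (m - 1) ^ 2 * (M - ρ) ≤ (m - 1) * ρ + m * a + M := by
    have h5 := mul_le_mul_of_nonneg_right h3
      (show 0 ≤ (m - 1) ^ 2 * (M - ρ) ^ 2 by positivity)
    have h6 : (2 * (1 / ((m - 1) * (M - ρ))) * (m - 1)
      - (1 / ((m - 1) * (M - ρ))) ^ 2 * ((m - 1) * ρ - (-(m * a) - M))) *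
        ((m - 1) ^ 2 * (M - ρ) ^ 2) = 2 * ((m - 1) ^ 2 * (M - ρ)) -
          ((m - 1) * ρ + m * a + M) := by
      field_simp
      ring
    have h7 : 1 / (M - ρ) * ((m - 1) ^ 2 * (M - ρ) ^ 2) = (m - 1) ^ 2 * (M - ρ) := by
      field_simp
    rw [h6, h7] at h5
    linarith
  have h8 : (m : ℝ) * ((M + a) * (m - 2)) ≤ m * ((ρ + a) * (m - 1)) := by nlinarith
  exact le_of_mul_le_mul_left h8 (by linarith)

theorem sum_roots_eq_of_splits {p : ℝ[X]} (hp : p.Splits) (hp0 : p ≠ 0) {m : ℕ}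
    (hm : p.natDegree = m + 1) {a : ℝ} (ha : p.coeff m = (m + 1) * a * p.coeff (m + 1)) :
    p.roots.sum = - (((m + 1 : ℕ) : ℝ) * a) := by
  have h1 := hp.nextCoeff_eq_neg_sum_roots_mul_leadingCoeff
  rw [nextCoeff_of_natDegree_pos (by omega), hm, Nat.add_sub_cancel, ha, leadingCoeff, hm] at h1
  have h2 : p.coeff (m + 1) ≠ 0 := by rw [← hm]; exact leadingCoeff_ne_zero.2 hp0
  have h3 : ((m + 1) * a + p.roots.sum) * p.coeff (m + 1) = 0 := by linarith
  have := (mul_eq_zero.1 h3).resolve_right h2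
  push_cast
  linarith

/-- If the `d`-th derivative of a real-rooted polynomial of degree `k + d` is positive on the
positive axis, its largest root is controlled by the mean of its roots. -/
theorem eval_pos_of_iterate_derivative_pos {k : ℕ} (hk : 2 ≤ k) {a : ℝ} (d : ℕ) (p : ℝ[X])
    (hp : p.Splits) (hlc : 0 < p.leadingCoeff) (hdeg : p.natDegree = k + d)
    (ha : p.coeff (k + d - 1) = (k + d : ℕ) * a * p.coeff (k + d))
    (hpos : ∀ t, 0 < t → 0 < (derivative^[d] p).eval t) {t : ℝ}
    (ht : a * (k + d - 1) / (k - 1) - a < t) : 0 < p.eval t := by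
  have hk2 : (2 : ℝ) ≤ k := by exact_mod_cast hk
  induction d generalizing p t with
  | zero =>
    apply hpos
    have : a * (k + (0 : ℕ) - 1) / (k - 1) - a = 0 := by
      have : (k : ℝ) - 1 ≠ 0 := by linarith
      push_cast
      field_simp
      ring
    linarith
  | succ d ih =>
    have hp0 : p ≠ 0 := fun h => by simp [h] at hlc
    have hcoeff : 0 < p.coeff (k + d + 1) := by
      have : p.natDegree = k + d + 1 := by omega
      rw [← this]; exact hlc
    have hdeg' : p.derivative.natDegree = k + d := by
      rw [natDegree_derivative, hdeg]; omega
    have hlc' : 0 < p.derivative.leadingCoeff := by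
      rw [leadingCoeff, hdeg', coeff_derivative]
      positivity
    have hind : ∀ t, a * (k + d - 1) / (k - 1) - a < t → 0 < p.derivative.eval t := by
      intro t ht
      refine ih p.derivative (splits_derivative_of_splits hp) hlc' hdeg' ?_ ?_ ht
      · rw [coeff_derivative, coeff_derivative, show k + d - 1 + 1 = k + d by omega]
        have h1 : p.coeff (k + d) = (k + (d + 1) : ℕ) * a * p.coeff (k + d + 1) := ha
        rw [h1]
        have h2 : ((k + d - 1 : ℕ) : ℝ) = k + d - 1 := by
          rw [Nat.cast_sub (by omega)]; push_cast; ring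
        rw [h2]
        push_cast
        ring
      · intro t ht
        have := hpos t ht
        rwa [Function.iterate_succ_apply] at this
    apply eval_pos_of_splits hp hlc
    intro R hR
    refine lt_of_le_of_lt ?_ ht
    have h3 := root_le_of_derivative_pos hp hlc (m := k + d + 1) (a := a) (by omega) (by omega)
      (sum_roots_eq_of_splits hp hp0 (by omega) (by
        have h1 : p.coeff (k + d) = (k + (d + 1) : ℕ) * a * p.coeff (k + d + 1) := ha
        rw [h1]; push_cast; ring)) hind hR
    push_cast at h3 ⊢
    have hk1 : (0 : ℝ) < k - 1 := by linarith
    have hd0 : (0 : ℝ) ≤ d := by positivity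
    -- Differentiation preserves the mean `-a` of the roots, so the factors `(m - 1) / (m - 2)`
    -- telescope to `(k + d) / (k - 1)`.
    have h4 : (a * (k + d - 1) / (k - 1) - a + a) * (k + d + 1 - 1)
        = (a * (k + (d + 1) - 1) / (k - 1)) * (k + d + 1 - 2) := by
      field_simp; ring
    rw [h4] at h3
    have := le_of_mul_le_mul_right h3 (by linarith)
    linarith

theorem coeff_prod_X_add_C_eq_sigmaFn {n : ℕ} (μ : Fin n → ℝ) {j : ℕ} (hj : j ≤ n) :
    (∏ i, (X + C (μ i))).coeff j = sigmaFn (n - j) μ := by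
  have := Finset.prod_X_add_C_coeff (Finset.univ : Finset (Fin n)) μ (k := j) (by simpa using hj)
  rw [Finset.card_univ, Fintype.card_fin] at this
  rw [this, sigmaFn]

theorem sigmaFn_zero {n : ℕ} (μ : Fin n → ℝ) : sigmaFn 0 μ = 1 := by simp [sigmaFn]

theorem sigmaFn_one {n : ℕ} (μ : Fin n → ℝ) : sigmaFn 1 μ = ∑ i, μ i := by
  simp [sigmaFn, Finset.powersetCard_one]

/-- The ratio for which `μ i + c σ₁(μ) ≥ 0` on `Γ_k⁺`. -/
noncomputable def gammaRatio (n k : ℕ) : ℝ := (n - k) / (n * (k - 1))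

theorem gammaRatio_nonneg {n k : ℕ} (hk : 1 ≤ k) (hkn : k ≤ n) : 0 ≤ gammaRatio n k := by
  have h1 : (1 : ℝ) ≤ k := by exact_mod_cast hk
  have h2 : (k : ℝ) ≤ n := by exact_mod_cast hkn
  unfold gammaRatio
  apply div_nonneg <;> [skip; apply mul_nonneg] <;> linarith

theorem gammaRatio_mul_lt {n k : ℕ} (hk : 1 ≤ k) (hkn : k ≤ n) (h : (n : ℝ) / 2 < k ∨ k = n) :
    gammaRatio n k * (n - 2) < 1 := by
  have h1 : (1 : ℝ) ≤ k := by exact_mod_cast hk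
  rcases h with h | rfl
  · rcases hk.eq_or_lt with rfl | hk2
    -- At `k = 1` the denominator is zero and the ratio is `0` by convention.
    · simp [gammaRatio]
    · have h2 : (2 : ℝ) ≤ k := by exact_mod_cast hk2
      have hn2 : (2 : ℝ) ≤ n := by exact_mod_cast (by omega : 2 ≤ n)
      unfold gammaRatio
      rw [div_mul_eq_mul_div, div_lt_one (by apply mul_pos <;> linarith)]
      nlinarith
  · simp [gammaRatio]

/-- On `Γ_k⁺` every eigenvalue is bounded below by a multiple of the trace. -/
theorem neg_le_of_mem_gammaPlus {n k : ℕ} (hk : 1 ≤ k) (hkn : k ≤ n)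
    (h : 2 ≤ k ∨ k = n) {μ : Fin n → ℝ} (hμ : μ ∈ gammaPlus n k) (i : Fin n) :
    0 ≤ μ i + gammaRatio n k * ∑ j, μ j := by
  have hσ1 : 0 < ∑ j, μ j := by rw [← sigmaFn_one]; exact hμ 1 le_rfl hk
  by_cases hk2 : 2 ≤ k
  swap
  · have hn1 : n = 1 := by omega
    subst hn1
    have : gammaRatio 1 k = 0 := by
      have : k = 1 := by omega
      subst this; simp [gammaRatio]
    rw [this, zero_mul, add_zero]
    have := Fintype.sum_subsingleton μ i
    linarith
  set p : ℝ[X] := ∏ i, (X + C (μ i)) with hp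
  have hdeg : p.natDegree = n := by
    rw [hp, natDegree_prod_of_monic _ _ fun i _ => monic_X_add_C _]; simp
  have hmonic : p.Monic := monic_prod_of_monic _ _ fun i _ => monic_X_add_C _
  have hsplits : p.Splits := Splits.prod fun i _ => Splits.X_add_C _
  have hn2 : (2 : ℝ) ≤ n := by exact_mod_cast hk2.trans hkn
  have hcoef : ∀ j, n - k ≤ j → j ≤ n → 0 < p.coeff j := by
    intro j hj hjn
    rw [hp, coeff_prod_X_add_C_eq_sigmaFn μ hjn]
    rcases Nat.eq_zero_or_pos (n - j) with h0 | h0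
    · rw [h0, sigmaFn_zero]; exact one_pos
    · exact hμ _ h0 (by omega)
  -- Differentiating `n - k` times leaves positive multiples of `σ_0, …, σ_k` as coefficients, all
  -- positive on `Γ_k⁺`.
  have hder : ∀ t : ℝ, 0 < t → 0 < (derivative^[n - k] p).eval t := by
    intro t ht
    rw [eval_eq_sum_range]
    have hc : ∀ j, j ≤ k → 0 < (derivative^[n - k] p).coeff j := by
      intro j hj
      rw [coeff_iterate_derivative, nsmul_eq_mul]
      refine mul_pos ?_ (hcoef _ (by omega) (by omega))
      exact_mod_cast Nat.descFactorial_pos.2 (by omega)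
    have hd : (derivative^[n - k] p).natDegree ≤ k := by
      have := natDegree_iterate_derivative p (n - k)
      omega
    apply Finset.sum_pos
    · intro j hj
      have := Finset.mem_range.1 hj
      exact mul_pos (hc j (by omega)) (pow_pos ht j)
    · exact ⟨0, by simp⟩
  have hkd : k + (n - k) = n := by omega
  -- The roots of `p` are the `-μ i`, of mean `-σ₁ / n`; if the claim failed, `-μ i` would lie
  -- beyond the bound for the largest root.
  have hmain := eval_pos_of_iterate_derivative_pos hk2 (a := (∑ j, μ j) / n) (n - k) p hsplits
    (by rw [hmonic.leadingCoeff]; exact one_pos) (by omega) (by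
      rw [hkd, hp, coeff_prod_X_add_C_eq_sigmaFn μ (by omega),
        coeff_prod_X_add_C_eq_sigmaFn μ le_rfl, Nat.sub_self, sigmaFn_zero,
        show n - (n - 1) = 1 by omega, sigmaFn_one]
      field_simp) hder (t := - μ i)
  by_contra! hcon
  have hk1 : (1 : ℝ) < k := by exact_mod_cast hk2
  have hpos := hmain (by
    have hcast : ((n - k : ℕ) : ℝ) = n - k := by rw [Nat.cast_sub hkn]
    have h3 : (∑ j, μ j) / n * (k + (n - k : ℕ) - 1) / (k - 1) - (∑ j, μ j) / n
      = gammaRatio n k * ∑ j, μ j := by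
      rw [hcast, gammaRatio]
      have : (k : ℝ) - 1 ≠ 0 := by linarith
      field_simp
      ring
    rw [h3]
    linarith)
  have : p.eval (- μ i) = 0 := by
    rw [hp, eval_prod]
    exact Finset.prod_eq_zero (Finset.mem_univ i) (by simp)
  rw [this] at hpos
  exact lt_irrefl _ hpos

end RealRooted

/-! ### Quadratic forms and eigenvalues of symmetric matrices. -/

section SymmetricMatrices

open scoped RealInnerProductSpace Matrix

/-- The quadratic form of a matrix. -/
noncomputable def matQuad {n : ℕ} (M : Matrix (Fin n) (Fin n) ℝ) (ξ : Euc n) : ℝ :=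
  ξ.ofLp ⬝ᵥ M *ᵥ ξ.ofLp

variable {n : ℕ} {A B : Matrix (Fin n) (Fin n) ℝ}

theorem matQuad_eq_sum (M : Matrix (Fin n) (Fin n) ℝ) (ξ : Euc n) :
    matQuad M ξ = ∑ i, ∑ j, M i j * ξ i * ξ j := by
  simp only [matQuad, dotProduct, Matrix.mulVec, Finset.mul_sum]
  exact Finset.sum_congr rfl fun i _ => Finset.sum_congr rfl fun j _ => by ring

theorem matQuad_add (M N : Matrix (Fin n) (Fin n) ℝ) (ξ : Euc n) :
    matQuad (M + N) ξ = matQuad M ξ + matQuad N ξ := by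
  simp [matQuad, Matrix.add_mulVec]

theorem matQuad_sub (M N : Matrix (Fin n) (Fin n) ℝ) (ξ : Euc n) :
    matQuad (M - N) ξ = matQuad M ξ - matQuad N ξ := by
  simp [matQuad, Matrix.sub_mulVec]

theorem matQuad_smul_one (t : ℝ) (ξ : Euc n) :
    matQuad (t • (1 : Matrix (Fin n) (Fin n) ℝ)) ξ = t * ‖ξ‖ ^ 2 := by
  rw [EuclideanSpace.norm_sq_eq]
  simp only [matQuad, Matrix.smul_mulVec, Matrix.one_mulVec, dotProduct, Finset.mul_sum]
  exact Finset.sum_congr rfl fun i _ => by simp; ring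

theorem matQuad_eq_sum_eigenvalues (hA : A.IsHermitian) (ξ : Euc n) :
    matQuad A ξ = ∑ i, hA.eigenvalues i * ⟪hA.eigenvectorBasis i, ξ⟫ ^ 2 := by
  have h1 : matQuad A ξ = ⟪Matrix.toEuclideanLin A ξ, ξ⟫ := by
    rw [EuclideanSpace.inner_eq_star_dotProduct]
    simp [matQuad]
  rw [h1, ← hA.eigenvectorBasis.sum_inner_mul_inner]
  refine Finset.sum_congr rfl fun i _ => ?_
  have h2 : Matrix.toEuclideanLin A (hA.eigenvectorBasis i)
      = hA.eigenvalues i • hA.eigenvectorBasis i := by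
    ext j
    have := congrFun (hA.mulVec_eigenvectorBasis i) j
    simpa using this
  rw [Matrix.isSymmetric_toEuclideanLin_iff.2 hA, h2, inner_smul_right, real_inner_comm ξ]
  ring

/-- Strict Weyl monotonicity of the ordered eigenvalues. -/
theorem eigenvalues_lt_of_matQuad (hA : A.IsHermitian) (hB : B.IsHermitian)
    (h : ∀ ξ : Euc n, ξ ≠ 0 → matQuad A ξ < matQuad B ξ) (i : Fin n) :
    hA.eigenvalues i < hB.eigenvalues i := by
  set e := (Fintype.equivOfCardEq (Fintype.card_fin (Fintype.card (Fin n)))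
    : Fin (Fintype.card (Fin n)) ≃ Fin n).symm with he
  have hAe : ∀ j, hA.eigenvalues j = hA.eigenvalues₀ (e j) := fun j => rfl
  have hBe : ∀ j, hB.eigenvalues j = hB.eigenvalues₀ (e j) := fun j => rfl
  -- There are only `n - 1` conditions, so some `ξ ≠ 0` meets them all. It is orthogonal to the
  -- eigenvectors of `A` after position `i` and to those of `B` before it, in decreasing order of
  -- eigenvalues. Hence `λ_i(A) ‖ξ‖² ≤ A(ξ) < B(ξ) ≤ λ_i(B) ‖ξ‖²`.
  set F : Euc n →ₗ[ℝ] ({j : Fin n // j ≠ i} → ℝ) := LinearMap.pi fun j =>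
    if e i < e j then (innerₛₗ ℝ (hA.eigenvectorBasis j) : Euc n →ₗ[ℝ] ℝ)
    else innerₛₗ ℝ (hB.eigenvectorBasis j) with hF
  have hker : F.ker ≠ ⊥ := by
    apply LinearMap.ker_ne_bot_of_finrank_lt
    have hi := i.pos
    simp only [Module.finrank_fintype_fun_eq_card, finrank_euclideanSpace, Fintype.card_fin,
      ne_eq, Fintype.card_subtype_compl, Fintype.card_unique]
    omega
  obtain ⟨ξ, hξ, hξ0⟩ := Submodule.exists_mem_ne_zero_of_ne_bot hker
  have hFξ : ∀ j : {j : Fin n // j ≠ i}, F ξ j = 0 := fun j => by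
    rw [LinearMap.mem_ker.1 hξ]; rfl
  have hAξ : ∀ j, e i < e j → ⟪hA.eigenvectorBasis j, ξ⟫ = 0 := by
    intro j hj
    have := hFξ ⟨j, fun h => by rw [h] at hj; exact lt_irrefl _ hj⟩
    simpa [hF, hj] using this
  have hBξ : ∀ j, e j < e i → ⟪hB.eigenvectorBasis j, ξ⟫ = 0 := by
    intro j hj
    have := hFξ ⟨j, fun h => by rw [h] at hj; exact lt_irrefl _ hj⟩
    simpa [hF, hj.not_gt] using this
  have hlow : hA.eigenvalues i * ‖ξ‖ ^ 2 ≤ matQuad A ξ := by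
    rw [matQuad_eq_sum_eigenvalues hA, ← hA.eigenvectorBasis.sum_sq_norm_inner_right ξ,
      Finset.mul_sum]
    refine Finset.sum_le_sum fun j _ => ?_
    rw [Real.norm_eq_abs, sq_abs]
    rcases lt_or_ge (e i) (e j) with hj | hj
    · rw [hAξ j hj]; simp
    · rw [hAe, hAe]
      exact mul_le_mul_of_nonneg_right (hA.eigenvalues₀_antitone hj) (sq_nonneg _)
  have hup : matQuad B ξ ≤ hB.eigenvalues i * ‖ξ‖ ^ 2 := by
    rw [matQuad_eq_sum_eigenvalues hB, ← hB.eigenvectorBasis.sum_sq_norm_inner_right ξ,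
      Finset.mul_sum]
    refine Finset.sum_le_sum fun j _ => ?_
    rw [Real.norm_eq_abs, sq_abs]
    rcases lt_or_ge (e j) (e i) with hj | hj
    · rw [hBξ j hj]; simp
    · rw [hBe, hBe]
      exact mul_le_mul_of_nonneg_right (hB.eigenvalues₀_antitone hj) (sq_nonneg _)
  have hpos : 0 < ‖ξ‖ ^ 2 := by have := norm_pos_iff.2 hξ0; positivity
  have := h ξ hξ0
  by_contra! hcon
  nlinarith

theorem posDef_of_matQuad (hA : A.IsHermitian) (h : ∀ ξ : Euc n, ξ ≠ 0 → 0 < matQuad A ξ) :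
    A.PosDef := by
  refine Matrix.posDef_iff_dotProduct_mulVec.2 ⟨hA, fun x hx => ?_⟩
  have := h (WithLp.toLp 2 x) (by simpa using hx)
  simpa [matQuad] using this

theorem matQuad_pos_of_posDef (hA : A.PosDef) {ξ : Euc n} (hξ : ξ ≠ 0) : 0 < matQuad A ξ := by
  have := (Matrix.posDef_iff_dotProduct_mulVec.1 hA).2 (x := ξ.ofLp) (by simpa using hξ)
  simpa [matQuad] using this

theorem mem_gammaPlus_of_pos {μ : Fin n → ℝ} (h : ∀ i, 0 < μ i) : μ ∈ gammaPlus n n := by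
  intro j _ hj
  refine Finset.sum_pos (fun s _ => Finset.prod_pos fun i _ => h i) ?_
  exact Finset.powersetCard_nonempty.2 (by simpa using hj)

theorem pos_of_mem_gammaPlus (hn : 1 ≤ n) {μ : Fin n → ℝ} (h : μ ∈ gammaPlus n n) (i : Fin n) :
    0 < μ i := by
  have h1 := neg_le_of_mem_gammaPlus hn le_rfl (Or.inr rfl) h i
  have h2 : gammaRatio n n = 0 := by simp [gammaRatio]
  rw [h2, zero_mul, add_zero] at h1
  refine lt_of_le_of_ne h1 fun h0 => ?_
  have h3 := h n hn le_rfl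
  have h4 : sigmaFn n μ = ∏ i, μ i := by
    have := Finset.powersetCard_self (Finset.univ : Finset (Fin n))
    rw [Finset.card_univ, Fintype.card_fin] at this
    simp [sigmaFn, this]
  rw [h4, Finset.prod_eq_zero (Finset.mem_univ i) h0.symm] at h3
  exact lt_irrefl _ h3

theorem eigenvalueVec_eq (hA : A.IsHermitian) : eigenvalueVec A = hA.eigenvalues := by
  unfold eigenvalueVec
  exact dif_pos hA

/-- The trace cone condition for matrices with eigenvalues in `Γ_k⁺`. -/
theorem matQuad_add_trace_nonneg {k : ℕ} (hk : 1 ≤ k) (hkn : k ≤ n) (h : 2 ≤ k ∨ k = n)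
    (hA : A.IsHermitian) (hmem : eigenvalueVec A ∈ gammaPlus n k) (ξ : Euc n) :
    0 ≤ matQuad A ξ + gammaRatio n k * A.trace * ‖ξ‖ ^ 2 := by
  rw [eigenvalueVec_eq hA] at hmem
  have htr : A.trace = ∑ i, hA.eigenvalues i := by simpa using hA.trace_eq_sum_eigenvalues
  rw [matQuad_eq_sum_eigenvalues hA, htr, ← hA.eigenvectorBasis.sum_sq_norm_inner_right ξ,
    Finset.mul_sum, ← Finset.sum_add_distrib]
  refine Finset.sum_nonneg fun i _ => ?_
  rw [Real.norm_eq_abs, sq_abs, ← add_mul]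
  exact mul_nonneg (neg_le_of_mem_gammaPlus hk hkn h hmem i) (sq_nonneg _)

end SymmetricMatrices

/-! ### Hessians of test functions, and gradients at contact points. -/

section HessianMatrix

open scoped RealInnerProductSpace Matrix

variable {n : ℕ}

/-- The real inner product as a continuous bilinear map. -/
noncomputable def innerCLM (n : ℕ) : Euc n →L[ℝ] Euc n →L[ℝ] ℝ := innerSL ℝ

theorem innerCLM_apply (v w : Euc n) : innerCLM n v w = ⟪v, w⟫ := rfl

theorem sum_smul_single (ξ : Euc n) :
    ∑ i, ξ i • EuclideanSpace.single i (1 : ℝ) = ξ := by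
  simpa using (EuclideanSpace.basisFun (Fin n) ℝ).sum_repr ξ

theorem matQuad_hessMatrix (φ : Euc n → ℝ) (x ξ : Euc n) :
    matQuad (hessMatrix φ x) ξ = fderiv ℝ (fderiv ℝ φ) x ξ ξ := by
  conv_rhs => rw [← sum_smul_single ξ]
  simp only [map_sum, map_smul, _root_.sum_apply, _root_.smul_apply,
    smul_eq_mul, matQuad_eq_sum, hessMatrix, Matrix.of_apply, Finset.mul_sum]
  rw [Finset.sum_comm]
  exact Finset.sum_congr rfl fun i _ => Finset.sum_congr rfl fun j _ => by ring

theorem isHermitian_hessMatrix {φ : Euc n → ℝ} (hφ : ContDiff ℝ 2 φ) (x : Euc n) :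
    (hessMatrix φ x).IsHermitian := by
  ext i j
  simpa [hessMatrix] using
    (hφ.contDiffAt.isSymmSndFDerivAt (by simp) : IsSymmSndFDerivAt ℝ φ x) _ _

theorem hessMatrix_sub_mul_norm_sq {φ : Euc n → ℝ} (hφ : ContDiff ℝ 2 φ) (C : ℝ) (x : Euc n) :
    hessMatrix (fun y => φ y - C * ‖y‖ ^ 2) x
      = hessMatrix φ x - (2 * C) • (1 : Matrix (Fin n) (Fin n) ℝ) := by
  have h1 : fderiv ℝ (fun y => φ y - C * ‖y‖ ^ 2)
      = fun y => fderiv ℝ φ y - ((2 * C) • innerCLM n) y := by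
    funext y
    have h2 := (hφ.differentiable (by norm_num) y).hasFDerivAt.sub
      ((hasStrictFDerivAt_norm_sq y).hasFDerivAt.const_mul C)
    rw [show (fun y => φ y - C * ‖y‖ ^ 2) = (φ - fun y => C * ‖y‖ ^ 2) from rfl, h2.fderiv]
    ext v
    simp [innerCLM_apply]
    ring
  have h3 : fderiv ℝ (fderiv ℝ fun y => φ y - C * ‖y‖ ^ 2) x
      = fderiv ℝ (fderiv ℝ φ) x - ((2 * C) • innerCLM n) := by
    rw [h1]
    have h4 : DifferentiableAt ℝ (fderiv ℝ φ) x :=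
      (hφ.fderiv_right (m := 1) (by norm_num)).differentiable (by norm_num) x
    exact (h4.hasFDerivAt.sub (ContinuousLinearMap.hasFDerivAt _)).fderiv
  ext i j
  simp only [hessMatrix, h3, Matrix.of_apply, Matrix.sub_apply, Matrix.smul_apply,
    Matrix.one_apply, _root_.sub_apply, _root_.smul_apply,
    innerCLM_apply, EuclideanSpace.inner_single_left, smul_eq_mul]
  simp

theorem IsParaboloid.contDiff {φ : Euc n → ℝ} (hφ : IsParaboloid φ) : ContDiff ℝ 2 φ := by
  obtain ⟨c, b, A, h⟩ := hφ
  rw [funext h]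
  fun_prop

theorem isParaboloid_add_inner (c : ℝ) (l : Euc n →L[ℝ] ℝ) (B : Euc n →L[ℝ] Euc n) :
    IsParaboloid fun x => c + l x + ⟪B x, x⟫ := by
  refine ⟨c, fun i => l (EuclideanSpace.single i 1), Matrix.of fun i j =>
    ⟪B (EuclideanSpace.single i 1), EuclideanSpace.single j 1⟫, fun x => ?_⟩
  have h1 : l x = ∑ i, l (EuclideanSpace.single i 1) * x i := by
    conv_lhs => rw [← sum_smul_single x]
    simp [mul_comm]
  have h2 : ⟪B x, x⟫ = ∑ i, ∑ j,
      ⟪B (EuclideanSpace.single i 1), EuclideanSpace.single j 1⟫ * x i * x j := by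
    conv_lhs => rw [← sum_smul_single x]
    simp only [map_sum, map_smul, sum_inner, inner_sum, inner_smul_left, inner_smul_right,
      Finset.mul_sum]
    rw [Finset.sum_comm]
    exact Finset.sum_congr rfl fun i _ => Finset.sum_congr rfl fun j _ => by
      simp only [conj_trivial]; ring
  simp only [h1, h2, Matrix.of_apply]

theorem isParaboloid_quadratic (a : ℝ) (x₀ p : Euc n) (A : Euc n →L[ℝ] Euc n) (C : ℝ) :
    IsParaboloid fun z => a + ⟪p, z - x₀⟫ + ⟪A (z - x₀), z - x₀⟫ / 2 - C * ‖z‖ ^ 2 := by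
  convert isParaboloid_add_inner (a - ⟪p, x₀⟫ + ⟪A x₀, x₀⟫ / 2)
    (innerSL ℝ p - (1 / 2 : ℝ) • innerSL ℝ (A x₀) - (1 / 2 : ℝ) • (innerSL ℝ x₀).comp A)
    ((1 / 2 : ℝ) • A - C • ContinuousLinearMap.id ℝ (Euc n)) using 2 with z
  simp only [map_sub, inner_sub_left, inner_sub_right, _root_.sub_apply,
    _root_.smul_apply, innerSL_apply_apply, ContinuousLinearMap.comp_apply,
    inner_smul_left, real_inner_self_eq_norm_sq, ContinuousLinearMap.id_apply, smul_eq_mul,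
    conj_trivial, real_inner_comm (A z) x₀]
  ring

theorem fderiv_fderiv_quadratic (a : ℝ) (x₀ p : Euc n) (A : Euc n →L[ℝ] Euc n) (x v w : Euc n) :
    fderiv ℝ (fderiv ℝ fun z => a + ⟪p, z - x₀⟫ + ⟪A (z - x₀), z - x₀⟫ / 2) x v w
      = (⟪A v, w⟫ + ⟪A w, v⟫) / 2 := by
  set T : Euc n →L[ℝ] Euc n →L[ℝ] ℝ := (1 / 2 : ℝ) • ((innerCLM n).comp A +
    ((innerCLM n).comp A).flip) with hT
  have hTv : ∀ v w, T v w = (⟪A v, w⟫ + ⟪A w, v⟫) / 2 := fun v w => by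
    change (1 / 2 : ℝ) * (⟪A v, w⟫ + ⟪A w, v⟫) = _
    ring
  have h1 : fderiv ℝ (fun z => a + ⟪p, z - x₀⟫ + ⟪A (z - x₀), z - x₀⟫ / 2)
      = fun z => innerSL ℝ p + T (z - x₀) := by
    funext z
    have hs : HasFDerivAt (fun z : Euc n => z - x₀) (ContinuousLinearMap.id ℝ (Euc n)) z :=
      (hasFDerivAt_id z).sub_const x₀
    have h2 := (((innerSL ℝ p).hasFDerivAt.comp z hs).const_add a).add
      (((A.hasFDerivAt.comp z hs).inner ℝ hs).const_mul (1 / 2 : ℝ))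
    have h3 : HasFDerivAt (fun z => a + ⟪p, z - x₀⟫ + ⟪A (z - x₀), z - x₀⟫ / 2)
        (innerSL ℝ p + T (z - x₀)) z := by
      refine (h2.congr_fderiv ?_).congr_of_eventuallyEq (Eventually.of_forall fun y => ?_)
      · ext v
        simp only [_root_.add_apply, hTv]
        simp [fderivInnerCLM_apply]
        ring
      · simp; ring
    exact h3.fderiv
  have h4 : HasFDerivAt (fun z => innerSL ℝ p + T (z - x₀))
      (T.comp (ContinuousLinearMap.id ℝ (Euc n))) x :=
    (T.hasFDerivAt.comp x ((hasFDerivAt_id x).sub_const x₀)).const_add _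
  rw [h1, h4.fderiv]
  simp [hTv]

/-- Moving in the direction `-g`, `φ` decreases at rate `‖g‖²` while `w ≤ φ` can decrease at rate at
most `K ‖g‖`. -/
theorem gradient_norm_le_of_touchesAbove {φ w : Euc n → ℝ} {K : ℝ≥0} {x₀ : Euc n} {s : Set (Euc n)}
    (hs : s ∈ 𝓝 x₀) (hw : LipschitzOnWith K w s) (hφ : DifferentiableAt ℝ φ x₀)
    (h : TouchesAbove φ w x₀) : ‖gradient φ x₀‖ ≤ K := by
  set g := gradient φ x₀ with hg
  have h1 : HasDerivAt (fun t : ℝ => φ (x₀ + t • -g)) (fderiv ℝ φ x₀ (-g)) 0 := by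
    have h2 : HasDerivAt (fun t : ℝ => x₀ + t • -g) (-g) 0 := by
      simpa using ((hasDerivAt_id (0 : ℝ)).smul_const (-g)).const_add x₀
    have h3 : HasFDerivAt φ (fderiv ℝ φ x₀) (x₀ + (0 : ℝ) • -g) := by
      simpa using hφ.hasFDerivAt
    exact h3.comp_hasDerivAt 0 h2
  have h4 : fderiv ℝ φ x₀ (-g) = -‖g‖ ^ 2 := by
    rw [← real_inner_self_eq_norm_sq, ← inner_neg_right]
    exact (InnerProductSpace.toDual_symm_apply).symm
  have hc : Tendsto (fun t : ℝ => x₀ + t • -g) (𝓝[>] 0) (𝓝 x₀) := by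
    have : Continuous fun t : ℝ => x₀ + t • -g := by fun_prop
    simpa using (this.tendsto 0).mono_left nhdsWithin_le_nhds
  have h5 : -(K * ‖g‖) ≤ -‖g‖ ^ 2 := by
    rw [← h4]
    refine ge_of_tendsto h1.tendsto_slope_zero_right ?_
    filter_upwards [hc h.2, hc hs, self_mem_nhdsWithin] with t ht hts ht0
    have ht0 : 0 < t := ht0
    have h6 := hw.dist_le_mul _ hts _ (mem_of_mem_nhds hs)
    rw [Real.dist_eq, dist_self_add_left, norm_smul, norm_neg, Real.norm_eq_abs,
      abs_of_pos ht0] at h6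
    have h7 := (abs_le.1 h6).1
    have h8 : w (x₀ + t • -g) ≤ φ (x₀ + t • -g) := ht
    simp only [zero_add, zero_smul, add_zero, smul_eq_mul]
    rw [h.1, inv_mul_eq_div, le_div_iff₀ ht0]
    linarith
  rcases (norm_nonneg g).eq_or_lt with h0 | h0
  · rw [← h0]; exact K.2
  · nlinarith

end HessianMatrix

/-! ### From viscosity subsolutions to `k`-convexity and differentiability. -/

section KConvexity

open scoped RealInnerProductSpace Matrix

variable {n k : ℕ}

theorem TouchesAbove.sub_mul_norm_sq {φ w : Euc n → ℝ} {C : ℝ} {x₀ : Euc n}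
    (h : TouchesAbove φ (fun x => w x + C * ‖x‖ ^ 2) x₀) :
    TouchesAbove (fun x => φ x - C * ‖x‖ ^ 2) w x₀ :=
  ⟨by simp [h.1], h.2.mono fun x hx => by linarith⟩

/-- On bounded sets of gradients, the lower order term is bounded as a quadratic form. -/
theorem IsAdmissibleL.exists_matQuad_lt {L : Euc n → Euc n → Matrix (Fin n) (Fin n) ℝ}
    (hL : IsAdmissibleL L) (K : ℝ) :
    ∃ M : ℝ, 0 ≤ M ∧ ∀ x ∈ unitBall n, ∀ p : Euc n, ‖p‖ ≤ K → ∀ ξ : Euc n, ξ ≠ 0 →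
      matQuad (L x p) ξ < M * ‖ξ‖ ^ 2 := by
  have hc : IsCompact (closedUnitBall n ×ˢ Metric.closedBall (0 : Euc n) K) :=
    (isCompact_closedBall _ _).prod (isCompact_closedBall _ _)
  have hb : ∀ i j : Fin n, ∃ M : ℝ, ∀ z ∈ closedUnitBall n ×ˢ Metric.closedBall (0 : Euc n) K,
      ‖L z.1 z.2 i j‖ ≤ M := fun i j =>
    hc.exists_bound_of_continuousOn
      ((hL.contDiffOn i j).continuousOn.mono (prod_mono_right (subset_univ _)))
  choose M hM using hb
  -- The added `1` gives strictness, needed because `Γ_n⁺` is open.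
  refine ⟨∑ i, ∑ j, |M i j| + 1, by positivity, fun x hx p hp ξ hξ => ?_⟩
  have hξ0 : 0 < ‖ξ‖ ^ 2 := by positivity
  have h1 : matQuad (L x p) ξ ≤ (∑ i, ∑ j, |M i j|) * ‖ξ‖ ^ 2 := by
    rw [matQuad_eq_sum, Finset.sum_mul]
    refine Finset.sum_le_sum fun i _ => ?_
    rw [Finset.sum_mul]
    refine Finset.sum_le_sum fun j _ => ?_
    have h2 := (hM i j (x, p) ⟨Metric.ball_subset_closedBall hx, by simpa using hp⟩).trans
      (le_abs_self _)
    have h3 : ‖ξ i‖ * ‖ξ j‖ ≤ ‖ξ‖ ^ 2 := by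
      rw [sq]
      exact mul_le_mul (PiLp.norm_apply_le ξ i) (PiLp.norm_apply_le ξ j) (norm_nonneg _)
        (norm_nonneg _)
    calc L x p i j * ξ i * ξ j ≤ ‖L x p i j * ξ i * ξ j‖ := le_abs_self _
      _ = ‖L x p i j‖ * (‖ξ i‖ * ‖ξ j‖) := by rw [norm_mul, norm_mul, mul_assoc]
      _ ≤ |M i j| * ‖ξ‖ ^ 2 := mul_le_mul h2 h3 (by positivity) (abs_nonneg _)
  linarith

/-- Both eigenvalue vectors are ordered in the same way, so by Weyl monotonicity their difference
lies in `Γ_n⁺`. -/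
theorem eigenvalueVec_mem_of_matQuad_lt {f : (Fin n → ℝ) → ℝ} {Γ : Set (Fin n → ℝ)}
    (hf : IsAdmissiblePair f Γ) {A B : Matrix (Fin n) (Fin n) ℝ} (hA : A.IsHermitian)
    (hB : B.IsHermitian) (h : ∀ ξ : Euc n, ξ ≠ 0 → matQuad A ξ < matQuad B ξ)
    (hmem : eigenvalueVec A ∈ Γ) : eigenvalueVec B ∈ Γ := by
  have h1 := hf.add_mem _ hmem (fun i => hB.eigenvalues i - hA.eigenvalues i)
    (mem_gammaPlus_of_pos fun i => sub_pos.2 (eigenvalues_lt_of_matQuad hA hB h i))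
  rw [eigenvalueVec_eq hA] at h1
  rw [eigenvalueVec_eq hB]
  convert h1 using 1
  ext i
  simp

/-- Membership in `Γ_n⁺` means positive definiteness, which is invariant under congruence; hence a
general `W` is allowed when `k = n`. -/
theorem eigenvalueVec_mem_of_conj {A B P : Matrix (Fin n) (Fin n) ℝ} (hn : 1 ≤ n)
    (hP : P.PosDef) (hA : A.IsHermitian) (hB : B.IsHermitian)
    (h : ∀ ξ : Euc n, ξ ≠ 0 → matQuad A ξ < matQuad B ξ)
    (hmem : eigenvalueVec (P * A * P) ∈ gammaPlus n n) : eigenvalueVec B ∈ gammaPlus n n := by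
  have hPh : Pᴴ = P := hP.isHermitian
  have hPAP : (P * A * P).IsHermitian := by
    have := Matrix.isHermitian_conjTranspose_mul_mul P hA
    rwa [hPh] at this
  rw [eigenvalueVec_eq hPAP] at hmem
  have h1 : (P * A * P).PosDef :=
    hPAP.posDef_iff_eigenvalues_pos.2 (pos_of_mem_gammaPlus hn hmem)
  have h2 : A.PosDef := by
    refine (Matrix.IsUnit.posDef_star_left_conjugate_iff hP.isUnit).1 ?_
    rwa [Matrix.star_eq_conjTranspose, hPh]
  have h3 : B.PosDef := posDef_of_matQuad hB fun ξ hξ =>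
    (matQuad_pos_of_posDef h2 hξ).trans (h ξ hξ)
  rw [eigenvalueVec_eq hB]
  exact mem_gammaPlus_of_pos h3.eigenvalues_pos

/-- A viscosity subsolution becomes `k`-convex after adding a large multiple of `‖x‖²`. -/
theorem IsViscositySubsolution.isKConvex {L : Euc n → Euc n → Matrix (Fin n) (Fin n) ℝ}
    (hk : 1 ≤ k) (hL : IsAdmissibleL L) {K : ℝ≥0} {C : ℝ}
    (hC : ∀ x ∈ unitBall n, ∀ p : Euc n, ‖p‖ ≤ K → ∀ ξ : Euc n, ξ ≠ 0 →
      matQuad (L x p) ξ < 2 * C * ‖ξ‖ ^ 2)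
    {f : (Fin n → ℝ) → ℝ} {Γ : Set (Fin n → ℝ)} {W : Euc n → Matrix (Fin n) (Fin n) ℝ}
    {R w : Euc n → ℝ} (hf : IsAdmissiblePair f Γ) (hΓ : Γ ⊆ gammaPlus n k)
    (hW : IsAdmissibleW W) (hWk : (∀ x ∈ unitBall n, W x = 1) ∨ k = n)
    (hw : LipschitzOnWith K w (unitBall n)) (hsol : IsViscositySubsolution f Γ L W R w) :
    IsKConvex k fun x => w x + C * ‖x‖ ^ 2 := by
  refine ⟨hw.continuousOn.add (by fun_prop), fun x₀ hx₀ φ hφ htouch => ?_⟩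
  have hφ2 := hφ.contDiff
  set ψ : Euc n → ℝ := fun x => φ x - C * ‖x‖ ^ 2 with hψ
  have hψ2 : ContDiff ℝ 2 ψ := hφ2.sub (contDiff_const.mul (contDiff_norm_sq ℝ))
  have hψt : TouchesAbove ψ w x₀ := htouch.sub_mul_norm_sq
  have hmem := (hsol.2 x₀ hx₀ ψ hψ2.contDiffOn hψt).1
  have hgrad : ‖gradient ψ x₀‖ ≤ K := gradient_norm_le_of_touchesAbove
    (Metric.isOpen_ball.mem_nhds hx₀) hw (hψ2.differentiable (by norm_num) x₀) hψt
  have hB := isHermitian_hessMatrix hφ2 x₀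
  have hA : (hessMatrix ψ x₀ + L x₀ (gradient ψ x₀)).IsHermitian :=
    (isHermitian_hessMatrix hψ2 x₀).add (by
      have := hL.symm x₀ (Metric.ball_subset_closedBall hx₀) (gradient ψ x₀)
      exact (Matrix.conjTranspose_eq_transpose_of_trivial _).trans this)
  have hlt : ∀ ξ : Euc n, ξ ≠ 0 →
      matQuad (hessMatrix ψ x₀ + L x₀ (gradient ψ x₀)) ξ < matQuad (hessMatrix φ x₀) ξ := by
    intro ξ hξ
    rw [matQuad_add, hψ, hessMatrix_sub_mul_norm_sq hφ2, matQuad_sub, matQuad_smul_one]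
    linarith [hC x₀ hx₀ _ hgrad ξ hξ]
  rw [operatorEigenvalues] at hmem
  rcases hWk with hW1 | rfl
  · rw [hW1 x₀ hx₀, one_mul, mul_one] at hmem
    exact hΓ (eigenvalueVec_mem_of_matQuad_lt hf hA hB hlt hmem)
  · exact eigenvalueVec_mem_of_conj hk (hW.posDef x₀ (Metric.ball_subset_closedBall hx₀)) hA hB
      hlt (hΓ hmem)

/-- Touching by quadratic polynomials turns `k`-convexity into the trace cone condition. -/
theorem IsKConvex.isTraceConvexOn {v : Euc n → ℝ} (hk : 1 ≤ k) (hkn : k ≤ n)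
    (h : 2 ≤ k ∨ k = n) (hv : IsKConvex k v) :
    IsTraceConvexOn (gammaRatio n k) v (unitBall n) := by
  intro x₀ hx₀ p A htouch ξ
  set φ : Euc n → ℝ := fun z => v x₀ + ⟪p, z - x₀⟫ + ⟪A (z - x₀), z - x₀⟫ / 2 with hφ
  have hpar : IsParaboloid φ := by
    simpa only [zero_mul, sub_zero] using isParaboloid_quadratic (v x₀) x₀ p A 0
  have hmem := hv.2 x₀ hx₀ φ hpar ⟨by simp [hφ], htouch⟩
  have h1 := matQuad_add_trace_nonneg hk hkn h (isHermitian_hessMatrix hpar.contDiff x₀) hmem ξ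
  have h2 : matQuad (hessMatrix φ x₀) ξ = ⟪A ξ, ξ⟫ := by
    rw [matQuad_hessMatrix, hφ, fderiv_fderiv_quadratic]
    ring
  have h3 : (hessMatrix φ x₀).trace = opTrace A := by
    rw [opTrace_eq_sum (EuclideanSpace.basisFun (Fin n) ℝ), Matrix.trace]
    refine Finset.sum_congr rfl fun i _ => ?_
    rw [Matrix.diag_apply, hessMatrix, Matrix.of_apply, hφ, fderiv_fderiv_quadratic]
    simp [real_inner_comm]
  rwa [h2, h3] at h1

theorem IsTraceConvexOn.congr {E : Type*} [NormedAddCommGroup E] [InnerProductSpace ℝ E]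
    {c : ℝ} {u v : E → ℝ} {s : Set E} (hs : IsOpen s) (hu : IsTraceConvexOn c u s)
    (huv : EqOn u v s) : IsTraceConvexOn c v s := by
  intro x₀ hx₀ p A htouch
  refine hu x₀ hx₀ p A ?_
  filter_upwards [htouch, hs.mem_nhds hx₀] with x hx hxs
  rwa [huv hxs, huv hx₀]

/-- Lipschitz functions that are `k`-convex up to a multiple of `‖x‖²` are punctually second
order differentiable almost everywhere. -/
theorem IsKConvex.ae_isPunctuallyTwiceDifferentiableAt {w : Euc n → ℝ} {K : ℝ≥0} {C : ℝ}
    (hk : 1 ≤ k) (hkn : k ≤ n) (h : (n : ℝ) / 2 < k ∨ k = n)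
    (hw : LipschitzOnWith K w (unitBall n)) (hv : IsKConvex k fun x => w x + C * ‖x‖ ^ 2) :
    ∀ᵐ x ∂(volume : Measure (Euc n)), x ∈ unitBall n →
      IsPunctuallyTwiceDifferentiableAt w x := by
  have h2 : 2 ≤ k ∨ k = n := by
    rcases h with h | h
    · by_contra! hcon
      have hk1 : k = 1 := by omega
      have hn2 : 2 ≤ n := by omega
      have : (2 : ℝ) ≤ n := by exact_mod_cast hn2
      rw [hk1] at h
      push_cast at h
      linarith
    · exact Or.inr h
  have hlip : LipschitzOnWith (K + 2 * ‖C‖₊) (fun x => w x + C * ‖x‖ ^ 2) (unitBall n) := by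
    refine hw.add (LipschitzOnWith.of_dist_le_mul fun x hx y hy => ?_)
    have hx1 : ‖x‖ < 1 := by simpa using hx
    have hy1 : ‖y‖ < 1 := by simpa using hy
    have h3 : C * ‖x‖ ^ 2 - C * ‖y‖ ^ 2 = C * ((‖x‖ + ‖y‖) * (‖x‖ - ‖y‖)) := by ring
    rw [Real.dist_eq, h3, abs_mul, abs_mul, abs_of_nonneg (by positivity : 0 ≤ ‖x‖ + ‖y‖),
      dist_eq_norm]
    push_cast
    rw [Real.norm_eq_abs]
    have h4 := abs_norm_sub_norm_le x y
    have h5 : (‖x‖ + ‖y‖) * |‖x‖ - ‖y‖| ≤ 2 * ‖x - y‖ :=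
      mul_le_mul (by linarith) h4 (abs_nonneg _) (by norm_num)
    nlinarith [abs_nonneg C]
  -- Conjugates and sup-convolutions need a globally Lipschitz function, whereas the cone condition
  -- is local and stays on the ball.
  obtain ⟨u, hu, huv⟩ := hlip.extend_real
  have htc : IsTraceConvexOn (gammaRatio n k) u (Metric.ball 0 1) :=
    (hv.isTraceConvexOn hk hkn h2).congr Metric.isOpen_ball huv
  have hc : gammaRatio n k * ((Module.finrank ℝ (Euc n) : ℝ) - 2) < 1 := by
    rw [finrank_euclideanSpace_fin]
    exact gammaRatio_mul_lt hk hkn h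
  filter_upwards [htc.ae_expansion (gammaRatio_nonneg hk hkn) hc hu] with x hx hxb
  obtain ⟨p, A, hpA⟩ := hx hxb
  refine ⟨_, isParaboloid_quadratic (u x) x p A C, hpA.congr' ?_ EventuallyEq.rfl⟩
  filter_upwards [Metric.isOpen_ball.mem_nhds hxb] with z hz
  have := huv hz
  simp only at this
  rw [← this]
  ring

end KConvexity

/-! ### The main theorem. -/

theorem theorem3 (n k : ℕ) (hk : 1 ≤ k) (hkn : k ≤ n)
    (L : Euc n → Euc n → Matrix (Fin n) (Fin n) ℝ) (hL : IsAdmissibleL L) (K : ℝ≥0) :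
    ∃ C : ℝ, 0 ≤ C ∧
      ∀ (f : (Fin n → ℝ) → ℝ) (Γ : Set (Fin n → ℝ)) (W : Euc n → Matrix (Fin n) (Fin n) ℝ)
        (R : Euc n → ℝ) (w : Euc n → ℝ),
        IsAdmissiblePair f Γ →
        Γ ⊆ gammaPlus n k →
        IsAdmissibleW W →
        (∀ x ∈ unitBall n, 0 < R x) →
        ((n : ℝ) / 2 < k ∧ (∀ x ∈ unitBall n, W x = 1) ∨ k = n) →
        LipschitzOnWith K w (unitBall n) →
        IsViscositySolution f Γ L W R w →
        IsKConvex k (fun x => w x + C * ‖x‖ ^ 2) ∧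
        ∀ᵐ x ∂(volume : Measure (Euc n)), x ∈ unitBall n →
          IsPunctuallyTwiceDifferentiableAt w x := by
  obtain ⟨M, hM, hLM⟩ := hL.exists_matQuad_lt K
  -- The Hessian of `C ‖x‖²` is `2C I`, so `C = M / 2` matches the bound `M` on `L`.
  refine ⟨M / 2, by positivity, fun f Γ W R w hf hΓ hW _ hkW hw hsol => ?_⟩
  have hv : IsKConvex k fun x => w x + M / 2 * ‖x‖ ^ 2 :=
    hsol.1.isKConvex hk hL (by simpa [mul_div_cancel₀] using hLM) hf hΓ hW
      (hkW.imp And.right id) hw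
  exact ⟨hv, hv.ae_isPunctuallyTwiceDifferentiableAt hk hkn (hkW.imp And.left id) hw⟩
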